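/- Fix an integer $r\ge 2$. In Max Exact $r$-SAT AA an instance is a pair $(F,k)$, where $F$ is a formula consisting of a multiset of $m$ clauses on $n$ variables, each clause having exactly $r$ distinct variables, and $k\ge 0$ is an integer, the parameter; the question is whether some truth assignment satisfies at least $(1-2^{-r})m+k2^{-r}$ clauses. In Max $r$-Lin AA an instance is a pair $(S,k)$, where $S$ is a system of linear equations over $\mathbb F_2$, each in at most $r$ variables and each with a positive integral weight, and $k\ge 0$ is an integer, the parameter; the question is whether some assignment of values to the variables has excess at least $k$, the excess being the total weight of the satisfied equations minus the total weight of the falsified equations. A bikernelization from a parameterized problem $L$ to a parameterized problem $L'$ is a polynomial-time algorithm that maps an instance $(x,k)$ to an instance $(x',k')$ (the bikernel) such that $(x,k)\in L$ if and only if $(x',k')\in L'$, $k'\le f(k)$ and $|x'|\le g(k)$ for some functions $f$ and $g$. If $L=L'$, it is called a kernelization and $(x',k')$ a kernel. The bikernel has $O(k\log k)$ variables if the number of variables of $x'$ is at most $h(k)$ for some function $h:\mathbb N\to\mathbb N$ with $h(k)=O(k\log k)$ as $k\to\infty$. Instances are written as words over a finite alphabet, numbers in binary, and algorithms are deterministic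 multi-stack Turing machines. Then, with all functions and constants depending on $r$ only: 1. There is a bikernelization from Max Exact $r$-SAT AA to Max $r$-Lin AA with $O(k\log k)$ variables. 2. Max Exact $r$-SAT AA has a kernel with $O(k\log k)$ variables. 3. Max Exact $r$-SAT AA can be solved in time $2^{O(k\log k)}+m^{O(1)}$: there are a Turing machine, a constant $c$ and a function $h:\mathbb N\to\mathbb N$ with $h(k)=O(k\log k)$ as $k\to\infty$ such that the machine decides every instance $(F,k)$ in at most $2^{h(k)}+N^{c}$ steps, where $N$ is the length of the word that encodes $(F,k)$, and in at most $2^{h(k)}+m^{c}$ steps if every variable of $F$ occurs in some clause of $F$. -/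

import Mathlib

open Computability Turing Filter Asymptotics

namespace MaxExactSat

/-! ### Parameterized problems, bikernelizations, running time -/

/-- A parameterized problem whose instances `x` are written over the finite alphabet `Γ'`
(two bits, brackets, comma, blank), together with the number of variables of an instance.
`yes x k` says that `(x, k)` is a yes-instance. -/
structure ParamProblem where
  Inst : Type
  enc : Inst → List Γ'
  enc_injective : Function.Injective enc
  numVars : Inst → ℕ
  yes : Inst → ℕ → Prop

/-- A natural number in binary, closed by a comma. -/
def encNat (a : ℕ) : List Γ' := (encodeNat a).map Γ'.bit ++ [Γ'.comma]

/-- The word on which an algorithm works: the parameter in binary, then the instance. -/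
def ParamProblem.encPair (L : ParamProblem) (p : L.Inst × ℕ) : List Γ' :=
  encNat p.2 ++ L.enc p.1

/-- A bikernelization from `L` to `L'`: a polynomial-time map `(x, k) ↦ (x', k')` that preserves
membership, with `k' ≤ f k` and `|x'| ≤ g k` for some functions `f` and `g`. -/
structure IsBikernelization (L L' : ParamProblem) (φ : L.Inst × ℕ → L'.Inst × ℕ) : Prop where
  polyTime : Nonempty (TM2ComputableInPolyTime L.encPair L'.encPair φ)
  yes_iff : ∀ p, L.yes p.1 p.2 ↔ L'.yes (φ p).1 (φ p).2
  param_le : ∃ f : ℕ → ℕ, ∀ p, (φ p).2 ≤ f p.2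
  size_le : ∃ g : ℕ → ℕ, ∀ p, (L'.enc (φ p).1).length ≤ g p.2

/-- `h` is `O(k log k)` as `k → ∞`. -/
def IsBigOKLogK (h : ℕ → ℕ) : Prop :=
  (fun k : ℕ => (h k : ℝ)) =O[atTop] (fun k : ℕ => (k : ℝ) * Real.log (k : ℝ))

/-- There is a bikernel from `L` to `L'` with `O(k log k)` variables. -/
def HasBikernelKLogK (L L' : ParamProblem) : Prop :=
  ∃ φ : L.Inst × ℕ → L'.Inst × ℕ, IsBikernelization L L' φ ∧
    ∃ h : ℕ → ℕ, IsBigOKLogK h ∧ ∀ p, L'.numVars (φ p).1 ≤ h p.2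

/-- A kernel is a bikernel from a problem to itself. -/
def HasKernelKLogK (L : ParamProblem) : Prop := HasBikernelKLogK L L

/-- The Turing machine `M`, started on the pair `(x, k)`, halts after at most `t` steps with the
correct one-bit answer to the question whether `(x, k)` is a yes-instance. -/
def ParamProblem.SolvesIn (L : ParamProblem) (M : TM2ComputableAux Γ' Bool)
    (x : L.Inst) (k t : ℕ) : Prop :=
  ∃ b : Bool, (b = true ↔ L.yes x k) ∧
    Nonempty (TM2OutputsInTime M.tm ((L.encPair (x, k)).map M.inputAlphabet.invFun)
      (some ((encodeBool b).map M.outputAlphabet.invFun)) t)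

/-! ### Encodings -/

/-- `f` is a prefix code. -/
def PrefixCode {α : Type} (f : α → List Γ') : Prop :=
  ∀ a a' s s', f a ++ s = f a' ++ s' → a = a' ∧ s = s'

theorem prefixCode_encNat : PrefixCode encNat := by
  intro a a' s s' h
  have key : ∀ (l l' : List Bool) (s s' : List Γ'),
      l.map Γ'.bit ++ Γ'.comma :: s = l'.map Γ'.bit ++ Γ'.comma :: s' → l = l' ∧ s = s' := by
    intro l
    induction l with
    | nil => intro l' s s' h; cases l' <;> simp_all
    | cons b l ih =>
      intro l' s s' h
      cases l' with
      | nil => simp at h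
      | cons b' l' =>
        simp only [List.map_cons, List.cons_append, List.cons.injEq, Γ'.bit.injEq] at h
        obtain ⟨h1, h2⟩ := ih l' s s' h.2
        exact ⟨by rw [h.1, h1], h2⟩
  obtain ⟨h1, h2⟩ := key (encodeNat a) (encodeNat a') s s' (by simpa [encNat] using h)
  exact ⟨by rw [← decode_encodeNat a, h1, decode_encodeNat], h2⟩

theorem encNat_head (a : ℕ) (s t : List Γ') : encNat a ++ s ≠ Γ'.ket :: t := by
  unfold encNat
  cases encodeNat a <;> simp

/-- A list of codewords of a prefix code, none of which starts with `ket`, closed by `ket`. -/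
theorem PrefixCode.flatMap_ket {α : Type} {f : α → List Γ'} (hf : PrefixCode f)
    (hk : ∀ a s t, f a ++ s ≠ Γ'.ket :: t) :
    PrefixCode (fun l : List α => l.flatMap f ++ [Γ'.ket]) := by
  intro l
  induction l with
  | nil =>
    intro l' s s' h
    cases l' with
    | nil => simpa using h
    | cons a' l' => exact absurd (by simpa using h.symm) (hk a' (l'.flatMap f ++ Γ'.ket :: s') s)
  | cons a l ih =>
    intro l' s s' h
    cases l' with
    | nil => exact absurd (by simpa using h) (hk a (l.flatMap f ++ Γ'.ket :: s) s')
    | cons a' l' =>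
      obtain ⟨h1, h2⟩ := hf a a' (l.flatMap f ++ Γ'.ket :: s) (l'.flatMap f ++ Γ'.ket :: s')
        (by simpa using h)
      obtain ⟨h3, h4⟩ := ih l' s s' (by simpa using h2)
      exact ⟨by rw [h1, h3], h4⟩

/-- A list of nonempty codewords of a prefix code. -/
theorem PrefixCode.flatMap_injective {α : Type} {f : α → List Γ'} (hf : PrefixCode f)
    (hk : ∀ a, f a ≠ []) : Function.Injective (fun l : List α => l.flatMap f) := by
  intro l
  induction l with
  | nil =>
    intro l' h
    cases l' with
    | nil => rfl
    | cons a' l' => simp at h; exact absurd h.1 (hk a')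
  | cons a l ih =>
    intro l' h
    cases l' with
    | nil => simp at h; exact absurd h.1 (hk a)
    | cons a' l' =>
      obtain ⟨h1, h2⟩ := hf a a' _ _ (by simpa using h)
      rw [h1, ih h2]

/-! ### Max Exact `r`-SAT above average -/

/-- A literal: a variable and its sign (`true` for `x`, `false` for `¬ x`). -/
abbrev Literal (n : ℕ) := Fin n × Bool

/-- A clause with exactly `r` distinct variables among `n` variables. -/
@[ext] structure Clause (r n : ℕ) where
  lits : List (Literal n)
  nodup : (lits.map Prod.fst).Nodup
  length_eq : lits.length = r

/-- A clause is satisfied if one of its literals is true. -/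
def Clause.Sat {r n : ℕ} (C : Clause r n) (a : Fin n → Bool) : Prop :=
  ∃ l ∈ C.lits, a l.1 = l.2

instance {r n : ℕ} (C : Clause r n) (a : Fin n → Bool) : Decidable (C.Sat a) := by
  unfold Clause.Sat; infer_instance

/-- An exact `r`-CNF formula: `n` variables and a list (repetitions allowed) of clauses. -/
structure Formula (r : ℕ) where
  n : ℕ
  clauses : List (Clause r n)

/-- The number of clauses. -/
def Formula.m {r : ℕ} (F : Formula r) : ℕ := F.clauses.length

/-- The number of clauses satisfied by `a`, with multiplicity. -/
def Formula.numSat {r : ℕ} (F : Formula r) (a : Fin F.n → Bool) : ℕ :=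
  F.clauses.countP (fun C => decide (C.Sat a))

/-- Every variable of the formula occurs in one of its clauses. -/
def Formula.AllOccur {r : ℕ} (F : Formula r) : Prop :=
  ∀ i : Fin F.n, ∃ C ∈ F.clauses, i ∈ C.lits.map Prod.fst

/-- Some assignment satisfies at least `(1 - 2⁻ʳ) m + k 2⁻ʳ` clauses. -/
def Formula.Yes {r : ℕ} (F : Formula r) (k : ℕ) : Prop :=
  ∃ a : Fin F.n → Bool, (1 - 1 / 2 ^ r : ℝ) * F.m + k * (1 / 2 ^ r) ≤ F.numSat a

def encLit {n : ℕ} (l : Literal n) : List Γ' := Γ'.bit l.2 :: encNat l.1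

def encClause {r n : ℕ} (C : Clause r n) : List Γ' :=
  Γ'.bra :: (C.lits.flatMap encLit ++ [Γ'.ket])

def encFormula {r : ℕ} (F : Formula r) : List Γ' := encNat F.n ++ F.clauses.flatMap encClause

theorem prefixCode_encLit {n : ℕ} : PrefixCode (encLit (n := n)) := by
  rintro ⟨i, b⟩ ⟨i', b'⟩ s s' h
  simp only [encLit, List.cons_append, List.cons.injEq, Γ'.bit.injEq] at h
  obtain ⟨h1, h2⟩ := prefixCode_encNat _ _ _ _ h.2
  exact ⟨Prod.ext (Fin.ext h1) h.1, h2⟩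

theorem prefixCode_encClause {r n : ℕ} : PrefixCode (encClause (r := r) (n := n)) := by
  intro C C' s s' h
  simp only [encClause, List.cons_append, List.cons.injEq, true_and] at h
  obtain ⟨h1, h2⟩ := prefixCode_encLit.flatMap_ket (by simp [encLit]) _ _ _ _ h
  exact ⟨Clause.ext h1, h2⟩

theorem encFormula_injective (r : ℕ) : Function.Injective (encFormula (r := r)) := by
  rintro ⟨n, cs⟩ ⟨n', cs'⟩ h
  obtain ⟨h1, h2⟩ := prefixCode_encNat _ _ _ _ h
  dsimp only at h1
  subst h1
  exact congrArg (Formula.mk n) (prefixCode_encClause.flatMap_injective (by simp [encClause]) h2)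

/-- Max Exact `r`-SAT AA. -/
def maxExactSatAA (r : ℕ) : ParamProblem where
  Inst := Formula r
  enc := encFormula
  enc_injective := encFormula_injective r
  numVars := Formula.n
  yes := Formula.Yes

/-! ### Max `r`-Lin above average -/

/-- A weighted equation `∑ i ∈ vars, z i = rhs` over the two-element field, in at most `r` distinct
variables among `n` variables, with a positive integral weight. The right-hand side is stored as a
bit, see `Equation.Sat`. -/
@[ext] structure Equation (r n : ℕ) where
  vars : List (Fin n)
  rhs : Bool
  weight : ℕ
  nodup : vars.Nodup
  length_le : vars.length ≤ r
  weight_pos : 0 < weight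

/-- `z` satisfies the equation. -/
def Equation.Sat {r n : ℕ} (e : Equation r n) (z : Fin n → ZMod 2) : Prop :=
  (e.vars.map z).sum = if e.rhs then 1 else 0

instance {r n : ℕ} (e : Equation r n) (z : Fin n → ZMod 2) : Decidable (e.Sat z) := by
  unfold Equation.Sat; infer_instance

/-- A weighted system of linear equations in `n` variables. -/
structure LinSystem (r : ℕ) where
  n : ℕ
  eqs : List (Equation r n)

/-- Total weight of the satisfied equations minus total weight of the falsified ones. -/
def LinSystem.excess {r : ℕ} (A : LinSystem r) (z : Fin A.n → ZMod 2) : ℤ :=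
  (A.eqs.map fun e => if e.Sat z then (e.weight : ℤ) else -(e.weight : ℤ)).sum

/-- The maximum excess is at least `k`. -/
def LinSystem.Yes {r : ℕ} (A : LinSystem r) (k : ℕ) : Prop :=
  ∃ z : Fin A.n → ZMod 2, (k : ℤ) ≤ A.excess z

def encEquation {r n : ℕ} (e : Equation r n) : List Γ' :=
  Γ'.bra :: Γ'.bit e.rhs :: (encNat e.weight ++
    (e.vars.flatMap (fun i : Fin n => encNat i) ++ [Γ'.ket]))

def encLinSystem {r : ℕ} (A : LinSystem r) : List Γ' := encNat A.n ++ A.eqs.flatMap encEquation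

theorem prefixCode_encEquation {r n : ℕ} : PrefixCode (encEquation (r := r) (n := n)) := by
  intro e e' s s' h
  simp only [encEquation, List.cons_append, List.cons.injEq, true_and, Γ'.bit.injEq] at h
  obtain ⟨hb, h⟩ := h
  rw [List.append_assoc (encNat e.weight), List.append_assoc (encNat e'.weight)] at h
  obtain ⟨hw, h⟩ := prefixCode_encNat _ _ _ _ h
  have hfin : PrefixCode (fun i : Fin n => encNat i) := by
    intro i i' s s' h
    obtain ⟨h1, h2⟩ := prefixCode_encNat _ _ _ _ h
    exact ⟨Fin.ext h1, h2⟩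
  obtain ⟨hv, h⟩ := hfin.flatMap_ket (fun i => encNat_head _) _ _ _ _ h
  exact ⟨Equation.ext hv hb hw, h⟩

theorem encLinSystem_injective (r : ℕ) : Function.Injective (encLinSystem (r := r)) := by
  rintro ⟨n, es⟩ ⟨n', es'⟩ h
  obtain ⟨h1, h2⟩ := prefixCode_encNat _ _ _ _ h
  dsimp only at h1
  subst h1
  exact congrArg (LinSystem.mk n)
    (prefixCode_encEquation.flatMap_injective (by simp [encEquation]) h2)

/-- Max `r`-Lin AA. -/
def maxLinAA (r : ℕ) : ParamProblem where
  Inst := LinSystem r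
  enc := encLinSystem
  enc_injective := encLinSystem_injective r
  numVars := LinSystem.n
  yes := LinSystem.Yes

/-! ### Solvability in time `2^{O(k log k)} + m^{O(1)}` -/

/-- One Turing machine solves Max Exact `r`-SAT AA in `2^{O(k log k)} + m^{O(1)}` steps on formulas
in which every variable occurs. A machine that reads its input has to pay also for variables that do
not occur; on arbitrary formulas `m` is replaced by the length of the input. -/
def SolvableKLogK (r : ℕ) : Prop :=
  ∃ (M : TM2ComputableAux Γ' Bool) (h : ℕ → ℕ) (c : ℕ), IsBigOKLogK h ∧
    ∀ (F : Formula r) (k : ℕ),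
      (maxExactSatAA r).SolvesIn M F k
        (2 ^ h k + ((maxExactSatAA r).encPair (F, k)).length ^ c) ∧
      (F.AllOccur → (maxExactSatAA r).SolvesIn M F k (2 ^ h k + F.m ^ c))

end MaxExactSat

/-! Give a clause the excess `1` if it is satisfied and `1 - 2 ^ r` if not; then `(F, k)` is a
yes-instance exactly if some assignment has total excess at least `k`. With `s_l = 1` for a true and
`-1` for a false literal, the excess of a clause is `1 - ∏ (1 - s_l)`, and expanding the product
leaves one signed monomial for every nonempty set of literals. Each monomial is the excess of a
linear equation of weight one in at most `r` variables. Merging equations with the same left-hand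
side gives a system of Max `r`-Lin with the same excess at every assignment (`termSum_terms`,
`excess_collect`).

The heart is a lower bound on the maximum excess (`exists_excess_ge_of_rank`). If the left-hand
sides `M` span more vectors than there are sums of fewer than `k` of them, take a vector that is no
such sum and a shortest representation `T` of it. Minimality forbids any subset of `T` with at least
two elements from summing to zero or to an element of `M`. Hence, averaged with the nonnegative
weight `∏ (1 + sign)` over `T`, the equations of `T` contribute their full weight and all others
cancel (`exists_excess_ge_sum`). Since every equation has at most `r` variables, the rank is at
least `n / r`. So either the instance is a trivial yes-instance, or `n ≤ r * k * L` with `L` the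
binary length of `|M|`. As `|M| ≤ (n + 1) ^ r`, this forces `n = O(k log k)` (`le_varBound`). A
weight of at least `k` also settles the instance, so all weights and the size of the remaining
system are bounded in `k`: this is the bikernel.

For the kernel an equation of weight `w` is padded to `r` variables and replaced by `w` copies of
those `2 ^ (r - 1)` clauses whose falsifying assignment violates it. This multiplies the excess by
`2 ^ (r - 1)` (`two_mul_sum_keeps`). For the decision algorithm, all assignments of the reduced
system are tried.

The machines come from a small calculus. Structured programs on stacks compile to `TM2` machines
with exact step counts (`Run.steps`). Data are binary trees on a value stack, and polynomial-time
functions (`PT`, `PTB`) are closed under composition, pairing, case distinction and size-bounded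
folds, out of which the whole algorithm is built. -/

/-! ### Structured stack programs and their compilation to `TM2` machines -/

namespace StackProg

/-- Structured programs over a family of stacks. `pop k f` pops stack `k` and branches on the
symbol found, `loop k final f` pops stack `k` and runs `f o` on the symbol `o` found, until `final o` holds. -/
inductive Cmd (K : Type) (Γ : K → Type) : Type
  | skip : Cmd K Γ
  | push (k : K) (a : Γ k) : Cmd K Γ
  | pop (k : K) (f : Option (Γ k) → Cmd K Γ) : Cmd K Γ
  | seq (c d : Cmd K Γ) : Cmd K Γ
  | loop (k : K) (final : Option (Γ k) → Bool) (f : Option (Γ k) → Cmd K Γ) : Cmd K Γ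

variable {K : Type} {Γ : K → Type}

/-- The labels of the machine that executes a program. -/
def Lbl : Cmd K Γ → Type
  | .skip => Unit
  | .push _ _ => Unit
  | .pop k f => Option (Σ o : Option (Γ k), Lbl (f o))
  | .seq c d => Lbl c ⊕ Lbl d
  | .loop k _ f => Option (Σ o : Option (Γ k), Lbl (f o))

def entry : (c : Cmd K Γ) → Lbl c
  | .skip => ()
  | .push _ _ => ()
  | .pop _ _ => (none : Option _)
  | .seq c _ => Sum.inl (entry c)
  | .loop _ _ _ => (none : Option _)

theorem finite_lbl [∀ k, Finite (Γ k)] (c : Cmd K Γ) : Finite (Lbl c) := by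
  induction c with
  | skip => exact inferInstanceAs (Finite Unit)
  | push => exact inferInstanceAs (Finite Unit)
  | pop k f ih => exact inferInstanceAs (Finite (Option (Σ o : Option (Γ k), Lbl (f o))))
  | seq c d ihc ihd => exact inferInstanceAs (Finite (Lbl c ⊕ Lbl d))
  | loop k _ f ih => exact inferInstanceAs (Finite (Option (Σ o : Option (Γ k), Lbl (f o))))

variable [DecidableEq K]

/-! ### Semantics of programs and correctness of the compilation. -/

/-- Big-step semantics with exact cost. -/
inductive Run : Cmd K Γ → (∀ k, List (Γ k)) → ℕ → (∀ k, List (Γ k)) → Prop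
  | skip (s) : Run .skip s 1 s
  | push (s k a) : Run (.push k a) s 1 (Function.update s k (a :: s k))
  | pop {s k f t s'} : Run (f (s k).head?) (Function.update s k (s k).tail) t s' →
      Run (.pop k f) s (1 + t) s'
  | seq {c d s t s' t' s''} : Run c s t s' → Run d s' t' s'' → Run (.seq c d) s (t + t') s''
  | loop_exit {s k final f} : final (s k).head? = true →
      Run (.loop k final f) s 1 (Function.update s k (s k).tail)
  | loop_step {s k final f t s' t' s''} : final (s k).head? = false →
      Run (f (s k).head?) (Function.update s k (s k).tail) t s' →
      Run (.loop k final f) s' t' s'' → Run (.loop k final f) s (1 + t + t') s''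

/-- The statements of the machine; `ex` is the label at which it continues. -/
def code {Λ : Type} : (c : Cmd K Γ) → (Lbl c → Λ) → Λ → Lbl c →
    TM2.Stmt Γ Λ (∀ k, Option (Γ k))
  | .skip, _, ex, _ => .goto fun _ => ex
  | .push k a, _, ex, _ => .push k (fun _ => a) (.goto fun _ => ex)
  | .pop k f, emb, ex, l => match l with
    -- A machine can branch only on its internal state, so the popped symbol is stored there and the
    -- jump selects the copy of the body that belongs to it. This is why labels carry a symbol.
    | none => .pop k (fun v o => Function.update v k o)
        (.goto fun v => emb (some ⟨v k, entry (f (v k))⟩))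
    | some ⟨o, l⟩ => code (f o) (fun l => emb (some ⟨o, l⟩)) ex l
  | .seq c d, emb, ex, l => match l with
    | Sum.inl l => code c (fun l => emb (Sum.inl l)) (emb (Sum.inr (entry d))) l
    | Sum.inr l => code d (fun l => emb (Sum.inr l)) ex l
  | .loop k final f, emb, ex, l => match l with
    | none => .pop k (fun v o => Function.update v k o)
        (.goto fun v => if final (v k) then ex else emb (some ⟨v k, entry (f (v k))⟩))
    | some ⟨o, l⟩ => code (f o) (fun l => emb (some ⟨o, l⟩)) (emb none) l

/-- `n` steps of a machine lead from `c` to `c'`. -/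
def Steps {Λ σ : Type} (M : Λ → TM2.Stmt Γ Λ σ) (n : ℕ) (c c' : TM2.Cfg Γ Λ σ) : Prop :=
  (flip Bind.bind (TM2.step M))^[n] (some c) = some c'

theorem Steps.trans {Λ σ : Type} {M : Λ → TM2.Stmt Γ Λ σ} {n m : ℕ} {a b c : TM2.Cfg Γ Λ σ}
    (h : Steps M n a b) (h' : Steps M m b c) : Steps M (n + m) a c := by
  unfold Steps at *
  rw [add_comm, Function.iterate_add_apply, h, h']

theorem steps_one {Λ σ : Type} {M : Λ → TM2.Stmt Γ Λ σ} {l : Λ} {v : σ}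
    {s : ∀ k, List (Γ k)} {c : TM2.Cfg Γ Λ σ} (h : TM2.stepAux (M l) v s = c) :
    Steps M 1 ⟨some l, v, s⟩ c := by
  simp [Steps, flip, TM2.step, h]

/-- Each unit of cost is one machine step. The code of `c` may sit inside a larger machine (`emb`)
and continue anywhere (`ex`), which makes the induction go through; the initial state `v` is
arbitrary because a stored symbol is read immediately after it is written. -/
theorem Run.steps {c : Cmd K Γ} {s s' : ∀ k, List (Γ k)} {t : ℕ} (h : Run c s t s') :
    ∀ {Λ : Type} (M : Λ → TM2.Stmt Γ Λ (∀ k, Option (Γ k))) (emb : Lbl c → Λ) (ex : Λ),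
      (∀ l, M (emb l) = code c emb ex l) → ∀ v, ∃ v',
        Steps M t ⟨some (emb (entry c)), v, s⟩ ⟨some ex, v', s'⟩ := by
  induction h with
  | skip s =>
    intro Λ M emb ex hM v
    exact ⟨v, steps_one ((congrArg (TM2.stepAux · v s) (hM _)).trans rfl)⟩
  | push s k a =>
    intro Λ M emb ex hM v
    exact ⟨v, steps_one ((congrArg (TM2.stepAux · v s) (hM _)).trans rfl)⟩
  | @pop s k f t s' _ ih =>
    intro Λ M emb ex hM v
    obtain ⟨v', h'⟩ := ih M (fun l => emb (some ⟨_, l⟩)) ex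
      (fun l => (hM _).trans rfl) (Function.update v k (s k).head?)
    refine ⟨v', (steps_one ((congrArg (TM2.stepAux · v s) (hM none)).trans ?_)).trans h'⟩
    -- The type of the label depends on the symbol read back from the state, so the symbol is
    -- generalised before it is substituted.
    have key : ∀ o, o = (s k).head? → (⟨some (emb (some ⟨o, entry (f o)⟩)),
        Function.update v k (s k).head?, Function.update s k (s k).tail⟩ :
          TM2.Cfg Γ Λ (∀ k, Option (Γ k))) =
        ⟨some (emb (some ⟨(s k).head?, entry (f (s k).head?)⟩)),
        Function.update v k (s k).head?, Function.update s k (s k).tail⟩ := by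
      rintro o rfl; rfl
    exact key _ (Function.update_self ..)
  | @seq c d s t s' t' s'' _ _ ih ih' =>
    intro Λ M emb ex hM v
    obtain ⟨v', h'⟩ := ih M (fun l => emb (Sum.inl l)) (emb (Sum.inr (entry d)))
      (fun l => (hM _).trans rfl) v
    obtain ⟨v'', h''⟩ := ih' M (fun l => emb (Sum.inr l)) ex (fun l => (hM _).trans rfl) v'
    exact ⟨v'', h'.trans h''⟩
  | @loop_exit s k final f h =>
    intro Λ M emb ex hM v
    refine ⟨Function.update v k (s k).head?,
      steps_one ((congrArg (TM2.stepAux · v s) (hM none)).trans ?_)⟩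
    simp only [code, TM2.stepAux, Function.update_self, h, if_true]
  | @loop_step s k final f t s' t' s'' h _ _ ih ih' =>
    intro Λ M emb ex hM v
    obtain ⟨v', h'⟩ := ih M (fun l => emb (some ⟨_, l⟩)) (emb none)
      (fun l => (hM _).trans rfl) (Function.update v k (s k).head?)
    obtain ⟨v'', h''⟩ := ih' M emb ex hM v'
    refine ⟨v'', ((steps_one ((congrArg (TM2.stepAux · v s) (hM none)).trans ?_)).trans
      h').trans h''⟩
    have key : ∀ o, o = (s k).head? →
        (⟨some (if final o then ex else emb (some ⟨o, entry (f o)⟩)),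
        Function.update v k (s k).head?, Function.update s k (s k).tail⟩ :
          TM2.Cfg Γ Λ (∀ k, Option (Γ k))) =
        ⟨some (emb (some ⟨(s k).head?, entry (f (s k).head?)⟩)),
        Function.update v k (s k).head?, Function.update s k (s k).tail⟩ := by
      rintro o rfl; simp [h]
    exact key _ (Function.update_self ..)

/-- The machine that executes a program and halts. -/
noncomputable def machine [Fintype K] [∀ k, Fintype (Γ k)] (k₀ k₁ : K) (c : Cmd K Γ) :
    FinTM2 where
  K := K
  k₀ := k₀
  k₁ := k₁
  Γ := Γ
  Λ := Option (Lbl c)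
  main := some (entry c)
  ΛFin := by
    haveI := finite_lbl c
    exact Fintype.ofFinite _
  σ := ∀ k, Option (Γ k)
  initialState := fun _ => none
  σFin := inferInstance
  Γk₀Fin := inferInstance
  m
    -- A configuration of the form `haltList` has the initial internal state, so the state is reset
    -- before halting. This is the extra step in `t + 1`.
    | none => .load (fun _ _ => none) .halt
    | some l => code c some none l

/-- The store with `w` on stack `k` and all other stacks empty. -/
def single (k : K) (w : List (Γ k)) : ∀ k, List (Γ k) := Function.update (fun _ => []) k w

theorem dite_eq_update (k₀ : K) (w : List (Γ k₀)) (k : K) :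
    (@dite (List (Γ k)) (k = k₀) _ (fun h => by rw [h]; exact w) fun _ => []) = single k₀ w k := by
  by_cases hk : k = k₀
  · subst hk; simp [single]
  · simp [single, hk]

theorem Run.outputs [Fintype K] [∀ k, Fintype (Γ k)] {k₀ k₁ : K} {c : Cmd K Γ}
    {w : List (Γ k₀)} {w' : List (Γ k₁)} {t : ℕ} (h : Run c (single k₀ w) t (single k₁ w'))
    {T : ℕ} (hT : t + 1 ≤ T) : Nonempty (TM2OutputsInTime (machine k₀ k₁ c) w (some w') T) := by
  obtain ⟨v', h'⟩ := h.steps (machine k₀ k₁ c).m some none (fun l => rfl) (fun _ => none)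
  have h2 : Steps (machine k₀ k₁ c).m 1 ⟨some none, v', single k₁ w'⟩
      ⟨none, fun _ => none, single k₁ w'⟩ := steps_one rfl
  have key := h'.trans h2
  have hi : initList (machine k₀ k₁ c) w = ⟨some (some (entry c)), fun _ => none, single k₀ w⟩ := by
    unfold initList
    congr
    funext k
    exact dite_eq_update k₀ w k
  have ho : haltList (machine k₀ k₁ c) w' = ⟨none, fun _ => none, single k₁ w'⟩ := by
    unfold haltList
    congr
    funext k
    exact dite_eq_update k₁ w' k
  refine ⟨⟨⟨t + 1, ?_⟩, hT⟩⟩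
  rw [hi]
  exact Eq.trans key (congrArg some ho.symm)

end StackProg

/-! ### A machine working on a stack of binary trees -/

namespace StackProg

/-- Binary trees, the universal data type. -/
inductive BTree : Type
  | leaf : BTree
  | node (a b : BTree) : BTree

/-- Prefix notation. -/
def BTree.enc : BTree → List Bool
  | .leaf => [false]
  | .node a b => true :: (a.enc ++ b.enc)

theorem BTree.enc_length_pos (t : BTree) : 0 < t.enc.length := by
  cases t <;> simp [BTree.enc]

/-- The working stacks: values, saved values, two scratch stacks and a counter. -/
inductive Bank : Type
  | val | ret | aux | tmp | cnt
  deriving DecidableEq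

instance : Fintype Bank where
  elems := {.val, .ret, .aux, .tmp, .cnt}
  complete i := by cases i <;> decide

/-- All stacks. -/
inductive Stack : Type
  | inp | out | ans
  | bank (i : Bank)
  deriving DecidableEq

instance : Fintype Stack where
  elems := {.inp, .out, .ans, .bank .val, .bank .ret, .bank .aux, .bank .tmp, .bank .cnt}
  complete i := by
    rcases i with _ | _ | _ | j
    · decide
    · decide
    · decide
    · cases j <;> decide

@[reducible] def Alph : Stack → Type
  | .inp => Γ'
  | .out => Γ'
  | .ans => Bool
  | .bank _ => Bool

instance (k : Stack) : Fintype (Alph k) := by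
  cases k <;> infer_instance

abbrev Prog := Cmd Stack Alph

/-- The contents of the input and output stacks. -/
structure Ext where
  inp : List Γ'
  out : List Γ'
  ans : List Bool

def store (e : Ext) (S : Bank → List Bool) : ∀ k, List (Alph k)
  | .inp => e.inp
  | .out => e.out
  | .ans => e.ans
  | .bank i => S i

theorem update_store_bank (e : Ext) (S : Bank → List Bool) (i : Bank) (l : List Bool) :
    Function.update (store e S) (.bank i) l = store e (Function.update S i l) := by
  funext k
  cases k with
  | bank j =>
    by_cases h : j = i
    · subst h; simp [store]
    · simp [store, h]
  | _ => simp [store]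

theorem update_store_inp (e : Ext) (S : Bank → List Bool) (l : List Γ') :
    Function.update (store e S) .inp l = store { e with inp := l } S := by
  funext k
  cases k <;> simp [store]

theorem update_store_out (e : Ext) (S : Bank → List Bool) (l : List Γ') :
    Function.update (store e S) .out l = store { e with out := l } S := by
  funext k
  cases k <;> simp [store]

theorem update_store_ans (e : Ext) (S : Bank → List Bool) (l : List Bool) :
    Function.update (store e S) .ans l = store { e with ans := l } S := by
  funext k
  cases k <;> simp [store]

/-! ### Time-bounded runs and loops on the working stacks. -/

/-- Execution within a time bound. -/
def Runs (c : Prog) (s s' : ∀ k, List (Alph k)) (T : ℕ) : Prop := ∃ t ≤ T, Run c s t s'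

theorem Runs.mono {c : Prog} {s s' : ∀ k, List (Alph k)} {T T' : ℕ} (h : Runs c s s' T)
    (hT : T ≤ T') : Runs c s s' T' := by
  obtain ⟨t, ht, hr⟩ := h
  exact ⟨t, ht.trans hT, hr⟩

theorem Runs.cast {c : Prog} {s s' s'' : ∀ k, List (Alph k)} {T T' : ℕ} (h : Runs c s s' T)
    (hs : s' = s'') (hT : T ≤ T') : Runs c s s'' T' := hs ▸ h.mono hT

theorem Runs.congr_left {c : Prog} {s s' s'' : ∀ k, List (Alph k)} {T : ℕ} (h : Runs c s s' T)
    (hs : s'' = s) : Runs c s'' s' T := hs ▸ h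

theorem store_congr {e : Ext} {S S' : Bank → List Bool} (h : ∀ k, S k = S' k) :
    store e S = store e S' := by rw [funext h]

theorem Runs.skip (s : ∀ k, List (Alph k)) : Runs .skip s s 1 := ⟨1, le_rfl, .skip s⟩

theorem Runs.seq {c d : Prog} {s s' s'' : ∀ k, List (Alph k)} {T T' : ℕ} (h : Runs c s s' T)
    (h' : Runs d s' s'' T') : Runs (.seq c d) s s'' (T + T') := by
  obtain ⟨t, ht, hr⟩ := h
  obtain ⟨t', ht', hr'⟩ := h'
  exact ⟨t + t', add_le_add ht ht', .seq hr hr'⟩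

theorem Runs.push (e : Ext) (S : Bank → List Bool) (i : Bank) (a : Bool) :
    Runs (.push (.bank i) a) (store e S) (store e (Function.update S i (a :: S i))) 1 := by
  refine ⟨1, le_rfl, ?_⟩
  have h := Run.push (store e S) (.bank i) a
  rwa [update_store_bank] at h

theorem Runs.pop {e : Ext} {S : Bank → List Bool} {i : Bank} {f : Option Bool → Prog} {a : Bool}
    {l : List Bool} {s' : ∀ k, List (Alph k)} {T : ℕ} (hi : S i = a :: l)
    (h : Runs (f (some a)) (store e (Function.update S i l)) s' T) :
    Runs (.pop (.bank i) f) (store e S) s' (1 + T) := by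
  obtain ⟨t, ht, hr⟩ := h
  refine ⟨1 + t, by omega, .pop ?_⟩
  have h1 : store e S (.bank i) = a :: l := hi
  rw [h1, update_store_bank]
  exact hr

/-- Runs `f a` on the symbols `a` popped from stack `i` until it is empty. -/
def each (i : Bank) (f : Bool → Prog) : Prog :=
  .loop (.bank i) (fun o => o.isNone) fun o => match o with
    | none => .skip
    | some a => f a

theorem Runs.each_nil {e : Ext} {S : Bank → List Bool} {i : Bank} {f : Bool → Prog}
    (hi : S i = []) : Runs (each i f) (store e S) (store e S) 1 := by
  refine ⟨1, le_rfl, ?_⟩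
  have h1 : store e S (.bank i) = [] := hi
  have h2 := Run.loop_exit (s := store e S) (k := .bank i) (final := fun o => o.isNone)
    (f := fun o => match o with
      | none => .skip
      | some a => f a) (by rw [h1]; rfl)
  rwa [h1, List.tail_nil, ← h1, Function.update_eq_self] at h2

theorem Runs.loop_step {e : Ext} {S : Bank → List Bool} {i : Bank} {final : Option Bool → Bool}
    {f : Option Bool → Prog} {a : Bool}
    {l : List Bool} {s' s'' : ∀ k, List (Alph k)} {T T' : ℕ} (hi : S i = a :: l)
    (ha : final (some a) = false)
    (h : Runs (f (some a)) (store e (Function.update S i l)) s' T)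
    (h' : Runs (.loop (.bank i) final f) s' s'' T') :
    Runs (.loop (.bank i) final f) (store e S) s'' (1 + T + T') := by
  obtain ⟨t, ht, hr⟩ := h
  obtain ⟨t', ht', hr'⟩ := h'
  have h1 : store e S (.bank i) = a :: l := hi
  refine ⟨1 + t + t', by omega, .loop_step (by rw [h1]; exact ha) ?_ hr'⟩
  rw [h1, update_store_bank]
  exact hr

theorem Runs.loop_exit {e : Ext} {S : Bank → List Bool} {i : Bank} {final : Option Bool → Bool}
    {f : Option Bool → Prog} {a : Bool} {l : List Bool} (hi : S i = a :: l)
    (ha : final (some a) = true) :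
    Runs (.loop (.bank i) final f) (store e S) (store e (Function.update S i l)) 1 := by
  refine ⟨1, le_rfl, ?_⟩
  have h1 : store e S (.bank i) = a :: l := hi
  have h2 := Run.loop_exit (s := store e S) (k := .bank i) (final := final) (f := f)
    (by rw [h1]; exact ha)
  rwa [h1, List.tail_cons, update_store_bank] at h2

theorem Runs.each_cons {e : Ext} {S : Bank → List Bool} {i : Bank} {f : Bool → Prog} {a : Bool}
    {l : List Bool} {s' s'' : ∀ k, List (Alph k)} {T T' : ℕ} (hi : S i = a :: l)
    (h : Runs (f a) (store e (Function.update S i l)) s' T)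
    (h' : Runs (each i f) s' s'' T') :
    Runs (each i f) (store e S) s'' (1 + T + T') :=
  Runs.loop_step hi rfl h h'

/-- Reverses stack `i` onto stack `j`. -/
def unload (i j : Bank) : Prog := each i fun a => .push (.bank j) a

theorem runs_unload (e : Ext) {i j : Bank} (hij : i ≠ j) (l : List Bool) :
    ∀ S : Bank → List Bool, S i = l → Runs (unload i j) (store e S)
      (store e (Function.update (Function.update S i []) j (l.reverse ++ S j)))
      (2 * l.length + 1) := by
  induction l with
  | nil =>
    intro S hS
    refine (Runs.each_nil hS).cast (store_congr fun k => ?_) (by simp)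
    simp [show Function.update S i [] = S from hS ▸ Function.update_eq_self ..]
  | cons a l ih =>
    intro S hS
    have h1 := Runs.push e (Function.update S i l) j a
    have h2 := ih (Function.update (Function.update S i l) j
      (a :: Function.update S i l j)) (by simp [hij])
    refine (Runs.each_cons hS h1 h2).cast (store_congr fun k => ?_) (by simp; omega)
    simp only [Function.update_apply]
    split_ifs <;> simp_all

/-- Moves one tree from stack `i` to stack `j`, reversing its code. -/
def mvTree (i j : Bank) : Prog :=
  .seq (.push (.bank .cnt) true) (each .cnt fun _ => .pop (.bank i) fun
    | some true => .seq (.push (.bank j) true)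
        (.seq (.push (.bank .cnt) true) (.push (.bank .cnt) true))
    | some false => .push (.bank j) false
    | none => .skip)

/-- Prefix notation delimits itself: `.cnt` holds in unary the number of trees still to be read, a
node trades one for two, a leaf finishes one. The rest of the run is a hypothesis, so that the two
subtrees of a node can be handled one after the other within the same loop. One symbol costs at most
five steps. -/
theorem runs_mvTree_loop (e : Ext) {i j : Bank} (hij : i ≠ j) (hi : i ≠ .cnt) (hj : j ≠ .cnt)
    {f : Bool → Prog} (hf : ∀ a, f a = .pop (.bank i) fun
      | some true => .seq (.push (.bank j) true)
          (.seq (.push (.bank .cnt) true) (.push (.bank .cnt) true))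
      | some false => .push (.bank j) false
      | none => .skip) (t : BTree) :
    ∀ (S : Bank → List Bool) (x cs : List Bool) (s' : ∀ k, List (Alph k)) (T : ℕ),
      S i = t.enc ++ x → S .cnt = true :: cs →
      Runs (each .cnt f) (store e (Function.update (Function.update
        (Function.update S i x) j (t.enc.reverse ++ S j)) .cnt cs)) s' T →
      Runs (each .cnt f) (store e S) s' (5 * t.enc.length + T) := by
  induction t with
  | leaf =>
    intro S x cs s' T hS hc h
    have h1 : Runs (f true) (store e (Function.update S .cnt cs)) (store e (Function.update
        (Function.update (Function.update S i x) j (BTree.leaf.enc.reverse ++ S j)) .cnt cs)) 2 := by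
      rw [hf]
      refine (Runs.pop (a := false) (l := x) ?_ (Runs.push ..)).cast
        (store_congr fun k => ?_) (by omega)
      · simpa [hi, BTree.enc] using hS
      · simp only [Function.update_apply]
        split_ifs <;> simp_all [BTree.enc]
    exact (Runs.each_cons hc h1 h).mono (by simp [BTree.enc])
  | node a b iha ihb =>
    intro S x cs s' T hS hc h
    have h1 : Runs (f true) (store e (Function.update S .cnt cs)) (store e (Function.update
        (Function.update (Function.update S i (a.enc ++ (b.enc ++ x))) j (true :: S j)) .cnt
          (true :: true :: cs))) 4 := by
      rw [hf]
      refine (Runs.pop (a := true) (l := a.enc ++ (b.enc ++ x)) ?_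
        (Runs.seq (Runs.push ..) (Runs.seq (Runs.push ..) (Runs.push ..)))).cast
        (store_congr fun k => ?_) (by omega)
      · simpa [hi, BTree.enc] using hS
      · simp only [Function.update_apply]
        split_ifs <;> simp_all
    refine (Runs.each_cons hc h1 (iha _ (b.enc ++ x) (true :: cs) s' (5 * b.enc.length + T)
      ?_ ?_ (ihb _ x cs s' T ?_ ?_ (h.congr_left (store_congr fun k => ?_))))).mono
        (by simp [BTree.enc]; omega)
    · simp [hij, hi]
    · simp
    · simp [hij, hi]
    · simp
    · simp only [Function.update_apply]
      split_ifs <;> simp_all [BTree.enc]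

theorem runs_mvTree (e : Ext) {i j : Bank} (hij : i ≠ j) (hi : i ≠ .cnt) (hj : j ≠ .cnt)
    (t : BTree) (S : Bank → List Bool) (x : List Bool) (hS : S i = t.enc ++ x)
    (hc : S .cnt = []) :
    Runs (mvTree i j) (store e S)
      (store e (Function.update (Function.update S i x) j (t.enc.reverse ++ S j)))
      (5 * t.enc.length + 2) := by
  have h1 := Runs.push e S .cnt true
  refine (Runs.seq h1 (runs_mvTree_loop e hij hi hj (fun _ => rfl) t _ x [] _ 1
    ?_ ?_ ((Runs.each_nil ?_).cast (store_congr fun k => ?_) le_rfl))).mono (by omega)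
  · simp [hi, hS]
  · simp [hc]
  · simp
  · simp only [Function.update_apply]
    split_ifs <;> simp_all

/-! ### Saving, restoring, copying, exchanging and deleting trees. -/

/-- The working stacks with given values and saved values. -/
def banks (x y : List Bool) : Bank → List Bool
  | .val => x
  | .ret => y
  | _ => []

abbrev conf (e : Ext) (x y : List Bool) : ∀ k, List (Alph k) := store e (banks x y)

/-- One pass reverses the code of a tree; the second, out of a scratch stack, puts it back in order.
-/
def save : Prog := .seq (mvTree .val .tmp) (unload .tmp .ret)
def restore : Prog := .seq (mvTree .ret .tmp) (unload .tmp .val)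
def dup : Prog := .seq (mvTree .val .tmp)
  (.seq (each .tmp fun a => .seq (.push (.bank .val) a) (.push (.bank .ret) a)) restore)
def swap : Prog := .seq save (.seq (mvTree .val .aux) (.seq restore (unload .aux .val)))
def drop : Prog := .seq (mvTree .val .tmp) (each .tmp fun _ => .skip)

theorem runs_save (e : Ext) (t : BTree) (x y : List Bool) :
    Runs save (conf e (t.enc ++ x) y) (conf e x (t.enc ++ y)) (7 * t.enc.length + 3) := by
  have h1 := runs_mvTree e (i := .val) (j := .tmp) (by decide) (by decide) (by decide) t
    (banks (t.enc ++ x) y) x rfl rfl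
  have h2 := h1.seq (runs_unload e (i := .tmp) (j := .ret) (by decide) t.enc.reverse _
    (by simp [banks]))
  refine h2.cast (store_congr fun k => ?_) (by simp; omega)
  cases k <;> simp [banks]

theorem runs_restore (e : Ext) (t : BTree) (x y : List Bool) :
    Runs restore (conf e x (t.enc ++ y)) (conf e (t.enc ++ x) y) (7 * t.enc.length + 3) := by
  have h1 := runs_mvTree e (i := .ret) (j := .tmp) (by decide) (by decide) (by decide) t
    (banks x (t.enc ++ y)) y rfl rfl
  have h2 := h1.seq (runs_unload e (i := .tmp) (j := .val) (by decide) t.enc.reverse _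
    (by simp [banks]))
  refine h2.cast (store_congr fun k => ?_) (by simp; omega)
  cases k <;> simp [banks]

theorem runs_copy (e : Ext) (l : List Bool) : ∀ S : Bank → List Bool, S .tmp = l →
    Runs (each .tmp fun a => .seq (.push (.bank .val) a) (.push (.bank .ret) a))
      (store e S) (store e (Function.update (Function.update (Function.update S .tmp [])
        .val (l.reverse ++ S .val)) .ret (l.reverse ++ S .ret))) (3 * l.length + 1) := by
  induction l with
  | nil =>
    intro S hS
    refine (Runs.each_nil hS).cast (store_congr fun k => ?_) (by simp)
    simp [show Function.update S .tmp [] = S from hS ▸ Function.update_eq_self ..]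
  | cons a l ih =>
    intro S hS
    have h1 := (Runs.push e (Function.update S .tmp l) .val a).seq (Runs.push e _ .ret a)
    refine (Runs.each_cons hS h1 (ih _ (by simp))).cast (store_congr fun k => ?_)
      (by simp; omega)
    cases k <;> simp

theorem runs_clear (e : Ext) (l : List Bool) : ∀ S : Bank → List Bool, S .tmp = l →
    Runs (each .tmp fun _ => .skip)
      (store e S) (store e (Function.update S .tmp [])) (2 * l.length + 1) := by
  induction l with
  | nil =>
    intro S hS
    refine (Runs.each_nil hS).cast (store_congr fun k => ?_) (by simp)
    simp [show Function.update S .tmp [] = S from hS ▸ Function.update_eq_self ..]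
  | cons a l ih =>
    intro S hS
    refine (Runs.each_cons hS (Runs.skip _) (ih _ (by simp))).cast
      (store_congr fun k => ?_) (by simp; omega)
    simp

theorem runs_dup (e : Ext) (t : BTree) (x y : List Bool) :
    Runs dup (conf e (t.enc ++ x) y) (conf e (t.enc ++ (t.enc ++ x)) y)
      (15 * t.enc.length + 6) := by
  have h1 := runs_mvTree e (i := .val) (j := .tmp) (by decide) (by decide) (by decide) t
    (banks (t.enc ++ x) y) x rfl rfl
  have h2 := runs_copy e t.enc.reverse (Function.update (Function.update
    (banks (t.enc ++ x) y) Bank.val x) Bank.tmp (t.enc.reverse ++ banks (t.enc ++ x) y .tmp))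
    (by simp [banks])
  refine (h1.seq (h2.seq ((runs_restore e t (t.enc ++ x) y).congr_left
    (store_congr fun k => ?_)))).mono (by simp; omega)
  cases k <;> simp [banks]

theorem runs_drop (e : Ext) (t : BTree) (x y : List Bool) :
    Runs drop (conf e (t.enc ++ x) y) (conf e x y) (7 * t.enc.length + 3) := by
  have h1 := runs_mvTree e (i := .val) (j := .tmp) (by decide) (by decide) (by decide) t
    (banks (t.enc ++ x) y) x rfl rfl
  have h2 := h1.seq (runs_clear e t.enc.reverse _ (by simp [banks]))
  refine h2.cast (store_congr fun k => ?_) (by simp; omega)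
  cases k <;> simp [banks]

theorem runs_swap (e : Ext) (t u : BTree) (x y : List Bool) :
    Runs swap (conf e (t.enc ++ (u.enc ++ x)) y) (conf e (u.enc ++ (t.enc ++ x)) y)
      (14 * t.enc.length + 7 * u.enc.length + 10) := by
  have h1 := runs_save e t (u.enc ++ x) y
  have h2 := runs_mvTree e (i := .val) (j := .aux) (by decide) (by decide) (by decide) u
    (banks (u.enc ++ x) (t.enc ++ y)) x rfl rfl
  -- The stack `.aux` is occupied at this point, so `runs_restore`, which starts with empty scratch
  -- stacks, does not apply; its two passes are traced separately.
  have h3 := runs_mvTree e (i := .ret) (j := .tmp) (by decide) (by decide) (by decide) t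
    (Function.update (Function.update (banks (u.enc ++ x) (t.enc ++ y)) Bank.val x) Bank.aux
      (u.enc.reverse ++ banks (u.enc ++ x) (t.enc ++ y) .aux)) y
    (by simp [banks]) (by simp [banks])
  have h4 := h3.seq (runs_unload e (i := .tmp) (j := .val) (by decide) t.enc.reverse _
    (by simp [banks]))
  have h5 := h1.seq (h2.seq (h4.seq (runs_unload e (i := .aux) (j := .val) (by decide)
    u.enc.reverse _ (by simp [banks]))))
  refine h5.cast (store_congr fun k => ?_) (by simp; omega)
  cases k <;> simp [banks]

end StackProg

/-! ### Functions computable in polynomial time -/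

namespace StackProg

/-- Types whose elements are represented by trees. -/
class Enc (α : Type) where
  tree : α → BTree

def bits {α : Type} [Enc α] (a : α) : List Bool := (Enc.tree a).enc

def size {α : Type} [Enc α] (a : α) : ℕ := (bits a).length

instance : Enc Unit := ⟨fun _ => .leaf⟩
instance : Enc Bool := ⟨fun b => if b then .node .leaf .leaf else .leaf⟩
instance {α β : Type} [Enc α] [Enc β] : Enc (α × β) := ⟨fun p => .node (Enc.tree p.1) (Enc.tree p.2)⟩
instance {α : Type} [Enc α] : Enc (List α) := ⟨fun l => l.foldr (fun a t => .node (Enc.tree a) t) .leaf⟩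
-- Naturals are unary, with the code of a list of `n` units (`bits_nat`). Arithmetic thus comes from
-- list operations, and sizes are measured by values.
instance : Enc ℕ := ⟨fun n => n.rec .leaf fun _ t => .node .leaf t⟩

section
variable {α β : Type} [Enc α] [Enc β]

theorem bits_pair (a : α) (b : β) : bits (a, b) = true :: (bits a ++ bits b) := rfl
theorem bits_nil : bits ([] : List α) = [false] := rfl
theorem bits_cons (a : α) (l : List α) : bits (a :: l) = true :: (bits a ++ bits l) := rfl
theorem bits_succ (n : ℕ) : bits (n + 1) = true :: false :: bits n := rfl

@[simp] theorem size_pair (a : α) (b : β) : size (a, b) = size a + size b + 1 := by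
  simp [size, bits_pair]
@[simp] theorem size_nil : size ([] : List α) = 1 := rfl
@[simp] theorem size_cons (a : α) (l : List α) : size (a :: l) = size a + size l + 1 := by
  simp [size, bits_cons]
@[simp] theorem size_nat (n : ℕ) : size n = 2 * n + 1 := by
  induction n with
  | zero => rfl
  | succ n ih =>
    have : size (n + 1) = size n + 2 := by simp [size, bits_succ]
    omega
@[simp] theorem size_unit (u : Unit) : size u = 1 := rfl
theorem size_bool (b : Bool) : size b ≤ 3 := by
  cases b <;> simp [size, bits, Enc.tree, BTree.enc]
theorem size_pos (a : α) : 0 < size a := BTree.enc_length_pos _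

theorem size_append (l l' : List α) : size (l ++ l') + 1 = size l + size l' := by
  induction l with
  | nil => simp [add_comm]
  | cons a l ih => simp only [List.cons_append, size_cons]; omega

theorem length_lt_size (l : List α) : l.length < size l := by
  induction l with
  | nil => simp
  | cons a l ih => simp; omega

theorem size_lt_of_mem {a : α} {l : List α} (h : a ∈ l) : size a < size l := by
  induction l with
  | nil => simp at h
  | cons b l ih =>
    rcases List.mem_cons.1 h with rfl | h
    · simp only [size_cons]; omega
    · have := ih h
      simp; omega

end

/-- `T` is bounded by a polynomial in `B`. -/
def PolyBdd {α : Type} (B T : α → ℕ) : Prop := ∃ c, ∀ a, T a ≤ (B a + 2) ^ c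

/-! ### Arithmetic of polynomial bounds. -/

section
variable {α β γ : Type} {B T T' : α → ℕ}

theorem PolyBdd.mono (h : PolyBdd B T) (hT : ∀ a, T' a ≤ T a) : PolyBdd B T' := by
  obtain ⟨c, hc⟩ := h
  exact ⟨c, fun a => (hT a).trans (hc a)⟩

theorem PolyBdd.self : PolyBdd B B := ⟨1, fun a => by simp⟩

/-- The summand `2` in the base serves this purpose: a base of at least two lets a single power
absorb constants and sums. -/
theorem PolyBdd.const (n : ℕ) : PolyBdd B (fun _ => n) :=
  ⟨n, fun a => (Nat.lt_two_pow_self).le.trans (Nat.pow_le_pow_left (by omega) n)⟩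

theorem PolyBdd.add (h : PolyBdd B T) (h' : PolyBdd B T') : PolyBdd B (fun a => T a + T' a) := by
  obtain ⟨c, hc⟩ := h
  obtain ⟨d, hd⟩ := h'
  refine ⟨c + d + 1, fun a => ?_⟩
  have h1 : (B a + 2) ^ c ≤ (B a + 2) ^ (c + d) := Nat.pow_le_pow_right (by omega) (by omega)
  have h2 : (B a + 2) ^ d ≤ (B a + 2) ^ (c + d) := Nat.pow_le_pow_right (by omega) (by omega)
  have h3 : (B a + 2) ^ (c + d) * 2 ≤ (B a + 2) ^ (c + d + 1) := by
    rw [pow_succ]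
    exact Nat.mul_le_mul_left _ (by omega)
  have := hc a
  have := hd a
  show T a + T' a ≤ _
  omega

theorem PolyBdd.mul (h : PolyBdd B T) (h' : PolyBdd B T') : PolyBdd B (fun a => T a * T' a) := by
  obtain ⟨c, hc⟩ := h
  obtain ⟨d, hd⟩ := h'
  exact ⟨c + d, fun a => by rw [pow_add]; exact Nat.mul_le_mul (hc a) (hd a)⟩

theorem PolyBdd.pow (h : PolyBdd B T) (n : ℕ) : PolyBdd B (fun a => T a ^ n) := by
  obtain ⟨c, hc⟩ := h
  exact ⟨c * n, fun a => by rw [pow_mul]; exact Nat.pow_le_pow_left (hc a) n⟩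

theorem PolyBdd.comp {S U : β → ℕ} (h : PolyBdd S U) {f : α → β} (hf : PolyBdd B (fun a => S (f a))) :
    PolyBdd B (fun a => U (f a)) := by
  obtain ⟨c, hc⟩ := h
  exact ((hf.add (PolyBdd.const 2)).pow c).mono fun a => hc _

end

theorem banks_update_val (x y z : List Bool) :
    Function.update (banks x y) .val z = banks z y := by
  funext k
  cases k <;> simp [banks]

theorem runs_push_val (e : Ext) (b : Bool) (x y : List Bool) :
    Runs (.push (.bank .val) b) (conf e x y) (conf e (b :: x) y) 1 := by
  have h := Runs.push e (banks x y) .val b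
  rwa [banks_update_val] at h

theorem runs_pop_val {e : Ext} {f : Option Bool → Prog} {b : Bool} {x y : List Bool}
    {s' : ∀ k, List (Alph k)} {T : ℕ} (h : Runs (f (some b)) (conf e x y) s' T) :
    Runs (.pop (.bank .val) f) (conf e (b :: x) y) s' (1 + T) := by
  refine Runs.pop (a := b) (l := x) rfl ?_
  rwa [banks_update_val]

/-! ### Polynomial-time computable functions and their closure properties. -/

section
variable {α β γ δ σ : Type} [Enc α] [Enc β] [Enc γ] [Enc δ] [Enc σ]

/-- The program `p` computes `f` in time `T` on top of the value stack. -/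
def Computes (p : Prog) (f : α → β) (T : α → ℕ) : Prop :=
  ∀ a e x y, Runs p (conf e (bits a ++ x) y) (conf e (bits (f a) ++ x) y) (T a)

/-- `f` is computable in time polynomial in `B`, where `B` bounds the input polynomially. -/
def PTB (B : α → ℕ) (f : α → β) : Prop :=
  (∃ p T, Computes p f T ∧ PolyBdd B T) ∧ PolyBdd B (fun a => size a) ∧ PolyBdd B (fun a => size (f a))

/-- `f` is computable in polynomial time. -/
abbrev PT (f : α → β) : Prop := PTB size f

variable {B : α → ℕ}

theorem PTB.comp {f : α → β} {g : β → γ} (hg : PT g) (hf : PTB B f) :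
    PTB B (fun x => g (f x)) := by
  obtain ⟨⟨p, T, hp, hT⟩, hB, hs⟩ := hf
  obtain ⟨⟨q, U, hq, hU⟩, -, hs'⟩ := hg
  exact ⟨⟨.seq p q, fun a => T a + U (f a), fun a e x y => (hp a e x y).seq (hq _ e x y),
    hT.add (hU.comp hs)⟩, hB, hs'.comp hs⟩

theorem PTB.of_PT {f : α → β} (hf : PT f) (hB : PolyBdd B (fun a => size a)) : PTB B f := by
  obtain ⟨⟨p, T, hp, hT⟩, -, hs⟩ := hf
  exact ⟨⟨p, T, hp, hT.comp (f := fun a => a) hB⟩, hB, hs.comp (f := fun a => a) hB⟩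

theorem PT.of_bits_eq {f : α → β} (hf : ∀ a, bits (f a) = bits a) : PT f :=
  ⟨⟨.skip, fun _ => 1, fun a e x y => by rw [hf]; exact Runs.skip _, PolyBdd.const 1⟩, PolyBdd.self,
    PolyBdd.self.mono fun a => by simp [size, hf]⟩

theorem PT.id : PT (fun x : α => x) := PT.of_bits_eq fun _ => rfl

theorem PTB.id (hB : PolyBdd B (fun a => size a)) : PTB B (fun x : α => x) := PTB.of_PT PT.id hB

/-- A program sees only bits, so a change of type that keeps the code is free. This identifies a
pair with a nonempty list, a truth value with a list of at most one unit, and a number with a list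
of units. -/
theorem PTB.recast {f : α → β} {f' : α → γ} (hf : PTB B f) (h : ∀ a, bits (f' a) = bits (f a)) :
    PTB B f' := by
  obtain ⟨⟨p, T, hp, hT⟩, hB, hs⟩ := hf
  refine ⟨⟨p, T, fun a e x y => by rw [h]; exact hp a e x y, hT⟩, hB, hs.mono fun a => ?_⟩
  simp [size, h]

theorem PTB.congr {f f' : α → β} (hf : PTB B f) (h : ∀ a, f' a = f a) : PTB B f' :=
  (funext h : f' = f) ▸ hf

theorem PTB.pair {f : α → β} {g : α → γ} (hf : PTB B f) (hg : PTB B g) :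
    PTB B (fun x => (f x, g x)) := by
  obtain ⟨⟨p, T, hp, hT⟩, hB, hs⟩ := hf
  obtain ⟨⟨q, U, hq, hU⟩, -, hs'⟩ := hg
  -- The argument is duplicated, each copy is evaluated on top of the stack, and the leading `true`
  -- joins the two results into a node.
  refine ⟨⟨.seq dup (.seq p (.seq swap (.seq q (.seq swap (.push (.bank .val) true))))),
    fun a => 15 * size a + 6 + (T a + ((14 * size (f a) + 7 * size a + 10) +
      (U a + ((14 * size (g a) + 7 * size (f a) + 10) + 1)))), fun a e x y => ?_, ?_⟩, hB, ?_⟩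
  · exact (runs_dup e _ x y).seq ((hp a e _ y).seq ((runs_swap e _ _ x y).seq
      ((hq a e _ y).seq ((runs_swap e _ _ x y).seq
        ((runs_push_val e true _ y).cast (by simp [bits, Enc.tree, BTree.enc]) le_rfl)))))
  · exact (((PolyBdd.const 15).mul hB).add (PolyBdd.const 6)).add (hT.add
      (((((PolyBdd.const 14).mul hs).add ((PolyBdd.const 7).mul hB)).add (PolyBdd.const 10)).add
      (hU.add (((((PolyBdd.const 14).mul hs').add ((PolyBdd.const 7).mul hs)).add
        (PolyBdd.const 10)).add (PolyBdd.const 1)))))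
  · exact ((hs.add hs').add (PolyBdd.const 1)).mono fun a => by simp

theorem PT.left : PT (fun p : α × β => p.1) := by
  refine ⟨⟨.seq (.pop (.bank .val) fun _ => .skip) (.seq swap drop),
    fun p => (1 + 1) + ((14 * size p.1 + 7 * size p.2 + 10) + (7 * size p.2 + 3)),
    fun a e x y => ?_, ?_⟩, PolyBdd.self, PolyBdd.self.mono fun p => ?_⟩
  · rw [bits_pair]
    refine (runs_pop_val (Runs.skip _)).seq (Runs.seq (((runs_swap e (Enc.tree a.1)
      (Enc.tree a.2) x y)).congr_left ?_) (runs_drop e _ _ _))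
    simp [bits]
  · exact ((PolyBdd.const 15).add ((PolyBdd.const 28).mul PolyBdd.self)).mono fun p => by
      have := size_pair p.1 p.2
      simp only [Prod.mk.eta] at this ⊢
      omega
  · have := size_pair p.1 p.2
    simp only [Prod.mk.eta] at this ⊢
    omega

theorem PT.right : PT (fun p : α × β => p.2) := by
  refine ⟨⟨.seq (.pop (.bank .val) fun _ => .skip) drop,
    fun p => (1 + 1) + (7 * size p.1 + 3),
    fun a e x y => ?_, ?_⟩, PolyBdd.self, PolyBdd.self.mono fun p => ?_⟩
  · rw [bits_pair]
    refine (runs_pop_val (Runs.skip _)).seq ((runs_drop e (Enc.tree a.1) _ _).congr_left ?_)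
    simp [bits]
  · exact ((PolyBdd.const 5).add ((PolyBdd.const 7).mul PolyBdd.self)).mono fun p => by
      have := size_pair p.1 p.2
      simp only [Prod.mk.eta] at this ⊢
      omega
  · have := size_pair p.1 p.2
    simp only [Prod.mk.eta] at this ⊢
    omega

theorem PTB.fst {f : α → β × γ} (hf : PTB B f) : PTB B (fun x => (f x).1) := PT.left.comp hf
theorem PTB.snd {f : α → β × γ} (hf : PTB B f) : PTB B (fun x => (f x).2) := PT.right.comp hf

def pushAll : List Bool → Prog
  | [] => .skip
  | b :: l => .seq (pushAll l) (.push (.bank .val) b)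

theorem runs_pushAll (e : Ext) (l x y : List Bool) :
    Runs (pushAll l) (conf e x y) (conf e (l ++ x) y) (l.length + 1) := by
  induction l with
  | nil => exact Runs.skip _
  | cons b l ih => exact ih.seq (runs_push_val e b _ y)

theorem PT.const (b : β) : PT (fun _ : α => b) := by
  refine ⟨⟨.seq drop (pushAll (bits b)), fun a => (7 * size a + 3) + (size b + 1),
    fun a e x y => (runs_drop e _ x y).seq (runs_pushAll e _ x y), ?_⟩, PolyBdd.self, PolyBdd.const _⟩
  exact (((PolyBdd.const 7).mul PolyBdd.self).add (PolyBdd.const 3)).add (PolyBdd.const _)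

/-- The codes of `(a :: l, s)` and `((a, l), s)` are the same word, starting with two symbols
`true`, and `([], s)` is coded by `true, false` followed by the code of `s`. So it suffices to pop
two symbols and, in the first case, to push them back. -/
theorem PT.listCase {f : γ → β} {g : (α × List α) × γ → β} (hf : PT f) (hg : PT g) :
    PT (fun p : List α × γ => match p.1 with
      | [] => f p.2
      | a :: l => g ((a, l), p.2)) := by
  obtain ⟨⟨p, T, hp, hT⟩, -, hs⟩ := hf
  obtain ⟨⟨q, U, hq, hU⟩, -, hs'⟩ := hg
  obtain ⟨c, hc⟩ := hT
  obtain ⟨d, hd⟩ := hU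
  obtain ⟨c', hc'⟩ := hs
  obtain ⟨d', hd'⟩ := hs'
  have mono : ∀ {m n k : ℕ}, m ≤ n → (m + 2) ^ k ≤ (n + 2) ^ k := fun h =>
    Nat.pow_le_pow_left (by omega) _
  refine ⟨⟨.pop (.bank .val) fun _ => .pop (.bank .val) fun o => if o = some true then
      .seq (.push (.bank .val) true) (.seq (.push (.bank .val) true) q) else p,
    fun x => (size x + 2) ^ c + (size x + 2) ^ d + 4, fun a e x y => ?_, ?_⟩, PolyBdd.self, ?_⟩
  · rcases a with ⟨_ | ⟨a, l⟩, s⟩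
    · refine ((runs_pop_val (b := true) (runs_pop_val (b := false) (x := bits s ++ x) (y := y)
        (e := e) (T := (size s + 2) ^ c) ?_)).mono ?_).congr_left ?_
      · simpa using (hp s e x y).mono (hc s)
      · have := mono (k := c) (show size s ≤ size (([] : List α), s) by simp; omega)
        simp only; omega
      · simp [bits_pair, bits_nil]
    · refine ((runs_pop_val (b := true) (runs_pop_val (b := true) (e := e) (y := y)
        (x := bits a ++ (bits l ++ (bits s ++ x)))
        (T := 1 + (1 + (size (a :: l, s) + 2) ^ d)) ?_)).mono ?_).congr_left ?_
      · simp only [if_true]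
        refine (runs_push_val ..).seq ((runs_push_val ..).seq
          (((hq ((a, l), s) e x y).mono (hd _)).congr_left ?_ |>.mono ?_))
        · simp [bits_pair]
        · simp
      · simp only; omega
      · simp [bits_pair, bits_cons]
  · exact (((PolyBdd.self.add (PolyBdd.const 2)).pow c).add
      ((PolyBdd.self.add (PolyBdd.const 2)).pow d)).add (PolyBdd.const 4)
  · refine (((PolyBdd.self.add (PolyBdd.const 2)).pow c').add
      ((PolyBdd.self.add (PolyBdd.const 2)).pow d')).mono ?_
    rintro ⟨_ | ⟨a, l⟩, s⟩
    · have : size (f s) ≤ _ := hc' s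
      have := mono (k := c') (show size s ≤ size (([] : List α), s) by simp; omega)
      simp only; omega
    · have : size (g ((a, l), s)) ≤ _ := hd' ((a, l), s)
      have h1 : size ((a, l), s) = size (a :: l, s) := by simp
      rw [h1] at this
      simp only; omega

/-- The loop of `List.foldl`. -/
def foldProg (q : Prog) : Prog := .loop (.bank .val) (fun o => o != some true) fun _ =>
  .seq save (.seq swap (.seq restore (.seq (.push (.bank .val) true) (.seq q swap))))

/-- The list lies above the state. After the leading `true` of a cons cell the body rearranges `a,
l, s` into the pair `(a, s)` above `l`, applies `g` and exchanges. `M` bounds all intermediate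
states and `W` the cost of a call; without such bounds iterating a polynomial-time function could be
exponential. -/
theorem runs_foldProg {q : Prog} {g : α × σ → σ} {U : α × σ → ℕ} (hq : Computes q g U)
    (e : Ext) (x y : List Bool) (M W : ℕ) : ∀ (l : List α) (s : σ),
      (∀ l₁ l₂, l = l₁ ++ l₂ → size (l₁.foldl (fun s a => g (a, s)) s) ≤ M) →
      (∀ a s, a ∈ l → size s ≤ M → U (a, s) ≤ W) →
      Runs (foldProg q) (conf e (bits l ++ (bits s ++ x)) y)
        (conf e (bits (l.foldl (fun s a => g (a, s)) s) ++ x) y)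
        (l.length * (50 * (size l + M + W + 1)) + 1) := by
  intro l
  induction l with
  | nil =>
    intro s _ _
    refine (Runs.loop_exit (a := false) (l := bits s ++ x) rfl rfl).cast ?_ (by simp)
    rw [banks_update_val]; rfl
  | cons a l ih =>
    intro s hM hU
    have hs : size s ≤ M := hM [] (a :: l) rfl
    have hs' : size (g (a, s)) ≤ M := hM [a] l rfl
    have hu := hU a s (by simp) hs
    have h1 := runs_save e (Enc.tree a) (bits l ++ (bits s ++ x)) y
    have h2 := runs_swap e (Enc.tree l) (Enc.tree s) x ((Enc.tree a).enc ++ y)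
    have h3 := runs_restore e (Enc.tree a) (bits s ++ (bits l ++ x)) y
    have h4 := runs_push_val e true (bits a ++ (bits s ++ (bits l ++ x))) y
    have h5 := (hq (a, s) e (bits l ++ x) y).congr_left
      (s'' := conf e (true :: (bits a ++ (bits s ++ (bits l ++ x)))) y) (by simp [bits_pair])
    have h6 := runs_swap e (Enc.tree (g (a, s))) (Enc.tree l) x y
    have h7 := h1.seq (h2.seq (h3.seq (h4.seq (h5.seq h6))))
    have h8 := ih (g (a, s)) (fun l₁ l₂ h => hM (a :: l₁) l₂ (by rw [h]; rfl))
      (fun b s hb => hU b s (List.mem_cons_of_mem _ hb))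
    refine (Runs.loop_step (a := true) (l := bits a ++ (bits l ++ (bits s ++ x)))
      (by simp [banks, bits_cons]) rfl (h7.congr_left ?_) h8).mono ?_
    · rw [banks_update_val]; rfl
    · have e1 : (Enc.tree a).enc.length = size a := rfl
      have e2 : (Enc.tree l).enc.length = size l := rfl
      have e3 : (Enc.tree s).enc.length = size s := rfl
      have e4 : (Enc.tree (g (a, s))).enc.length = size (g (a, s)) := rfl
      simp only [e1, e2, e3, e4]
      rw [size_cons, List.length_cons, Nat.add_mul, Nat.one_mul]
      have h9 : l.length * (50 * (size l + M + W + 1)) ≤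
          l.length * (50 * (size a + size l + 1 + M + W + 1)) :=
        Nat.mul_le_mul_left _ (by omega)
      omega

theorem PTB.foldl' {B : γ → ℕ} {l : γ → List α} {i : γ → σ} {g : α × σ → σ}
    (hl : PTB B l) (hi : PTB B i) (hg : PT g) {M : γ → ℕ} (hM : PolyBdd B M)
    (hb : ∀ c l₁ l₂, l c = l₁ ++ l₂ → size (l₁.foldl (fun s a => g (a, s)) (i c)) ≤ M c) :
    PTB B (fun c => (l c).foldl (fun s a => g (a, s)) (i c)) := by
  obtain ⟨⟨p, T, hp, hT⟩, hB, -⟩ := hl.pair hi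
  obtain ⟨⟨q, U, hq, c, hU⟩, -, -⟩ := hg
  let W : γ → ℕ := fun x => (size (l x) + M x + 3) ^ c
  have hW : PolyBdd B W := ((hl.2.2.add hM).add (PolyBdd.const 3)).pow c
  refine ⟨⟨.seq p (.seq (.pop (.bank .val) fun _ => .skip) (foldProg q)),
    fun x => T x + ((1 + 1) + (size (l x) * (50 * (size (l x) + M x + W x + 1)) + 1)),
    fun a e x y => ?_, ?_⟩, hB, hM.mono fun a => ?_⟩
  · refine (hp a e x y).seq (Runs.seq (s' := conf e (bits (l a) ++ (bits (i a) ++ x)) y) ?_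
      ((runs_foldProg hq e x y (M a) (W a) (l a) (i a)
        (fun l₁ l₂ h => hb a l₁ l₂ h) ?_).mono ?_))
    · exact (runs_pop_val (b := true) (Runs.skip _)).congr_left (by simp [bits_pair])
    · intro b s hb' hs
      refine (hU _).trans (Nat.pow_le_pow_left ?_ c)
      have := size_lt_of_mem hb'
      rw [size_pair]; omega
    · have := Nat.mul_le_mul_right (50 * (size (l a) + M a + W a + 1)) (length_lt_size (l a)).le
      omega
  · exact hT.add ((PolyBdd.const 2).add ((hl.2.2.mul ((PolyBdd.const 50).mul
      (((hl.2.2.add hM).add hW).add (PolyBdd.const 1)))).add (PolyBdd.const 1)))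
  · exact hb a (l a) [] (by simp)

end

end StackProg

/-! ### Basic polynomial-time functions -/

namespace StackProg

section
variable {α β γ δ σ : Type} [Enc α] [Enc β] [Enc γ] [Enc δ] [Enc σ] {B : γ → ℕ}

theorem PTB.const {f : γ → α} (hf : PTB B f) (b : β) : PTB B (fun _ => b) := (PT.const b).comp hf

theorem PTB.cons {f : γ → α} {g : γ → List α} (hf : PTB B f) (hg : PTB B g) :
    PTB B (fun c => f c :: g c) :=
  (hf.pair hg).recast fun _ => rfl

theorem PTB.comp₂ {f : γ → α} {g : γ → β} {h : α → β → δ} (hh : PT fun p : α × β => h p.1 p.2)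
    (hf : PTB B f) (hg : PTB B g) : PTB B (fun c => h (f c) (g c)) :=
  hh.comp (hf.pair hg)

theorem PTB.cond {b : γ → Bool} {f g : γ → β} (hb : PTB B b) (hf : PTB B f) (hg : PTB B g) :
    PTB B (fun c => bif b c then f c else g c) := by
  -- A truth value has the code of a list of units with at most one element, so the case distinction
  -- on lists becomes a conditional. Both branches are evaluated beforehand.
  have h1 : PTB B (fun c => ((if b c then [()] else [] : List Unit), (f c, g c))) := by
    refine (hb.recast fun c => ?_).pair (hf.pair hg)
    cases b c <;> rfl
  refine (PTB.comp (PT.listCase (α := Unit) (f := fun p : β × β => p.2)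
    (g := fun q : (Unit × List Unit) × (β × β) => q.2.1) PT.right PT.right.fst) h1).congr fun c => ?_
  cases b c <;> rfl

theorem PTB.ite {p : γ → Prop} [DecidablePred p] {f g : γ → β}
    (hp : PTB B (fun c => decide (p c))) (hf : PTB B f) (hg : PTB B g) :
    PTB B (fun c => if p c then f c else g c) :=
  (hp.cond hf hg).congr fun c => by by_cases h : p c <;> simp [h]

theorem PTB.and {b b' : γ → Bool} (hb : PTB B b) (hb' : PTB B b') :
    PTB B (fun c => b c && b' c) :=
  (hb.cond hb' (hb.const false)).congr fun c => by cases b c <;> rfl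

theorem PTB.or {b b' : γ → Bool} (hb : PTB B b) (hb' : PTB B b') :
    PTB B (fun c => b c || b' c) :=
  (hb.cond (hb.const true) hb').congr fun c => by cases b c <;> rfl

theorem PTB.not {b : γ → Bool} (hb : PTB B b) : PTB B (fun c => !b c) :=
  (hb.cond (hb.const false) (hb.const true)).congr fun c => by cases b c <;> rfl

theorem PTB.xor {b b' : γ → Bool} (hb : PTB B b) (hb' : PTB B b') :
    PTB B (fun c => Bool.xor (b c) (b' c)) :=
  (hb.cond hb'.not hb').congr fun c => by cases b c <;> simp

theorem PTB.isEmpty {l : γ → List α} (hl : PTB B l) : PTB B (fun c => (l c).isEmpty) :=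
  (PTB.comp (PT.listCase (α := α) (f := fun _ : Unit => true)
    (g := fun _ : (α × List α) × Unit => false) (PT.const _) (PT.const _))
    (hl.pair (hl.const ()))).congr fun c => by cases l c <;> rfl

theorem PTB.tail {l : γ → List α} (hl : PTB B l) : PTB B (fun c => (l c).tail) :=
  (PTB.comp (PT.listCase (α := α) (f := fun _ : Unit => ([] : List α))
    (g := fun p : (α × List α) × Unit => p.1.2) (PT.const _) PT.left.snd)
    (hl.pair (hl.const ()))).congr fun c => by cases l c <;> rfl

theorem PTB.headD {l : γ → List α} (hl : PTB B l) (d : α) : PTB B (fun c => (l c).headD d) :=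
  (PTB.comp (PT.listCase (α := α) (f := fun _ : Unit => d)
    (g := fun p : (α × List α) × Unit => p.1.1) (PT.const _) PT.left.fst)
    (hl.pair (hl.const ()))).congr fun c => by cases l c <;> rfl

/-! Folds -/

theorem PTB.foldl_of_bound {l : γ → List α} {i : γ → σ} {g : γ → σ → α → σ} (hl : PTB B l)
    (hi : PTB B i) (hg : PT (fun p : γ × σ × α => g p.1 p.2.1 p.2.2)) {M : γ → ℕ}
    (hM : PolyBdd B M)
    (hb : ∀ c l₁ l₂, l c = l₁ ++ l₂ → size (l₁.foldl (g c) (i c)) ≤ M c) :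
    PTB B (fun c => (l c).foldl (g c) (i c)) := by
  -- The step function may use the context `c`; it is carried along as part of the state.
  have key : ∀ (c : γ) (l : List α) (s : σ),
      l.foldl (fun (s : γ × σ) a => ((s.1, g s.1 s.2 a) : γ × σ)) (c, s)
        = (c, l.foldl (g c) s) := by
    intro c l
    induction l with
    | nil => intro s; rfl
    | cons a l ih => intro s; exact ih _
  have hid : PTB B (fun c : γ => c) := PTB.id hl.2.1
  have h1 := PTB.foldl' (g := fun q : α × γ × σ => ((q.2.1, g q.2.1 q.2.2 q.1) : γ × σ))
    hl (hid.pair hi) (PT.right.fst.pair (hg.comp (PT.right.fst.pair (PT.right.snd.pair PT.left))))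
    (M := fun c => size c + M c + 1) ((hl.2.1.add hM).add (PolyBdd.const 1)) ?_
  · exact h1.snd.congr fun c => by simp only [key]
  · intro c l₁ l₂ h
    have := hb c l₁ l₂ h
    simp only [key, size_pair]
    omega

/-- Additive growth accumulates to at most the length of the list times `G c`, so intermediate
states remain polynomial. -/
theorem PTB.foldl_of_growth {l : γ → List α} {i : γ → σ} {g : γ → σ → α → σ} (hl : PTB B l)
    (hi : PTB B i) (hg : PT (fun p : γ × σ × α => g p.1 p.2.1 p.2.2)) {G : γ → ℕ}
    (hG : PolyBdd B G) (hb : ∀ c s a, a ∈ l c → size (g c s a) ≤ size s + G c) :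
    PTB B (fun c => (l c).foldl (g c) (i c)) := by
  refine PTB.foldl_of_bound hl hi hg (M := fun c => size (i c) + size (l c) * G c)
    (hi.2.2.add (hl.2.2.mul hG)) ?_
  intro c l₁ l₂ h
  have key : ∀ (l₁ : List α) (s : σ), (∀ a ∈ l₁, a ∈ l c) →
      size (l₁.foldl (g c) s) ≤ size s + l₁.length * G c := by
    intro l₁
    induction l₁ with
    | nil => intro s _; simp
    | cons a l₁ ih =>
      intro s ha
      have h1 := ih (g c s a) fun a h => ha a (List.mem_cons_of_mem _ h)
      have h2 := hb c s a (ha a (by simp))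
      rw [List.foldl_cons, List.length_cons, Nat.add_mul, Nat.one_mul]
      omega
  have h1 := key l₁ (i c) (fun a ha => by rw [h]; exact List.mem_append_left _ ha)
  have h2 : l₁.length ≤ size (l c) := by
    have := length_lt_size (l c)
    have := congrArg List.length h
    rw [List.length_append] at this
    omega
  exact h1.trans (Nat.add_le_add_left (Nat.mul_le_mul_right _ h2) _)

theorem PTB.mem_bound {l : γ → List α} (hl : PTB B l) {g : γ → α → β}
    (hg : PT (fun p : γ × α => g p.1 p.2)) :
    ∃ G, PolyBdd B G ∧ ∀ c a, a ∈ l c → size (g c a) ≤ G c := by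
  obtain ⟨d, hd⟩ := hg.2.2
  refine ⟨fun c => (size c + size (l c) + 3) ^ d,
    ((hl.2.1.add hl.2.2).add (PolyBdd.const 3)).pow d, fun c a ha => (hd (c, a)).trans ?_⟩
  have := size_lt_of_mem ha
  exact Nat.pow_le_pow_left (by rw [size_pair]; omega) _

theorem PTB.reverse {l : γ → List α} (hl : PTB B l) : PTB B (fun c => (l c).reverse) := by
  refine (PTB.foldl_of_growth (i := fun _ => ([] : List α)) (g := fun _ s a => a :: s) hl
    (hl.const _) (PTB.cons PT.right.snd PT.right.fst) (G := fun c => size (l c)) hl.2.2 ?_).congr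
    fun c => by simp
  intro c s a ha
  have := size_lt_of_mem ha
  simp; omega

theorem PTB.append {l l' : γ → List α} (hl : PTB B l) (hl' : PTB B l') :
    PTB B (fun c => l c ++ l' c) := by
  refine (PTB.foldl_of_growth (g := fun _ s a => a :: s) hl.reverse hl'
    (PTB.cons PT.right.snd PT.right.fst) (G := fun c => size (l c)) hl.2.2 ?_).congr
    fun c => by simp
  intro c s a ha
  have := size_lt_of_mem (List.mem_reverse.1 ha)
  simp; omega

theorem PTB.flatMap {l : γ → List α} {g : γ → α → List β} (hl : PTB B l)
    (hg : PT (fun p : γ × α => g p.1 p.2)) : PTB B (fun c => (l c).flatMap (g c)) := by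
  obtain ⟨G, hG, hb⟩ := hl.mem_bound hg
  have key : ∀ (g : α → List β) (l : List α) (s : List β),
      l.reverse.foldl (fun s a => g a ++ s) s = l.flatMap g ++ s := by
    intro g l
    induction l with
    | nil => intro s; rfl
    | cons a l ih => intro s; simp [ih, List.foldl_append]
  refine (PTB.foldl_of_growth (i := fun _ => ([] : List β)) (g := fun c s a => g c a ++ s)
    hl.reverse (hl.const _) (PTB.append (hg.comp (PT.left.pair PT.right.snd)) PT.right.fst) hG
    ?_).congr fun c => by rw [key, List.append_nil]
  intro c s a ha
  have h1 := hb c a (List.mem_reverse.1 ha)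
  have h2 := size_append (g c a) s
  omega

theorem PTB.map {l : γ → List α} {g : γ → α → β} (hl : PTB B l)
    (hg : PT (fun p : γ × α => g p.1 p.2)) : PTB B (fun c => (l c).map (g c)) :=
  (hl.flatMap (g := fun c a => [g c a]) (hg.cons (PT.const _))).congr fun _ =>
    List.map_eq_flatMap

theorem PTB.filter {l : γ → List α} {p : γ → α → Bool} (hl : PTB B l)
    (hp : PT (fun q : γ × α => p q.1 q.2)) : PTB B (fun c => (l c).filter (p c)) :=
  (hl.flatMap (g := fun c a => bif p c a then [a] else [])
    (hp.cond (PT.right.cons (PT.const _)) (PT.const _))).congr fun c => by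
      induction l c with
      | nil => rfl
      | cons a l ih => cases h : p c a <;> simp [h, ih]

theorem PTB.any {l : γ → List α} {p : γ → α → Bool} (hl : PTB B l)
    (hp : PT (fun q : γ × α => p q.1 q.2)) : PTB B (fun c => (l c).any (p c)) :=
  (hl.filter hp).isEmpty.not.congr fun c => by
    induction l c with
    | nil => rfl
    | cons a l ih => cases h : p c a <;> simp_all

theorem PTB.foldr_of_growth {l : γ → List α} {i : γ → σ} {g : γ → α → σ → σ} (hl : PTB B l)
    (hi : PTB B i) (hg : PT (fun p : γ × σ × α => g p.1 p.2.2 p.2.1)) {G : γ → ℕ}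
    (hG : PolyBdd B G) (hb : ∀ c s a, a ∈ l c → size (g c a s) ≤ size s + G c) :
    PTB B (fun c => (l c).foldr (g c) (i c)) :=
  (PTB.foldl_of_growth (g := fun c s a => g c a s) hl.reverse hi hg hG
    fun c s a ha => hb c s a (List.mem_reverse.1 ha)).congr fun c => by simp

/-! Natural numbers in unary -/

theorem bits_nat (n : ℕ) : bits n = bits (List.replicate n ()) := by
  induction n with
  | zero => rfl
  | succ n ih => rw [bits_succ, List.replicate_succ, bits_cons, ih]; rfl

theorem PTB.replicate_unit {f : γ → ℕ} (hf : PTB B f) :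
    PTB B (fun c => List.replicate (f c) ()) := hf.recast fun _ => (bits_nat _).symm

theorem PTB.length {l : γ → List α} (hl : PTB B l) : PTB B (fun c => (l c).length) :=
  (hl.map (g := fun _ _ => ()) (PT.const _)).recast fun c => by
    rw [bits_nat, List.map_const']

theorem PTB.add {f g : γ → ℕ} (hf : PTB B f) (hg : PTB B g) : PTB B (fun c => f c + g c) :=
  (hf.replicate_unit.append hg.replicate_unit).length.congr fun c => by simp

theorem PTB.mul {f g : γ → ℕ} (hf : PTB B f) (hg : PTB B g) : PTB B (fun c => f c * g c) :=
  (PTB.comp (g := fun p : List Unit × List Unit => (p.1.flatMap fun _ => p.2).length)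
    (PT.left.flatMap PT.left.snd).length (hf.replicate_unit.pair hg.replicate_unit)).congr
    fun c => by simp

theorem PTB.sub {f g : γ → ℕ} (hf : PTB B f) (hg : PTB B g) : PTB B (fun c => f c - g c) :=
  (PTB.foldl_of_growth (l := fun c => List.replicate (g c) ())
    (i := fun c => List.replicate (f c) ()) (g := fun _ s _ => s.tail) hg.replicate_unit
    hf.replicate_unit PT.right.fst.tail (PolyBdd.const 0) (by
      intro c s a _
      cases s
      · simp
      · simp only [List.tail_cons, size_cons]; omega)).length.congr fun c => by
      generalize f c = m
      generalize g c = n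
      induction n generalizing m with
      | zero => simp
      | succ n ih =>
        rw [List.replicate_succ, List.foldl_cons, List.tail_replicate, ← ih]
        omega

theorem PTB.decide_eq_zero {f : γ → ℕ} (hf : PTB B f) : PTB B (fun c => decide (f c = 0)) :=
  hf.replicate_unit.isEmpty.congr fun c => by cases f c <;> simp

theorem PTB.decide_le {f g : γ → ℕ} (hf : PTB B f) (hg : PTB B g) :
    PTB B (fun c => decide (f c ≤ g c)) :=
  (hf.sub hg).decide_eq_zero.congr fun c => by simp [Nat.sub_eq_zero_iff_le]

theorem PTB.decide_lt {f g : γ → ℕ} (hf : PTB B f) (hg : PTB B g) :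
    PTB B (fun c => decide (f c < g c)) :=
  (hg.decide_le hf).not.congr fun c => by
    rw [Bool.eq_iff_iff]; simp

theorem PTB.min {f g : γ → ℕ} (hf : PTB B f) (hg : PTB B g) :
    PTB B (fun c => min (f c) (g c)) :=
  (hf.sub (hf.sub hg)).congr fun c => by omega

theorem PTB.sum {l : γ → List ℕ} (hl : PTB B l) : PTB B (fun c => (l c).sum) :=
  (hl.flatMap (g := fun _ n => List.replicate n ()) PT.right.replicate_unit).length.congr
    fun c => by
      induction l c with
      | nil => rfl
      | cons a l ih => simp

/-! Equality -/

/-- Equality on `α` is decidable in polynomial time. -/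
def PTEq (α : Type) [Enc α] : Prop := ∃ e : α × α → Bool, PT e ∧ ∀ p, e p = true ↔ p.1 = p.2

theorem PTEq.decide_eq (h : PTEq α) {f g : γ → α} [∀ c, Decidable (f c = g c)] (hf : PTB B f)
    (hg : PTB B g) : PTB B (fun c => decide (f c = g c)) := by
  obtain ⟨e, he, he'⟩ := h
  exact (PTB.comp he (hf.pair hg)).congr fun c => by
    rw [Bool.eq_iff_iff, he']; simp

theorem PTEq.bool : PTEq Bool :=
  ⟨_, (PT.left.xor PT.right).not, fun p => by rcases p with ⟨_ | _, _ | _⟩ <;> simp⟩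

theorem PTEq.prod (h : PTEq α) (h' : PTEq β) : PTEq (α × β) := by
  classical
  exact ⟨_, (h.decide_eq PT.left.fst PT.right.fst).and (h'.decide_eq PT.left.snd PT.right.snd),
    fun p => by simp [Prod.ext_iff]⟩

/-- The fold over the first list carries a flag and the unread part of the second. The lists agree
if the flag survives and nothing is left unread; `default` is read only when the flag is being
cleared anyway. -/
theorem PTEq.list [Inhabited α] (h : PTEq α) : PTEq (List α) := by
  classical
  have h1 : PT fun p : List α × List α => p.1.foldl (fun (s : Bool × List α) a =>
      (s.1 && !s.2.isEmpty && decide (s.2.headD default = a), s.2.tail)) (true, p.2) := by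
    refine PTB.foldl_of_growth (i := fun p : List α × List α => (true, p.2))
      (g := fun _ (s : Bool × List α) a =>
        (s.1 && !s.2.isEmpty && decide (s.2.headD default = a), s.2.tail)) PT.left
      ((PT.const _).pair PT.right) ?_ (PolyBdd.const 3) ?_
    · exact ((PT.right.fst.fst.and PT.right.fst.snd.isEmpty.not).and
        (h.decide_eq (PT.right.fst.snd.headD _) PT.right.snd)).pair PT.right.fst.snd.tail
    · rintro c ⟨b, s⟩ a -
      have h1 := size_bool (b && !s.isEmpty && decide (s.headD default = a))
      have h2 := size_pos b
      simp only [size_pair]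
      have h3 : size s.tail ≤ size s := by
        cases s
        · simp
        · simp only [List.tail_cons, size_cons]; omega
      omega
  refine ⟨_, h1.fst.and h1.snd.isEmpty, ?_⟩
  rintro ⟨l, l'⟩
  have key : ∀ (l l' : List α) (b : Bool), (let s := l.foldl (fun (s : Bool × List α) a =>
      (s.1 && !s.2.isEmpty && decide (s.2.headD default = a), s.2.tail)) (b, l')
      (s.1 && s.2.isEmpty)) = (b && decide (l = l')) := by
    intro l
    induction l with
    | nil => intro l' b; cases l' <;> simp
    | cons a l ih =>
      intro l' b
      have := ih l'.tail (b && !l'.isEmpty && decide (l'.headD default = a))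
      simp only [List.foldl_cons] at this ⊢
      rw [this]
      cases l' with
      | nil => simp
      | cons a' l' =>
        rcases eq_or_ne a a' with rfl | hne
        · rw [Bool.eq_iff_iff]
          simp only [List.isEmpty_cons, Bool.not_false, Bool.and_true, List.headD_cons,
            decide_true, List.tail_cons, Bool.and_eq_true, List.cons.injEq, true_and]
          exact and_congr_right fun _ => decide_eq_true_iff.trans decide_eq_true_iff.symm
        · simp [hne, hne.symm]
  have := key l l' true
  simp only [Bool.true_and] at this
  rw [this, decide_eq_true_iff]

theorem PTB.decide_mem (h : PTEq α) {f : γ → α} {l : γ → List α} [∀ c, Decidable (f c ∈ l c)]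
    (hf : PTB B f) (hl : PTB B l) : PTB B (fun c => decide (f c ∈ l c)) := by
  classical
  exact (PTB.comp (g := fun p : α × List α => p.2.any fun b => decide (p.1 = b))
    (PT.right.any (h.decide_eq PT.left.fst PT.right)) (hf.pair hl)).congr fun c => by
      rw [Bool.eq_iff_iff]; simp

theorem PTB.dedup [DecidableEq α] (h : PTEq α) {l : γ → List α} (hl : PTB B l) :
    PTB B (fun c => (l c).dedup) := by
  refine (PTB.foldr_of_growth (i := fun _ => ([] : List α))
    (g := fun _ a s => if a ∈ s then s else a :: s) hl (hl.const _)
    (PTB.ite (PTB.decide_mem h PT.right.snd PT.right.fst) PT.right.fst (PT.right.snd.cons PT.right.fst))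
    (G := fun c => size (l c)) hl.2.2 ?_).congr fun c => ?_
  · intro c s a ha
    have := size_lt_of_mem ha
    split_ifs
    · omega
    · simp; omega
  · induction l c with
    | nil => rfl
    | cons a l ih =>
      rw [List.foldr_cons, ← ih]
      by_cases h : a ∈ l
      · simp [h]
      · simp [h]

theorem PTB.count [BEq α] [LawfulBEq α] (h : PTEq α) {f : γ → α} {l : γ → List α}
    (hf : PTB B f) (hl : PTB B l) : PTB B (fun c => (l c).count (f c)) := by
  classical
  exact (PTB.comp (g := fun p : α × List α => (p.2.filter fun b => decide (b = p.1)).length)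
    (PT.right.filter (h.decide_eq PT.right PT.left.fst)).length (hf.pair hl)).congr fun c => by
      rw [List.count_eq_length_filter]; congr 2; funext b; rw [Bool.eq_iff_iff]; simp

end

end StackProg

/-! ### Binary numbers -/

namespace StackProg

/-- The successor of a binary number, least significant bit first. -/
def inc : List Bool → List Bool
  | [] => [true]
  | false :: l => true :: l
  | true :: l => false :: inc l

/-- The value of a binary number. -/
def bitsVal (l : List Bool) : ℕ := l.foldr (fun b n => 2 * n + b.toNat) 0

theorem encodePosNum_succ (p : PosNum) : encodePosNum p.succ = inc (encodePosNum p) := by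
  induction p with
  | one => rfl
  | bit1 p ih => simp [PosNum.succ, encodePosNum, inc, ih]
  | bit0 p ih => simp [PosNum.succ, encodePosNum, inc]

theorem encodeNat_zero : encodeNat 0 = [] := rfl

theorem encodeNat_succ (n : ℕ) : encodeNat (n + 1) = inc (encodeNat n) := by
  have h : ((n + 1 : ℕ) : Num) = Num.succ (n : Num) := by
    rw [Nat.cast_succ, Num.add_one]
  unfold encodeNat
  rw [h]
  cases (n : Num) with
  | zero => rfl
  | pos p => exact encodePosNum_succ p

theorem bitsVal_inc (l : List Bool) : bitsVal (inc l) = bitsVal l + 1 := by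
  induction l with
  | nil => rfl
  | cons b l ih =>
    cases b
    · simp [inc, bitsVal]
    · simp only [inc, bitsVal, List.foldr_cons, Bool.toNat_false, Bool.toNat_true] at ih ⊢
      rw [ih]; omega

theorem bitsVal_encodeNat (n : ℕ) : bitsVal (encodeNat n) = n := by
  induction n with
  | zero => rfl
  | succ n ih => rw [encodeNat_succ, bitsVal_inc, ih]

theorem bitsVal_lt (l : List Bool) : bitsVal l < 2 ^ l.length := by
  induction l with
  | nil => simp [bitsVal]
  | cons b l ih =>
    simp only [bitsVal, List.foldr_cons, List.length_cons, pow_succ] at ih ⊢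
    cases b <;> simp <;> omega

theorem lt_two_pow_encodeNat_length (n : ℕ) : n < 2 ^ (encodeNat n).length := by
  conv_lhs => rw [← bitsVal_encodeNat n]
  exact bitsVal_lt _

theorem two_pow_encodeNat_length_le {n : ℕ} (hn : n ≠ 0) :
    2 ^ (encodeNat n).length ≤ 2 * n := by
  have key : ∀ p : PosNum, 2 ^ (encodePosNum p).length ≤ 2 * (p : ℕ) := by
    intro p
    induction p with
    | one => simp [encodePosNum]
    | bit1 p ih => simp only [encodePosNum, List.length_cons, pow_succ, PosNum.cast_bit1]; omega
    | bit0 p ih => simp only [encodePosNum, List.length_cons, pow_succ, PosNum.cast_bit0]; omega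
  unfold encodeNat
  have h : ((n : Num) : ℕ) = n := Num.to_of_nat n
  cases hc : (n : Num) with
  | zero => rw [hc] at h; exact absurd h.symm hn
  | pos p =>
    rw [hc] at h
    have := key p
    rw [show (p : ℕ) = n from h] at this
    exact this

theorem encodeNat_length_le (n : ℕ) : (encodeNat n).length ≤ n := by
  rcases Nat.eq_zero_or_pos n with rfl | h
  · simp [encodeNat_zero]
  · have h1 := two_pow_encodeNat_length_le h.ne'
    have h2 : (encodeNat n).length < 2 ^ (encodeNat n).length := Nat.lt_two_pow_self
    by_contra hc
    have h3 : 2 ^ (n + 1) ≤ 2 ^ (encodeNat n).length := Nat.pow_le_pow_right (by omega) (by omega)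
    have h4 : n < 2 ^ n := Nat.lt_two_pow_self
    rw [pow_succ] at h3
    omega

theorem encodeNat_injective : Function.Injective encodeNat := fun a b h => by
  rw [← bitsVal_encodeNat a, h, bitsVal_encodeNat]

section
variable {γ : Type} [Enc γ] {B : γ → ℕ}

@[simp] theorem size_true : size true = 3 := rfl
@[simp] theorem size_false : size false = 1 := rfl

theorem size_inc_le (l : List Bool) : size (inc l) ≤ size l + 4 := by
  induction l with
  | nil => simp [inc]
  | cons b l ih => cases b <;> simp [inc] <;> omega

/-- A fold with a carry and the output in reverse; a carry that is left over becomes a new leading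
digit. -/
theorem PT.inc : PT StackProg.inc := by
  have h1 : PT fun l : List Bool => l.foldl (fun (s : Bool × List Bool) a =>
      (s.1 && a, Bool.xor s.1 a :: s.2)) (true, []) := by
    refine PTB.foldl_of_growth (l := fun l : List Bool => l) (i := fun _ => (true, []))
      (g := fun _ (s : Bool × List Bool) a => (s.1 && a, Bool.xor s.1 a :: s.2)) PT.id
      (PT.const _) ?_ (PolyBdd.const 6) ?_
    · exact (PT.right.fst.fst.and PT.right.snd).pair
        ((PT.right.fst.fst.xor PT.right.snd).cons PT.right.fst.snd)
    · rintro c ⟨b, s⟩ a -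
      cases b <;> cases a <;> simp <;> omega
  refine ((h1.fst.cond (PTB.cons (PT.const true) h1.snd) h1.snd).reverse).congr fun l => ?_
  have key : ∀ (l : List Bool) (c : Bool) (o : List Bool),
      (let s := l.foldl (fun (s : Bool × List Bool) a =>
        (s.1 && a, Bool.xor s.1 a :: s.2)) (c, o)
      (bif s.1 then true :: s.2 else s.2).reverse) =
        o.reverse ++ bif c then StackProg.inc l else l := by
    intro l
    induction l with
    | nil => intro c o; cases c <;> simp [StackProg.inc]
    | cons a l ih =>
      intro c o
      simp only [List.foldl_cons] at ih ⊢
      rw [ih]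
      cases c <;> cases a <;> simp [StackProg.inc]
  exact (key l true []).symm

theorem PTB.encodeNat {f : γ → ℕ} (hf : PTB B f) : PTB B (fun c => encodeNat (f c)) := by
  refine PTB.comp (g := fun n : ℕ => Computability.encodeNat n) ?_ hf
  refine (PTB.foldl_of_growth (l := fun n : ℕ => List.replicate n ())
    (i := fun _ => ([] : List Bool)) (g := fun _ s _ => StackProg.inc s)
    (PTB.replicate_unit PT.id) (PT.const _) (PT.inc.comp PT.right.fst) (PolyBdd.const 4)
    (fun c s a _ => size_inc_le s)).congr fun n => ?_
  induction n with
  | zero => rfl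
  | succ n ih => rw [List.replicate_succ', List.foldl_append, ← ih, encodeNat_succ]; rfl

/-- The unary value of a binary word can be exponentially long. Truncating at `f c` after every
doubling keeps the number small and does not change the truncated result. -/
theorem PTB.min_bitsVal {f : γ → ℕ} {l : γ → List Bool} (hf : PTB B f) (hl : PTB B l) :
    PTB B (fun c => Nat.min (bitsVal (l c)) (f c)) := by
  refine PTB.comp (g := fun p : List Bool × ℕ => Nat.min (bitsVal p.1) p.2) ?_ (hl.pair hf)
  refine (PTB.foldl_of_bound (l := fun p : List Bool × ℕ => p.1.reverse) (i := fun _ => 0)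
    (g := fun p n b => Min.min (2 * n + (bif b then 1 else 0)) p.2) PT.left.reverse (PT.const _)
    ((((PTB.const PT.id 2).mul PT.right.fst).add
      (PT.right.snd.cond (PTB.const PT.id 1) (PTB.const PT.id 0))).min PT.left.snd)
    (M := fun p => size p.2) PT.right.2.2 ?_).congr ?_
  · intro p l₁ _ _
    rcases List.eq_nil_or_concat l₁ with rfl | ⟨l, b, rfl⟩
    · simp
    · simp
  · intro p
    rw [List.foldl_reverse]
    generalize p.1 = l
    generalize p.2 = m
    induction l with
    | nil => simp [bitsVal]
    | cons b l ih =>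
      simp only [bitsVal, List.foldr_cons] at ih ⊢
      rw [← ih]
      have h : ∀ b : Bool, b.toNat = bif b then 1 else 0 := by decide
      rw [h]
      simp only [Nat.min_def]
      split_ifs <;> omega

end

/-! ### Reading and writing words -/

instance : Enc Γ' where
  tree
    | .bit false => Enc.tree 0
    | .bit true => Enc.tree 1
    | .bra => Enc.tree 2
    | .ket => Enc.tree 3
    | .comma => Enc.tree 4
    | .blank => Enc.tree 5

/-- Programs branch on bits only, so the unary number of a symbol is decoded by walking down the
list of symbols. -/
def emitSym : List Γ' → Prog
  | [] => .skip
  | s :: l => .pop (.bank .val) fun o =>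
      if o = some true then .seq (.pop (.bank .val) fun _ => .skip) (emitSym l)
      else .push .out s

theorem runs_push_out (e : Ext) (S : Bank → List Bool) (a : Γ') :
    Runs (.push .out a) (store e S) (store { e with out := a :: e.out } S) 1 := by
  refine ⟨1, le_rfl, ?_⟩
  have h := Run.push (store e S) .out a
  rwa [update_store_out] at h

theorem runs_push_ans (e : Ext) (S : Bank → List Bool) (a : Bool) :
    Runs (.push .ans a) (store e S) (store { e with ans := a :: e.ans } S) 1 := by
  refine ⟨1, le_rfl, ?_⟩
  have h := Run.push (store e S) .ans a
  rwa [update_store_ans] at h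

theorem runs_emitSym (e : Ext) (x y : List Bool) (s : Γ') : ∀ (l : List Γ') (n : ℕ),
    l[n]? = some s → Runs (emitSym l) (conf e (bits n ++ x) y)
      (conf { e with out := s :: e.out } x y) (3 * n + 2) := by
  intro l
  induction l with
  | nil => intro n h; simp at h
  | cons s' l ih =>
    intro n h
    cases n with
    | zero =>
      obtain rfl : s' = s := by simpa using h
      exact (runs_pop_val (b := false) (runs_push_out e _ s')).mono (by omega)
    | succ n =>
      have h1 := ih n (by simpa using h)
      refine ((runs_pop_val (b := true) (x := false :: (bits n ++ x)) (e := e) (y := y) ?_).mono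
        (T := 1 + (1 + 1 + (3 * n + 2))) (by omega)).congr_left (by simp [bits_succ])
      simp only [if_true]
      exact (runs_pop_val (Runs.skip _)).seq h1

def symbols : List Γ' := [.bit false, .bit true, .bra, .ket, .comma, .blank]

theorem runs_emitSym_symbols (e : Ext) (x y : List Bool) (s : Γ') :
    Runs (emitSym symbols) (conf e (bits s ++ x) y) (conf { e with out := s :: e.out } x y) 17 := by
  rcases s with _ | (_ | _) | _ | _ | _
  · exact (runs_emitSym e x y _ symbols 5 rfl).mono (by omega)
  · exact (runs_emitSym e x y _ symbols 0 rfl).mono (by omega)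
  · exact (runs_emitSym e x y _ symbols 1 rfl).mono (by omega)
  · exact (runs_emitSym e x y _ symbols 2 rfl).mono (by omega)
  · exact (runs_emitSym e x y _ symbols 3 rfl).mono (by omega)
  · exact (runs_emitSym e x y _ symbols 4 rfl).mono (by omega)

/-- Pops a list of symbols from the value stack and writes it in reverse order. -/
def emit : Prog := .loop (.bank .val) (fun o => o != some true) fun _ => emitSym symbols

theorem runs_emit (x y : List Bool) (l : List Γ') : ∀ e : Ext,
    Runs emit (conf e (bits l ++ x) y) (conf { e with out := l.reverse ++ e.out } x y)
      (18 * l.length + 1) := by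
  induction l with
  | nil =>
    intro e
    refine (Runs.loop_exit (a := false) (l := x) rfl rfl).cast ?_ (by simp)
    rw [banks_update_val]; rfl
  | cons s l ih =>
    intro e
    refine (Runs.loop_step (a := true) (l := bits s ++ (bits l ++ x)) (by simp [banks, bits_cons])
      rfl ((runs_emitSym_symbols e _ y s).congr_left ?_) (ih _)).cast ?_
      (by rw [List.length_cons]; omega)
    · rw [banks_update_val]
    · simp

def emitBool : Prog := .pop (.bank .val) fun o =>
  if o = some true then .seq (.pop (.bank .val) fun _ => .skip)
    (.seq (.pop (.bank .val) fun _ => .skip) (.push .ans true))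
  else .push .ans false

theorem runs_emitBool (e : Ext) (x y : List Bool) (b : Bool) :
    Runs emitBool (conf e (bits b ++ x) y) (conf { e with ans := b :: e.ans } x y) 6 := by
  cases b
  · exact (runs_pop_val (b := false) (runs_push_ans e _ false)).mono (by omega)
  · refine (runs_pop_val (b := true) (x := false :: false :: x) (T := (1 + 1) + ((1 + 1) + 1))
      ?_).mono (by omega)
    simp only [if_true]
    exact (runs_pop_val (Runs.skip _)).seq ((runs_pop_val (Runs.skip _)).seq (runs_push_ans e _ true))

/-- Reverses the input onto the output stack. -/
def flipInput : Prog := .loop .inp (fun o => o.isNone) fun o => match o with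
  | none => .skip
  | some a => .push .out a

theorem runs_flipInput (S : Bank → List Bool) (w : List Γ') : ∀ e : Ext, e.inp = w →
    Runs flipInput (store e S) (store { e with inp := [], out := w.reverse ++ e.out } S)
      (2 * w.length + 1) := by
  induction w with
  | nil =>
    rintro e he
    have h1 : store e S .inp = [] := he
    refine ⟨1, by simp, ?_⟩
    have h2 := Run.loop_exit (s := store e S) (k := .inp) (final := fun o => o.isNone)
      (f := fun o => match o with
        | none => .skip
        | some a => .push .out a) (by rw [h1]; rfl)
    rw [h1, List.tail_nil, update_store_inp] at h2
    exact h2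
  | cons a w ih =>
    rintro e he
    have h1 : store e S .inp = a :: w := he
    obtain ⟨t, ht, hr⟩ := ih { e with inp := w, out := a :: e.out } rfl
    obtain ⟨t', ht', hr'⟩ := runs_push_out { e with inp := w } S a
    rw [show (a :: w).reverse ++ e.out = w.reverse ++ a :: e.out by simp]
    refine ⟨1 + t' + t, by simp; omega, .loop_step (s' := store { e with inp := w, out := a :: e.out } S)
      (by rw [h1]; rfl) ?_ hr⟩
    rw [h1, List.tail_cons, update_store_inp]
    exact hr'

/-- Runs `p a` on the symbols `a` popped from the output stack. -/
def scan (p : Γ' → Prog) : Prog := .loop .out (fun o => o.isNone) fun o => match o with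
  | none => .skip
  | some a => p a

theorem runs_scan {σ : Type} [Enc σ] {g : Γ' → σ → σ} {p : Γ' → Prog} {c C : ℕ}
    (hp : ∀ a, Computes (p a) (g a) fun s => (size s + 2) ^ c)
    (hC : ∀ a s, size (g a s) ≤ size s + C) (y : List Bool) (w : List Γ') :
    ∀ (e : Ext) (s : σ), e.out = w →
    Runs (scan p) (conf e (bits s) y)
      (conf { e with out := [] } (bits (w.foldl (fun s a => g a s) s)) y)
      (w.length * (1 + (size s + w.length * C + 2) ^ c) + 1) := by
  induction w with
  | nil =>
    rintro e s he
    have h1 : conf e (bits s) y .out = [] := he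
    refine ⟨1, by simp, ?_⟩
    have h2 := Run.loop_exit (s := conf e (bits s) y) (k := .out) (final := fun o => o.isNone)
      (f := fun o => match o with
        | none => .skip
        | some a => p a) (by rw [h1]; rfl)
    rw [h1, List.tail_nil, update_store_out] at h2
    exact h2
  | cons a w ih =>
    rintro e s he
    have h1 : conf e (bits s) y .out = a :: w := he
    obtain ⟨t, ht, hr⟩ := ih { e with out := w } (g a s) rfl
    obtain ⟨t', ht', hr'⟩ := hp a s { e with out := w } [] y
    rw [List.append_nil, List.append_nil] at hr'
    refine ⟨1 + t' + t, ?_, .loop_step (s' := conf { e with out := w } (bits (g a s)) y)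
      (by rw [h1]; rfl) ?_ hr⟩
    · have h2 : (size s + 2) ^ c ≤ (size s + (w.length + 1) * C + 2) ^ c :=
        Nat.pow_le_pow_left (by omega) c
      have h3 : (size (g a s) + w.length * C + 2) ^ c ≤ (size s + (w.length + 1) * C + 2) ^ c := by
        refine Nat.pow_le_pow_left ?_ c
        have := hC a s
        rw [Nat.add_mul]; omega
      have h4 := Nat.mul_le_mul_left w.length (Nat.add_le_add_left h3 1)
      simp only [List.length_cons] at ht' ⊢
      generalize (size s + (w.length + 1) * C + 2) ^ c = P at *
      rw [Nat.add_mul w.length 1, Nat.one_mul]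
      omega
    · rw [h1, List.tail_cons, update_store_out]
      exact hr'

/-- Reads a word, folding it from the right. -/
theorem exists_reader {σ : Type} [Enc σ] {g : Γ' → σ → σ} (hg : ∀ a, PT (g a)) {C : ℕ}
    (hC : ∀ a s, size (g a s) ≤ size s + C) (s₀ : σ) :
    ∃ p c, ∀ w, Runs p (single .inp w) (conf ⟨[], [], []⟩ (bits (w.foldr g s₀)) [])
      ((w.length + 2) ^ c) := by
  choose hg' _ using hg
  choose p T hp hT using hg'
  choose c hc using hT
  -- A common exponent for the finitely many symbols.
  let d := ∑ a, c a
  have hp' : ∀ a, Computes (p a) (g a) fun s => (size s + 2) ^ d := fun a s e x y =>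
    (hp a s e x y).mono ((hc a s).trans (Nat.pow_le_pow_right (by omega)
      (Finset.single_le_sum (fun _ _ => Nat.zero_le _) (Finset.mem_univ a))))
  have hpoly : PolyBdd (fun w : List Γ' => w.length) fun w => (2 * w.length + 1) + ((size s₀ + 1) +
      (w.length * (1 + (size s₀ + w.length * C + 2) ^ d) + 1)) :=
    (((PolyBdd.const 2).mul PolyBdd.self).add (PolyBdd.const 1)).add ((PolyBdd.const _).add
      ((PolyBdd.self.mul ((PolyBdd.const 1).add ((((PolyBdd.const _).add (PolyBdd.self.mul
        (PolyBdd.const C))).add (PolyBdd.const 2)).pow d))).add (PolyBdd.const 1)))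
  obtain ⟨c', hc'⟩ := hpoly
  -- After the reversal the last symbol of the word is on top of `.out`, so the left fold performed
  -- by `scan` is the right fold of the word. It also leaves `.out` empty for the result.
  refine ⟨.seq flipInput (.seq (pushAll (bits s₀)) (scan p)), c', fun w => ?_⟩
  have h1 := runs_flipInput (banks [] []) w ⟨w, [], []⟩ rfl
  have h2 := runs_pushAll ⟨[], w.reverse ++ [], []⟩ (bits s₀) [] []
  have h3 := runs_scan hp' hC [] w.reverse ⟨[], w.reverse ++ [], []⟩ s₀ (by simp)
  rw [List.append_nil (bits s₀)] at h2
  refine ((h1.seq (h2.seq h3)).congr_left ?_).cast ?_ ((le_of_eq ?_).trans (hc' w))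
  · funext k
    rcases k with _ | _ | _ | i
    · simp [single, store]
    · simp [single, store]
    · simp [single, store]
    · cases i <;> simp [single, store, banks]
  · simp
  · simp [size]

theorem conf_out (w : List Γ') : conf ⟨[], w, []⟩ [] [] = single .out w := by
  funext k
  rcases k with _ | _ | _ | i
  · simp [single, store]
  · simp [single, store]
  · simp [single, store]
  · cases i <;> simp [single, store, banks]

theorem conf_ans (w : List Bool) : conf ⟨[], [], w⟩ [] [] = single .ans w := by
  funext k
  rcases k with _ | _ | _ | i
  · simp [single, store]
  · simp [single, store]
  · simp [single, store]
  · cases i <;> simp [single, store, banks]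

theorem outputs_cast {tm : FinTM2} {l l' : List (tm.Γ tm.k₀)} {o o' : List (tm.Γ tm.k₁)} {T : ℕ}
    (h : Nonempty (TM2OutputsInTime tm l' (some o') T)) (hl : l = l') (ho : o = o') :
    Nonempty (TM2OutputsInTime tm l (some o) T) := by
  subst hl ho; exact h

/-- A machine that reads a word, computes a function of it in polynomial time and writes the
result. -/
theorem exists_machine_word {σ : Type} [Enc σ] {g : Γ' → σ → σ} (hg : ∀ a, PT (g a)) {C : ℕ}
    (hC : ∀ a s, size (g a s) ≤ size s + C) (s₀ : σ) {f : σ → List Γ'} (hf : PT f) :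
    ∃ (M : TM2ComputableAux Γ' Γ') (c : ℕ), ∀ w : List Γ',
      Nonempty (TM2OutputsInTime M.tm (w.map M.inputAlphabet.invFun)
        (some ((f (w.foldr g s₀)).map M.outputAlphabet.invFun)) ((w.length + 2) ^ c)) := by
  obtain ⟨p, c, hp⟩ := exists_reader hg hC s₀
  -- `emit` writes in reverse order, hence the reversed word is computed.
  obtain ⟨⟨q, T, hq, hT⟩, -, hs⟩ := hf.reverse
  let st : List Γ' → σ := fun w => w.foldr g s₀
  have hst : PolyBdd (fun w : List Γ' => w.length) fun w => size (st w) := by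
    refine ((PolyBdd.const (size s₀)).add (PolyBdd.self.mul (PolyBdd.const C))).mono fun w => ?_
    induction w with
    | nil => simp [st]
    | cons a w ih =>
      have := hC a (st w)
      simp only [st, List.foldr_cons, List.length_cons, Nat.add_mul] at *
      omega
  have hpoly : PolyBdd (fun w : List Γ' => w.length) fun w => (w.length + 2) ^ c + (T (st w) +
      (18 * size (f (st w)).reverse + 1)) + 1 :=
    (((PolyBdd.self.add (PolyBdd.const 2)).pow c).add ((hT.comp hst).add
      (((PolyBdd.const 18).mul (hs.comp hst)).add (PolyBdd.const 1)))).add (PolyBdd.const 1)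
  obtain ⟨d, hd⟩ := hpoly
  refine ⟨⟨machine Stack.inp Stack.out (.seq p (.seq q emit)), Equiv.refl Γ', Equiv.refl Γ'⟩, d,
    fun w => ?_⟩
  have h1 := hq (st w) ⟨[], [], []⟩ [] []
  rw [List.append_nil] at h1
  have h2 := runs_emit [] [] (f (st w)).reverse ⟨[], [], []⟩
  obtain ⟨t, ht, hr⟩ := (hp w).seq (h1.seq h2)
  rw [List.append_nil, List.reverse_reverse, conf_out] at hr
  have h3 := hr.outputs (T := (w.length + 2) ^ d) (by
    have := hd w
    have := length_lt_size (f (st w)).reverse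
    simp only at *; omega)
  have e1 : ∀ l : List Γ', l.map (Equiv.refl Γ').invFun = l := fun l => List.map_id l
  exact outputs_cast h3 (e1 w) (e1 _)

/-- A machine that reads a word and decides a property of it. -/
theorem exists_machine_bool {σ : Type} [Enc σ] {g : Γ' → σ → σ} (hg : ∀ a, PT (g a)) {C : ℕ}
    (hC : ∀ a s, size (g a s) ≤ size s + C) (s₀ : σ) {B : σ → ℕ} {f : σ → Bool} (hf : PTB B f) :
    ∃ (M : TM2ComputableAux Γ' Bool) (c : ℕ), ∀ w : List Γ',
      Nonempty (TM2OutputsInTime M.tm (w.map M.inputAlphabet.invFun)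
        (some ((encodeBool (f (w.foldr g s₀))).map M.outputAlphabet.invFun))
          ((w.length + B (w.foldr g s₀) + 2) ^ c)) := by
  obtain ⟨p, c, hp⟩ := exists_reader hg hC s₀
  obtain ⟨⟨q, T, hq, hT⟩, -, -⟩ := hf
  let st : List Γ' → σ := fun w => w.foldr g s₀
  let N : List Γ' → ℕ := fun w => w.length + B (st w)
  have hpoly : PolyBdd N fun w => (w.length + 2) ^ c + (T (st w) + 6) + 1 := by
    have h1 : PolyBdd N fun w => B (st w) := PolyBdd.self.mono fun w => by simp only [N]; omega
    have h2 : PolyBdd N fun w => w.length := PolyBdd.self.mono fun w => by simp only [N]; omega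
    exact (((h2.add (PolyBdd.const 2)).pow c).add ((hT.comp h1).add (PolyBdd.const 6))).add
      (PolyBdd.const 1)
  obtain ⟨d, hd⟩ := hpoly
  refine ⟨⟨machine Stack.inp Stack.ans (.seq p (.seq q emitBool)), Equiv.refl Γ', Equiv.refl Bool⟩, d,
    fun w => ?_⟩
  have h1 := hq (st w) ⟨[], [], []⟩ [] []
  rw [List.append_nil] at h1
  have h2 := runs_emitBool ⟨[], [], []⟩ [] [] (f (st w))
  obtain ⟨t, ht, hr⟩ := (hp w).seq (h1.seq h2)
  rw [conf_ans] at hr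
  have h3 := hr.outputs (T := (N w + 2) ^ d) (by
    have := hd w
    simp only at *; omega)
  have e1 : ∀ l : List Γ', l.map (Equiv.refl Γ').invFun = l := fun l => List.map_id l
  have e2 : ∀ l : List Bool, l.map (Equiv.refl Bool).invFun = l := fun l => List.map_id l
  exact outputs_cast h3 (e1 w) (e2 _)

end StackProg

/-! ### The maximum excess of a system of linear equations -/

namespace LinExcess

/-- The sign `(-1) ^ a`. -/
def sgn (a : ZMod 2) : ℤ := if a = 0 then 1 else -1

@[simp] theorem sgn_zero : sgn 0 = 1 := rfl

theorem sgn_add (a b : ZMod 2) : sgn (a + b) = sgn a * sgn b := by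
  revert a b; decide

theorem sgn_add_one (a : ZMod 2) : sgn (a + 1) = -sgn a := by revert a; decide

theorem sgn_sum {ι : Type*} (s : Finset ι) (f : ι → ZMod 2) :
    sgn (∑ i ∈ s, f i) = ∏ i ∈ s, sgn (f i) := by
  classical
  induction s using Finset.induction_on with
  | empty => rfl
  | insert a s ha ih => rw [Finset.sum_insert ha, Finset.prod_insert ha, sgn_add, ih]

theorem neg_one_le_sgn (a : ZMod 2) : -1 ≤ sgn a := by revert a; decide

/-- There are at most `(|M| + 1) ^ j` sums of at most `j` elements of `M`. -/
theorem exists_small_sums {V : Type*} [Fintype V] (M : Finset (V → ZMod 2)) (j : ℕ) :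
    ∃ S : Finset (V → ZMod 2), S.card ≤ (M.card + 1) ^ j ∧
      ∀ T ⊆ M, T.card ≤ j → ∑ b ∈ T, b ∈ S := by
  classical
  induction j with
  | zero =>
    refine ⟨{0}, by simp, fun T _ hT => ?_⟩
    rw [Finset.card_eq_zero.1 (Nat.le_zero.1 hT)]; simp
  | succ j ih =>
    obtain ⟨S, hS, h⟩ := ih
    -- A sum of at most `j + 1` elements is a sum of at most `j` plus an element of `M`, or plus `0`
    -- for the empty sum.
    refine ⟨Finset.image₂ (· + ·) S (insert 0 M), ?_, fun T hTM hT => ?_⟩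
    · refine (Finset.card_image₂_le _ _ _).trans ?_
      rw [pow_succ]
      exact Nat.mul_le_mul hS (Finset.card_insert_le _ _)
    · rcases T.eq_empty_or_nonempty with rfl | ⟨a, ha⟩
      · refine Finset.mem_image₂.2 ⟨0, ?_, 0, Finset.mem_insert_self _ _, by simp⟩
        simpa using h ∅ (by simp) (by simp)
      · refine Finset.mem_image₂.2 ⟨∑ b ∈ T.erase a, b, h _ ((Finset.erase_subset _ _).trans hTM)
          (by rw [Finset.card_erase_of_mem ha]; omega), a, Finset.mem_insert_of_mem (hTM ha), ?_⟩
        exact Finset.sum_erase_add _ _ ha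

theorem exists_sum_eq_of_mem_span {V : Type*} {M : Finset (V → ZMod 2)} {x : V → ZMod 2}
    (hx : x ∈ Submodule.span (ZMod 2) (M : Set (V → ZMod 2))) :
    ∃ T ⊆ M, ∑ b ∈ T, b = x := by
  obtain ⟨f, -, hf⟩ := Submodule.mem_span_finset.1 hx
  refine ⟨M.filter fun a => f a ≠ 0, Finset.filter_subset _ _, ?_⟩
  rw [Finset.sum_filter, ← hf]
  refine Finset.sum_congr rfl fun a _ => ?_
  have : ∀ c : ZMod 2, c = 0 ∨ c = 1 := by decide
  rcases this (f a) with h | h <;> simp [h]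

/-! ### Lower bounds for the maximum excess. -/

section
variable {V : Type*} [Fintype V] [DecidableEq V]

/-- Orthogonality of characters: if `u i = 1`, adding the `i`-th unit vector to `z` flips every
sign. -/
theorem sum_sgn_dotProduct (u : V → ZMod 2) :
    ∑ z : V → ZMod 2, sgn (u ⬝ᵥ z) = if u = 0 then (Fintype.card (V → ZMod 2) : ℤ) else 0 := by
  split_ifs with h
  · subst h; simp
  · obtain ⟨i, hi⟩ := Function.ne_iff.1 h
    have hi' : u i = 1 := by
      have : ∀ a : ZMod 2, a ≠ 0 → a = 1 := by decide
      exact this _ hi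
    have key : ∑ z : V → ZMod 2, sgn (u ⬝ᵥ z) = ∑ z : V → ZMod 2, -sgn (u ⬝ᵥ z) := by
      refine Fintype.sum_equiv (Equiv.addRight (Pi.single i (1 : ZMod 2))) _ _ fun z => ?_
      rw [Equiv.coe_addRight, dotProduct_add, dotProduct_single, hi', mul_one, sgn_add_one,
        neg_neg]
    rw [Finset.sum_neg_distrib] at key
    linarith

/-- If the only subsets of `K ⊆ M` whose sum vanishes or lies in `M` are the empty set and the
singletons, then the excess can reach the total weight of `K`. -/
theorem exists_excess_ge_sum {M K : Finset (V → ZMod 2)} (w : (V → ZMod 2) → ℤ)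
    (ε : (V → ZMod 2) → ZMod 2) (hKM : K ⊆ M)
    (h0 : ∀ T ⊆ K, ∑ b ∈ T, b = 0 → T = ∅)
    (h1 : ∀ T ⊆ K, ∑ b ∈ T, b ∈ M → ∃ b, T = {b}) :
    ∃ z : V → ZMod 2, ∑ b ∈ K, w b ≤ ∑ u ∈ M, w u * sgn (u ⬝ᵥ z + ε u) := by
  set N : ℤ := (Fintype.card (V → ZMod 2) : ℤ) with hN
  have hNpos : 0 < N := by rw [hN]; exact_mod_cast Fintype.card_pos
  -- Up to normalisation `P` is a probability weight that favours assignments satisfying the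
  -- equations of `K`. Expanded over the subsets of `K` it is a sum of characters, so its total and
  -- its correlations with the equations can be read off.
  let P : (V → ZMod 2) → ℤ := fun z => ∏ b ∈ K, (1 + sgn (b ⬝ᵥ z + ε b))
  have hP : ∀ z, 0 ≤ P z := fun z => Finset.prod_nonneg fun b _ => by
    have := neg_one_le_sgn (b ⬝ᵥ z + ε b)
    omega
  have hexp : ∀ z, P z = ∑ T ∈ K.powerset, sgn ((∑ b ∈ T, b) ⬝ᵥ z + ∑ b ∈ T, ε b) := by
    intro z
    simp only [P, Finset.prod_one_add]
    refine Finset.sum_congr rfl fun T _ => ?_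
    rw [← sgn_sum, sum_dotProduct, Finset.sum_add_distrib]
  have hsum : ∑ z, P z = N := by
    simp only [hexp]
    rw [Finset.sum_comm, Finset.sum_eq_single ∅]
    · simp [hN]
    · intro T hT hne
      simp only [sgn_add]
      rw [← Finset.sum_mul, sum_sgn_dotProduct, if_neg fun h => hne (h0 T (Finset.mem_powerset.1 hT) h),
        zero_mul]
    · simp
  -- Only subsets of `K` with sum `u` correlate with the equation `u`. By `h1` such a subset is a
  -- singleton, hence `{u}` itself, which requires `u ∈ K`.
  have hmul : ∀ u ∈ M, ∑ z, P z * sgn (u ⬝ᵥ z + ε u) = if u ∈ K then N else 0 := by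
    intro u hu
    have e1 : ∀ T ∈ K.powerset, ∑ z : V → ZMod 2,
        sgn ((∑ b ∈ T, b) ⬝ᵥ z + ∑ b ∈ T, ε b) * sgn (u ⬝ᵥ z + ε u) =
          if ∑ b ∈ T, b = u then N * sgn (∑ b ∈ T, ε b + ε u) else 0 := by
      intro T _
      have : ∀ z : V → ZMod 2, sgn ((∑ b ∈ T, b) ⬝ᵥ z + ∑ b ∈ T, ε b) * sgn (u ⬝ᵥ z + ε u) =
          sgn ((∑ b ∈ T, b + u) ⬝ᵥ z) * sgn (∑ b ∈ T, ε b + ε u) := by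
        intro z
        rw [← sgn_add, ← sgn_add, add_dotProduct]
        congr 1; ring
      simp only [this]
      rw [← Finset.sum_mul, sum_sgn_dotProduct]
      have e2 : ∑ b ∈ T, b + u = 0 ↔ ∑ b ∈ T, b = u := by
        rw [add_eq_zero_iff_eq_neg]
        have : -u = u := by
          funext i
          exact (by decide : ∀ a : ZMod 2, -a = a) (u i)
        rw [this]
      simp only [e2]
      split_ifs <;> simp [hN]
    simp only [hexp, Finset.sum_mul]
    rw [Finset.sum_comm, Finset.sum_congr rfl e1]
    split_ifs with huK
    · rw [Finset.sum_eq_single {u}]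
      · have : ∀ a : ZMod 2, a + a = 0 := by decide
        simp [this]
      · intro T hT hne
        refine if_neg fun h => hne ?_
        obtain ⟨b, rfl⟩ := h1 T (Finset.mem_powerset.1 hT) (h ▸ hu)
        rw [Finset.sum_singleton] at h
        rw [h]
      · intro h; exact absurd (Finset.mem_powerset.2 (Finset.singleton_subset_iff.2 huK)) h
    · refine Finset.sum_eq_zero fun T hT => if_neg fun h => huK ?_
      obtain ⟨b, rfl⟩ := h1 T (Finset.mem_powerset.1 hT) (h ▸ hu)
      rw [Finset.sum_singleton] at h
      exact h ▸ Finset.mem_powerset.1 hT (Finset.mem_singleton_self b)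
  have htot : ∑ z, P z * ∑ u ∈ M, w u * sgn (u ⬝ᵥ z + ε u) = N * ∑ b ∈ K, w b := by
    simp only [Finset.mul_sum]
    rw [Finset.sum_comm]
    have e1 : ∀ u ∈ M, ∑ z, P z * (w u * sgn (u ⬝ᵥ z + ε u)) = if u ∈ K then N * w u else 0 := by
      intro u hu
      have e2 := hmul u hu
      calc ∑ z, P z * (w u * sgn (u ⬝ᵥ z + ε u)) = w u * ∑ z, P z * sgn (u ⬝ᵥ z + ε u) := by
            rw [Finset.mul_sum]; exact Finset.sum_congr rfl fun z _ => by ring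
        _ = _ := by rw [e2]; split_ifs <;> ring
    rw [Finset.sum_congr rfl e1, ← Finset.sum_filter, Finset.filter_mem_eq_inter,
      Finset.inter_eq_right.2 hKM]
  -- Otherwise every excess is at most the weight of `K` minus one, and so is the `P`-average, which
  -- was computed to be the weight of `K`.
  by_contra! hlt
  have h2 : ∑ z, P z * ∑ u ∈ M, w u * sgn (u ⬝ᵥ z + ε u) ≤
      ∑ z, P z * (∑ b ∈ K, w b - 1) :=
    Finset.sum_le_sum fun z _ => mul_le_mul_of_nonneg_left (by have := hlt z; omega) (hP z)
  rw [htot, ← Finset.sum_mul, hsum] at h2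
  nlinarith

/-- The case `K = {b}`, for systems in which a single weight already reaches the parameter. -/
theorem exists_excess_ge_weight {M : Finset (V → ZMod 2)} (hM : 0 ∉ M) (w : (V → ZMod 2) → ℤ)
    (ε : (V → ZMod 2) → ZMod 2) {b : V → ZMod 2} (hb : b ∈ M) :
    ∃ z : V → ZMod 2, w b ≤ ∑ u ∈ M, w u * sgn (u ⬝ᵥ z + ε u) := by
  have h := exists_excess_ge_sum (K := {b}) w ε (by simpa using hb) ?_ ?_
  · simpa using h
  · intro T hT h
    rcases Finset.subset_singleton_iff.1 hT with rfl | rfl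
    · rfl
    · rw [Finset.sum_singleton] at h
      exact absurd (h ▸ hb) hM
  · intro T hT h
    rcases Finset.subset_singleton_iff.1 hT with rfl | rfl
    · exact absurd (by simpa using h) hM
    · exact ⟨b, rfl⟩

/-- Take a basis of the span among the elements of `M`. A coordinate on which the whole basis
vanishes would vanish on all of `M`, so the supports of the basis vectors, each with at most `r`
elements, cover `V`. -/
theorem card_le_mul_finrank_span {M : Finset (V → ZMod 2)} {r : ℕ}
    (hr : ∀ u ∈ M, (Finset.univ.filter fun i => u i ≠ 0).card ≤ r)
    (hV : ∀ i, ∃ u ∈ M, u i ≠ 0) :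
    Fintype.card V ≤ r * Module.finrank (ZMod 2)
      (Submodule.span (ZMod 2) (M : Set (V → ZMod 2))) := by
  obtain ⟨b, hbM, hspan, hli⟩ := exists_linearIndependent (ZMod 2) (M : Set (V → ZMod 2))
  have hfin : b.Finite := M.finite_toSet.subset hbM
  lift b to Finset (V → ZMod 2) using hfin
  have hcard : Module.finrank (ZMod 2) (Submodule.span (ZMod 2) (M : Set (V → ZMod 2))) = b.card := by
    rw [← hspan]
    exact finrank_span_finset_eq_card hli
  rw [hcard]
  have hcov : (Finset.univ : Finset V) ⊆ b.biUnion fun u => Finset.univ.filter fun i => u i ≠ 0 := by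
    intro i _
    by_contra hi
    simp only [Finset.mem_biUnion, Finset.mem_filter, Finset.mem_univ, true_and, not_exists,
      not_and, not_not] at hi
    obtain ⟨u, hu, hui⟩ := hV i
    have hle : Submodule.span (ZMod 2) (b : Set (V → ZMod 2)) ≤
        LinearMap.ker (LinearMap.proj (R := ZMod 2) (φ := fun _ : V => ZMod 2) i) :=
      Submodule.span_le.2 fun a ha => hi a ha
    exact hui (hle (hspan ▸ Submodule.subset_span hu))
  calc Fintype.card V = (Finset.univ : Finset V).card := rfl
    _ ≤ _ := Finset.card_le_card hcov
    _ ≤ ∑ u ∈ b, (Finset.univ.filter fun i => u i ≠ 0).card := Finset.card_biUnion_le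
    _ ≤ ∑ u ∈ b, r := Finset.sum_le_sum fun u hu => hr u (hbM hu)
    _ = r * b.card := by rw [Finset.sum_const, smul_eq_mul, mul_comm]

/-- If the rank is large compared to the number of equations, the excess is at least `k`. -/
theorem exists_excess_ge_of_rank {M : Finset (V → ZMod 2)} (hM : 0 ∉ M) (w : (V → ZMod 2) → ℤ)
    (ε : (V → ZMod 2) → ZMod 2) (hw : ∀ u ∈ M, 1 ≤ w u) {k : ℕ}
    (hk : (M.card + 1) ^ (k - 1) < 2 ^ Module.finrank (ZMod 2)
      (Submodule.span (ZMod 2) (M : Set (V → ZMod 2)))) :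
    ∃ z : V → ZMod 2, (k : ℤ) ≤ ∑ u ∈ M, w u * sgn (u ⬝ᵥ z + ε u) := by
  classical
  obtain ⟨S, hS, hsmall⟩ := exists_small_sums M (k - 1)
  -- The span has `2 ^ rank` elements, more than the set `S` that contains all sums of at most `k -
  -- 1` elements.
  obtain ⟨x, hx, hxS⟩ : ∃ x ∈ Submodule.span (ZMod 2) (M : Set (V → ZMod 2)), x ∉ S := by
    by_contra! hc
    have h1 : Nat.card (Submodule.span (ZMod 2) (M : Set (V → ZMod 2))) ≤ S.card := by
      rw [← Set.ncard_coe_finset S]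
      exact Set.ncard_le_ncard (fun x hx => hc x hx) S.finite_toSet
    rw [Module.natCard_eq_pow_finrank (K := ZMod 2), Nat.card_zmod] at h1
    omega
  -- A shortest representation of `x`; it has at least `k` elements because `x ∉ S`.
  obtain ⟨T, hT, hmin⟩ := Finset.exists_min_image (M.powerset.filter fun T => ∑ b ∈ T, b = x)
    Finset.card (by
      obtain ⟨T, hT, h⟩ := exists_sum_eq_of_mem_span hx
      exact ⟨T, by simp [hT, h]⟩)
  simp only [Finset.mem_filter, Finset.mem_powerset] at hT hmin
  obtain ⟨hTM, hTx⟩ := hT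
  have hcard : k ≤ T.card := by
    by_contra hlt
    exact hxS (hTx ▸ hsmall T hTM (by omega))
  have hself : ∀ u : V → ZMod 2, u + u = 0 := fun u =>
    funext fun i => (by decide : ∀ a : ZMod 2, a + a = 0) (u i)
  have hex := exists_excess_ge_sum (K := T) w ε hTM ?_ ?_
  · obtain ⟨z, hz⟩ := hex
    refine ⟨z, le_trans ?_ hz⟩
    calc (k : ℤ) ≤ T.card := by exact_mod_cast hcard
      _ = ∑ b ∈ T, (1 : ℤ) := by simp
      _ ≤ _ := Finset.sum_le_sum fun b hb => hw b (hTM hb)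
  -- A nonempty subset with sum zero could be deleted from the representation.
  · intro U hU h
    have h1 := Finset.sum_sdiff (f := fun b : V → ZMod 2 => b) hU
    rw [h, add_zero] at h1
    have h2 := hmin (T \ U) ⟨Finset.sdiff_subset.trans hTM, h1.trans hTx⟩
    rw [Finset.card_sdiff_of_subset hU] at h2
    have h3 := Finset.card_le_card hU
    exact Finset.card_eq_zero.1 (by
      by_contra h4
      omega)
  · intro U hU h
    have h1 := Finset.sum_sdiff (f := fun b : V → ZMod 2 => b) hU
    have hne : U ≠ ∅ := by
      rintro rfl
      exact hM (by simpa using h)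
    have hpos : 0 < U.card := Finset.card_pos.2 (Finset.nonempty_iff_ne_empty.2 hne)
    have h3 := Finset.card_le_card hU
    set u := ∑ b ∈ U, b with hu
    -- Replacing `U` by its sum `u ∈ M` represents `x` again. If `u` is already present outside `U`,
    -- both copies cancel and the representation becomes shorter, a contradiction; otherwise
    -- minimality leaves only one element for `U`.
    by_cases huT : u ∈ T \ U
    · have h2 := hmin ((T \ U).erase u)
        ⟨(Finset.erase_subset _ _).trans (Finset.sdiff_subset.trans hTM), by
          have h4 := Finset.sum_erase_add (T \ U) (fun b : V → ZMod 2 => b) huT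
          rw [← hTx, ← h1, ← h4, add_assoc, hself, add_zero]⟩
      rw [Finset.card_erase_of_mem huT, Finset.card_sdiff_of_subset hU] at h2
      omega
    · have h2 := hmin (insert u (T \ U))
        ⟨Finset.insert_subset h (Finset.sdiff_subset.trans hTM), by
          rw [Finset.sum_insert huT, add_comm, h1, hTx]⟩
      rw [Finset.card_insert_of_notMem huT, Finset.card_sdiff_of_subset hU] at h2
      exact Finset.card_eq_one.1 (by omega)

/-- More than `r * k * L` variables force a rank above `k * L`, and then `(M.card + 1) ^ (k - 1) ≤ 2
^ (L * (k - 1)) < 2 ^ rank`. -/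
theorem exists_excess_ge_of_card {M : Finset (V → ZMod 2)} (hM : 0 ∉ M) (w : (V → ZMod 2) → ℤ)
    (ε : (V → ZMod 2) → ZMod 2) (hw : ∀ u ∈ M, 1 ≤ w u) {r k L : ℕ}
    (hr : ∀ u ∈ M, (Finset.univ.filter fun i => u i ≠ 0).card ≤ r)
    (hV : ∀ i, ∃ u ∈ M, u i ≠ 0) (hL : M.card < 2 ^ L)
    (hk : r * k * L < Fintype.card V) :
    ∃ z : V → ZMod 2, (k : ℤ) ≤ ∑ u ∈ M, w u * sgn (u ⬝ᵥ z + ε u) := by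
  refine exists_excess_ge_of_rank hM w ε hw ?_
  have h1 := card_le_mul_finrank_span hr hV
  set ρ := Module.finrank (ZMod 2) (Submodule.span (ZMod 2) (M : Set (V → ZMod 2)))
  have h2 : k * L < ρ := by
    by_contra hc
    have := Nat.mul_le_mul_left r (not_lt.1 hc)
    rw [← mul_assoc] at this
    omega
  calc (M.card + 1) ^ (k - 1) ≤ (2 ^ L) ^ (k - 1) := Nat.pow_le_pow_left hL _
    _ = 2 ^ (L * (k - 1)) := (pow_mul _ _ _).symm
    _ < 2 ^ ρ := Nat.pow_lt_pow_right (by norm_num)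
      ((Nat.mul_le_mul_left L (Nat.sub_le k 1)).trans_lt (by rwa [mul_comm]))

end

end LinExcess

/-! ### The algorithm -/

namespace MaxExactSat

open StackProg

abbrev Word := List Bool

/-- Reads a symbol (from the right): words are closed by commas, clauses stand in brackets. -/
def readStep : Γ' → List Word × List (List Word) → List Word × List (List Word)
  | .bit b, s => ((b :: s.1.headD []) :: s.1.tail, s.2)
  | .comma, s => ([] :: s.1, s.2)
  | .ket, s => ([], s.2)
  | .bra, s => ([], s.1 :: s.2)
  | .blank, s => s

/-- The sublists of a list of length at most `r`. -/
def subs {α : Type} : ℕ → List α → List (List α)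
  | 0, _ => [[]]
  | r + 1, l => match l with
    | [] => [[]]
    | a :: l => subs r l ++ (subs r l).map fun U => a :: U

/-- The lists obtained from a list of length at most `r` by giving a sign to every element. -/
def signings {α : Type} : ℕ → List α → List (List (α × Bool))
  | 0, _ => [[]]
  | r + 1, l => match l with
    | [] => [[]]
    | a :: l => (signings r l).map (fun c => (a, false) :: c) ++
        (signings r l).map fun c => (a, true) :: c

/-- A literal is stored as its sign followed by the name of its variable. -/
def rhsOf (U : List Word) : Bool := U.foldr (fun l b => Bool.xor b (!l.headD false)) true

def allVars (cs : List (List Word)) : List Word := (cs.flatMap fun C => C.map List.tail).dedup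

/-- Puts the variables into the order of `D`, so that equal sets of variables become equal lists and
can be merged by comparing lists. -/
def canon (D S : List Word) : List Word := D.filter fun v => decide (v ∈ S)

/-- The equations of weight one that belong to the clauses. -/
def terms (r : ℕ) (cs : List (List Word)) : List (List Word × Bool) :=
  cs.flatMap fun C => ((subs r C).filter fun U => !U.isEmpty).map fun U =>
    (canon (allVars cs) (U.map List.tail), rhsOf U)

abbrev Eqn := List Word × Bool × ℕ

/-- Equations with the same left-hand side and opposite right-hand sides cancel in pairs. What is
left is the absolute difference of the two counts, written with truncated subtraction, on the side
of the majority. -/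
def coeff (T : List (List Word × Bool)) (S : List Word) : Eqn :=
  (S, decide (T.count (S, false) < T.count (S, true)),
    (T.count (S, true) - T.count (S, false)) + (T.count (S, false) - T.count (S, true)))

/-- Combines equations with the same left-hand side. -/
def collect (T : List (List Word × Bool)) : List Eqn :=
  ((T.map Prod.fst).dedup.map fun S => coeff T S).filter fun e => !decide (e.2.2 = 0)

/-- Cancellation can remove variables altogether; the bound on the rank needs every variable to
occur. -/
def occurring (D : List Word) (M : List Eqn) : List Word :=
  D.filter fun v => M.any fun e => decide (v ∈ e.1)

/-- A system that surely has excess at least `k`. -/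
def easy (r : ℕ) (M : List Eqn) (D : List Word) (k : ℕ) : Bool :=
  (M.any fun e => decide (k ≤ e.2.2)) ||
    decide (r * k * (encodeNat M.length).length < D.length)

abbrev System := List Eqn × List Word × ℕ

/-- The empty system with parameter `0` is a fixed yes-instance. -/
def trim (r : ℕ) (R : System) : System := if easy r R.1 R.2.1 R.2.2 then ([], [], 0) else R

/-- The parameter is truncated just above the number of terms: larger values are out of reach anyway
(`collected_yes`), and the unary number stays short. -/
def reduce (r : ℕ) (s : List Word × List (List Word)) : System :=
  trim r (collect (terms r s.2), occurring (allVars s.2) (collect (terms r s.2)),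
    Nat.min (bitsVal (s.1.headD [])) ((terms r s.2).length + 1))

/-- The word that encodes a system over the variables `D`. -/
def linWord (R : System) : List Γ' :=
  encNat R.2.2 ++ (encNat R.2.1.length ++ R.1.flatMap fun e =>
    Γ'.bra :: Γ'.bit e.2.1 :: (encNat e.2.2 ++
      (e.1.flatMap (fun v => encNat (R.2.1.idxOf v)) ++ [Γ'.ket])))

/-- The variables of an equation, padded to `r` variables. -/
def padded (r : ℕ) (D : List Word) (S : List Word) : List ℕ :=
  S.map (fun v => D.idxOf v) ++
    -- New variables have numbers from `D.length` on, by which `keeps` recognises them. Filtering a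
    -- constant list makes the padding evidently polynomial-time.
    ((List.range r).filter fun j => decide (j < r - S.length)).map fun j => j + D.length

/-- Whether the assignment that falsifies the clause `c` falsifies the equation. -/
def keeps (n : ℕ) (b : Bool) (c : List (ℕ × Bool)) : Bool :=
  c.foldr (fun l b => Bool.xor b (decide (l.1 < n) && !l.2)) b

/-- The clauses that replace an equation. -/
def gadget (r : ℕ) (D : List Word) (e : Eqn) : List (List (ℕ × Bool)) :=
  (List.replicate e.2.2 ()).flatMap fun _ =>
    (signings r (padded r D e.1)).filter fun c => keeps D.length e.2.1 c

/-- The factor `2 ^ (r - 1)` in the parameter is the one by which the gadgets multiply the excess;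
the `r` additional variables serve all equations as padding. -/
def satWord (r : ℕ) (R : System) : List Γ' :=
  encNat (2 ^ (r - 1) * R.2.2) ++ (encNat (R.2.1.length + r) ++ R.1.flatMap fun e =>
    (gadget r R.2.1 e).flatMap fun c =>
      Γ'.bra :: (c.flatMap (fun l => Γ'.bit l.2 :: encNat l.1) ++ [Γ'.ket]))

def holds (A : List Word) (e : Eqn) : Bool :=
  e.1.foldr (fun v b => Bool.xor b (decide (v ∈ A))) (!e.2.1)

/-- Whether the assignment with the set `A` of true variables has excess at least `k`. -/
def reaches (M : List Eqn) (k : ℕ) (A : List Word) : Bool :=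
  decide (k + ((M.filter fun e => !holds A e).map fun e => e.2.2).sum ≤
    ((M.filter fun e => holds A e).map fun e => e.2.2).sum)

def sublistsOf (D : List Word) : List (List Word) :=
  D.foldr (fun v acc => acc ++ acc.map fun A => v :: A) [[]]

def solve (R : System) : Bool := (sublistsOf R.2.1).any fun A => reaches R.1 R.2.2 A

/-! ### Its running time -/

section
variable {γ α : Type} [Enc γ] [Enc α] {B : γ → ℕ}

theorem pt_readStep (a : Γ') : PT (readStep a) := by
  rcases a with _ | b | _ | _ | _
  · exact PT.id
  · exact (((PT.const b).cons (PT.left.headD [])).cons PT.left.tail).pair PT.right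
  · exact (PT.const _).pair (PT.left.cons PT.right)
  · exact (PT.const _).pair PT.right
  · exact ((PT.const _).cons PT.left).pair PT.right

theorem size_readStep_le (a : Γ') (s : List Word × List (List Word)) :
    size (readStep a s) ≤ size s + 7 := by
  obtain ⟨ws, cs⟩ := s
  have := size_pos ws
  rcases a with _ | b | _ | _ | _
  · simp [readStep]
  · have := size_bool b
    cases ws <;> simp [readStep] <;> omega
  · simp [readStep]; omega
  · simp [readStep]
    omega
  · simp [readStep]; omega

/-- Since `r` is a constant, induction on it yields a separate program for every `r`. -/
theorem _root_.StackProg.PTB.subs (r : ℕ) {l : γ → List α} (hl : PTB B l) : PTB B (fun c => subs r (l c)) := by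
  refine PTB.comp (g := MaxExactSat.subs r) ?_ hl
  clear hl l
  induction r with
  | zero => exact PT.const _
  | succ r ih =>
    refine (PTB.comp (PT.listCase (α := α) (γ := Unit) (f := fun _ => ([[]] : List (List α)))
      (g := fun p => MaxExactSat.subs r p.1.2 ++ (MaxExactSat.subs r p.1.2).map fun U => p.1.1 :: U)
      (PT.const _) ?_) (PT.id.pair (PT.const ()))).congr fun l => ?_
    · exact (ih.comp PT.left.snd).append
        ((ih.comp PT.left.snd).map (PT.left.fst.fst.cons PT.right))
    · cases l <;> rfl

theorem _root_.StackProg.PTB.signings (r : ℕ) {l : γ → List α} (hl : PTB B l) :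
    PTB B (fun c => signings r (l c)) := by
  refine PTB.comp (g := MaxExactSat.signings r) ?_ hl
  clear hl l
  induction r with
  | zero => exact PT.const _
  | succ r ih =>
    refine (PTB.comp (PT.listCase (α := α) (γ := Unit)
      (f := fun _ => ([[]] : List (List (α × Bool))))
      (g := fun p => (MaxExactSat.signings r p.1.2).map (fun c => (p.1.1, false) :: c) ++
        (MaxExactSat.signings r p.1.2).map fun c => (p.1.1, true) :: c)
      (PT.const _) ?_) (PT.id.pair (PT.const ()))).congr fun l => ?_
    · exact ((ih.comp PT.left.snd).map ((PT.left.fst.fst.pair (PT.const _)).cons PT.right)).append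
        ((ih.comp PT.left.snd).map ((PT.left.fst.fst.pair (PT.const _)).cons PT.right))
    · cases l <;> rfl

theorem _root_.StackProg.PTB.foldr_bool {l : γ → List α} {i : γ → Bool} {g : γ → α → Bool → Bool} (hl : PTB B l)
    (hi : PTB B i) (hg : PT (fun p : γ × Bool × α => g p.1 p.2.2 p.2.1)) :
    PTB B (fun c => (l c).foldr (g c) (i c)) :=
  PTB.foldr_of_growth hl hi hg (PolyBdd.const 3) fun _ _ _ _ =>
    (size_bool _).trans (Nat.le_add_left _ _)

theorem pt_rhsOf : PT rhsOf := by
  have h : PT fun p : List Word × Bool × Word => Bool.xor p.2.1 (!p.2.2.headD false) :=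
    PTB.xor PT.right.fst (PTB.not (PTB.headD PT.right.snd false))
  exact PTB.foldr_bool (l := fun U : List Word => U) (i := fun _ => true)
    (g := fun _ l b => Bool.xor b (!l.headD false)) PT.id (PT.const true) h

theorem ptEq_word : PTEq Word := PTEq.list PTEq.bool
theorem ptEq_words : PTEq (List Word) := PTEq.list ptEq_word
theorem ptEq_term : PTEq (List Word × Bool) := PTEq.prod ptEq_words PTEq.bool

theorem pt_allVars : PT allVars :=
  PTB.dedup ptEq_word (PT.id.flatMap (PT.right.map PT.right.tail))

theorem _root_.StackProg.PTB.canon {D S : γ → List Word} (hD : PTB B D) (hS : PTB B S) :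
    PTB B (fun c => canon (D c) (S c)) :=
  PTB.comp₂ (h := MaxExactSat.canon)
    (PT.left.filter (PTB.decide_mem ptEq_word PT.right PT.left.snd)) hD hS

theorem pt_terms (r : ℕ) : PT (terms r) :=
  PT.id.flatMap (((PTB.subs r PT.right).filter PT.right.isEmpty.not).map
    ((PTB.canon (pt_allVars.comp PT.left.fst) (PT.right.map PT.right.tail)).pair
      (pt_rhsOf.comp PT.right)))

theorem _root_.StackProg.PTB.coeff {T : γ → List (List Word × Bool)} {S : γ → List Word} (hT : PTB B T)
    (hS : PTB B S) : PTB B (fun c => coeff (T c) (S c)) := by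
  have h : ∀ b : Bool, PTB B fun c => (T c).count (S c, b) := fun b =>
    PTB.count ptEq_term (hS.pair (hS.const b)) hT
  exact hS.pair (((h false).decide_lt (h true)).pair
    (((h true).sub (h false)).add ((h false).sub (h true))))

theorem pt_collect : PT collect :=
  ((PTB.dedup ptEq_words (PT.id.map PT.right.fst)).map (PTB.coeff PT.left PT.right)).filter
    PT.right.snd.snd.decide_eq_zero.not

theorem pt_occurring : PT fun p : List Word × List Eqn => occurring p.1 p.2 :=
  PT.left.filter (PT.left.snd.any (PTB.decide_mem ptEq_word PT.left.snd PT.right.fst))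

theorem pt_easy (r : ℕ) : PT fun p : System => easy r p.1 p.2.1 p.2.2 :=
  (PT.left.any (PT.left.snd.snd.decide_le PT.right.snd.snd)).or
    ((((PT.const r).mul PT.right.snd).mul PT.left.length.encodeNat.length).decide_lt
      PT.right.fst.length)

theorem pt_trim (r : ℕ) : PT (trim r) :=
  PTB.ite ((pt_easy r).congr fun p => by simp) (PT.const _) PT.id

theorem pt_reduce (r : ℕ) : PT (reduce r) := by
  have hT : PT fun s : List Word × List (List Word) => terms r s.2 := (pt_terms r).comp PT.right
  have hM := pt_collect.comp hT
  exact (pt_trim r).comp (hM.pair ((pt_occurring.comp ((pt_allVars.comp PT.right).pair hM)).pair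
    (PTB.min_bitsVal (hT.length.add (PT.const 1)) (PT.left.headD []))))

theorem _root_.StackProg.PTB.bit {b : γ → Bool} (hb : PTB B b) : PTB B (fun c => Γ'.bit (b c)) :=
  (hb.cond (hb.const (Γ'.bit true)) (hb.const (Γ'.bit false))).congr fun c => by
    cases b c <;> rfl

theorem _root_.StackProg.PTB.encNat {f : γ → ℕ} (hf : PTB B f) : PTB B (fun c => encNat (f c)) :=
  (hf.encodeNat.map PT.right.bit).append (hf.const _)

theorem _root_.StackProg.PTB.idxOf {D : γ → List Word} {v : γ → Word} (hD : PTB B D) (hv : PTB B v) :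
    PTB B (fun c => (D c).idxOf (v c)) := by
  refine PTB.comp₂ (h := fun (D : List Word) v => D.idxOf v) ?_ hD hv
  refine (PTB.foldr_of_growth (l := fun p : List Word × Word => p.1) (i := fun _ => 0)
    (g := fun p a n => if a = p.2 then 0 else n + 1) PT.left (PT.const _)
    (PTB.ite (ptEq_word.decide_eq PT.right.snd PT.left.snd) (PT.const _)
      (PT.right.fst.add (PT.const 1))) (PolyBdd.const 2) ?_).congr fun p => ?_
  · intro c s a _
    simp only [size_nat]
    split_ifs <;> omega
  · induction p.1 with
    | nil => rfl
    | cons a l ih =>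
      rw [List.foldr_cons, ← ih, List.idxOf_cons]
      rcases eq_or_ne a p.2 with h | h
      · simp [h]
      · rw [if_neg h, beq_eq_false_iff_ne.2 h, cond_false]

theorem pt_linWord : PT linWord :=
  PT.right.snd.encNat.append (PT.right.fst.length.encNat.append
    (PT.left.flatMap ((PT.const _).cons (PT.right.snd.fst.bit.cons (PT.right.snd.snd.encNat.append
      ((PT.right.fst.flatMap
        (PTB.idxOf PT.left.fst.snd.fst PT.right).encNat).append (PT.const _)))))))

theorem pt_padded (r : ℕ) : PT fun p : List Word × List Word => padded r p.1 p.2 :=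
  (PT.right.map (PTB.idxOf PT.left.fst PT.right)).append
    (((PT.const (List.range r)).filter (PT.right.decide_lt
      ((PT.const r).sub PT.left.snd.length))).map (PT.right.add PT.left.fst.length))

theorem pt_keeps : PT fun p : ℕ × Bool × List (ℕ × Bool) => keeps p.1 p.2.1 p.2.2 := by
  have h : PT fun q : (ℕ × Bool × List (ℕ × Bool)) × Bool × (ℕ × Bool) =>
      Bool.xor q.2.1 (decide (q.2.2.1 < q.1.1) && !q.2.2.2) :=
    PTB.xor PT.right.fst
      (PTB.and (PTB.decide_lt PT.right.snd.fst PT.left.fst) (PTB.not PT.right.snd.snd))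
  exact PTB.foldr_bool (l := fun p : ℕ × Bool × List (ℕ × Bool) => p.2.2) (i := fun p => p.2.1)
    (g := fun p l b => Bool.xor b (decide (l.1 < p.1) && !l.2)) PT.right.snd PT.right.fst h

theorem pt_gadget (r : ℕ) : PT fun p : List Word × Eqn => gadget r p.1 p.2 := by
  have h : PT fun q : (List Word × Eqn) × List (ℕ × Bool) =>
      keeps q.1.1.length q.1.2.2.1 q.2 :=
    PTB.comp (f := fun q : (List Word × Eqn) × List (ℕ × Bool) =>
      (q.1.1.length, q.1.2.2.1, q.2)) pt_keeps
      (PT.left.fst.length.pair (PT.left.snd.snd.fst.pair PT.right))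
  have h' : PT fun p : List Word × Eqn => signings r (padded r p.1 p.2.1) :=
    PTB.signings r (PTB.comp (f := fun p : List Word × Eqn => (p.1, p.2.1)) (pt_padded r)
      (PT.left.pair PT.right.fst))
  have h'' : PT fun p : List Word × Eqn => (signings r (padded r p.1 p.2.1)).filter fun c =>
      keeps p.1.length p.2.2.1 c := PTB.filter h' h
  exact PTB.flatMap (l := fun p : List Word × Eqn => List.replicate p.2.2.2 ())
    (g := fun p _ => (signings r (padded r p.1 p.2.1)).filter fun c => keeps p.1.length p.2.2.1 c)
    PT.right.snd.snd.replicate_unit (PTB.comp h'' PT.left)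

theorem pt_satWord (r : ℕ) : PT (satWord r) :=
  ((PT.const _).mul PT.right.snd).encNat.append
    ((PT.right.fst.length.add (PT.const r)).encNat.append
      (PT.left.flatMap (((pt_gadget r).comp (PT.left.snd.fst.pair PT.right)).flatMap
        ((PT.const _).cons ((PT.right.flatMap
          (PT.right.snd.bit.cons PT.right.fst.encNat)).append (PT.const _))))))

theorem pt_holds : PT fun p : List Word × Eqn => holds p.1 p.2 := by
  have h : PT fun q : (List Word × Eqn) × Bool × Word =>
      Bool.xor q.2.1 (decide (q.2.2 ∈ q.1.1)) :=
    PTB.xor PT.right.fst (PTB.decide_mem ptEq_word PT.right.snd PT.left.fst)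
  exact PTB.foldr_bool (l := fun p : List Word × Eqn => p.2.1) (i := fun p => !p.2.2.1)
    (g := fun p v b => Bool.xor b (decide (v ∈ p.1))) PT.right.fst PT.right.snd.fst.not h

theorem pt_reaches : PT fun p : (List Eqn × ℕ) × List Word => reaches p.1.1 p.1.2 p.2 := by
  have h : PT fun q : ((List Eqn × ℕ) × List Word) × Eqn => holds q.1.2 q.2 :=
    PTB.comp (f := fun q : ((List Eqn × ℕ) × List Word) × Eqn => (q.1.2, q.2)) pt_holds
      (PT.left.snd.pair PT.right)
  have h0 : PT fun p : (List Eqn × ℕ) × List Word => p.1.1.filter fun e => !holds p.2 e :=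
    PTB.filter PT.left.fst (PTB.not h)
  have h1 : PT fun p : (List Eqn × ℕ) × List Word => p.1.1.filter fun e => holds p.2 e :=
    PTB.filter PT.left.fst h
  have h2 : PT fun q : ((List Eqn × ℕ) × List Word) × Eqn => q.2.2.2 := PT.right.snd.snd
  exact PTB.decide_le (PTB.add PT.left.snd (PTB.sum (PTB.map h0 h2))) (PTB.sum (PTB.map h1 h2))

end

theorem length_sublistsOf (D : List Word) : (sublistsOf D).length = 2 ^ D.length := by
  induction D with
  | nil => rfl
  | cons v D ih =>
    have : sublistsOf (v :: D) = sublistsOf D ++ (sublistsOf D).map fun A => v :: A := rfl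
    rw [this, List.length_append, List.length_map, ih, List.length_cons, pow_succ]
    omega

theorem size_le_of_forall {α : Type} [Enc α] (l : List α) {m : ℕ} (h : ∀ a ∈ l, size a ≤ m) :
    size l ≤ l.length * (m + 1) + 1 := by
  induction l with
  | nil => simp
  | cons a l ih =>
    have h1 := ih fun a ha => h a (List.mem_cons_of_mem _ ha)
    have h2 := h a (by simp)
    rw [size_cons, List.length_cons, Nat.add_mul, Nat.one_mul]
    omega

theorem size_sublistsOf_le (D : List Word) :
    size (sublistsOf D) ≤ 2 ^ D.length * (size D + 1) + 1 := by
  rw [← length_sublistsOf]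
  refine size_le_of_forall _ ?_
  induction D with
  | nil => simp [sublistsOf]
  | cons v D ih =>
    intro A hA
    have : sublistsOf (v :: D) = sublistsOf D ++ (sublistsOf D).map fun A => v :: A := rfl
    rw [this, List.mem_append, List.mem_map] at hA
    rw [size_cons]
    rcases hA with hA | ⟨A, hA, rfl⟩
    · have := ih A hA; omega
    · have := ih A hA
      rw [size_cons]; omega

/-- The search takes time polynomial in the size of the system and `2 ^ |D|`. -/
theorem ptb_solve : PTB (fun R : System => size R + 2 ^ R.2.1.length) solve := by
  set B : System → ℕ := fun R => size R + 2 ^ R.2.1.length with hBdef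
  have hB : PolyBdd B fun R => size R := PolyBdd.self.mono fun R => Nat.le_add_right _ _
  have hB' : PolyBdd B fun R => 2 ^ R.2.1.length := PolyBdd.self.mono fun R => Nat.le_add_left _ _
  have hD : PTB B fun R : System => R.2.1 := PTB.of_PT PT.right.fst hB
  have hbound : PolyBdd B fun R => 2 ^ R.2.1.length * (size R.2.1 + 1) + 1 :=
    (hB'.mul (hD.2.2.add (PolyBdd.const 1))).add (PolyBdd.const 1)
  have hsub : PTB B fun R : System => sublistsOf R.2.1 := by
    refine (PTB.foldl_of_bound (l := fun R : System => R.2.1.reverse) (i := fun _ => [[]])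
      (g := fun _ (acc : List (List Word)) v => acc ++ acc.map fun A => v :: A) hD.reverse
      (hD.const _) (PT.right.fst.append (PT.right.fst.map (PT.left.snd.snd.cons PT.right)))
      (M := fun R => 2 ^ R.2.1.length * (size R.2.1 + 1) + 1) hbound ?_).congr fun R => ?_
    · intro R l₁ l₂ h
      -- The intermediate states are the families of sublists of suffixes of the variable list, so
      -- the bound for the final family covers them.
      have e1 : l₁.foldl (fun (acc : List (List Word)) v => acc ++ acc.map fun A => v :: A) [[]]
          = sublistsOf l₁.reverse := by
        rw [sublistsOf, List.foldr_reverse]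
      rw [e1]
      refine (size_sublistsOf_le _).trans ?_
      have e2 : R.2.1 = l₂.reverse ++ l₁.reverse := by
        rw [← List.reverse_append, ← h, List.reverse_reverse]
      have h1 : l₁.reverse.length ≤ R.2.1.length := by rw [e2]; simp
      have h2 : size l₁.reverse ≤ size R.2.1 := by
        rw [e2]
        have := size_append l₂.reverse l₁.reverse
        have := size_pos l₂.reverse
        omega
      exact Nat.add_le_add_right (Nat.mul_le_mul (Nat.pow_le_pow_right (by norm_num) h1)
        (by omega)) 1
    · rw [List.foldl_reverse]; rfl
  have hMk : PTB B fun R : System => (R.1, R.2.2) := PTB.of_PT (PT.left.pair PT.right.snd) hB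
  have hany : PT fun p : (List Eqn × ℕ) × List (List Word) =>
      p.2.any fun A => reaches p.1.1 p.1.2 A := by
    have h : PT fun q : ((List Eqn × ℕ) × List (List Word)) × List Word =>
        reaches q.1.1.1 q.1.1.2 q.2 :=
      PTB.comp (f := fun q : ((List Eqn × ℕ) × List (List Word)) × List Word => (q.1.1, q.2))
        pt_reaches (PT.left.fst.pair PT.right)
    exact PTB.any PT.right h
  have hpair : PTB B fun R : System => ((R.1, R.2.2), sublistsOf R.2.1) := hMk.pair hsub
  exact PTB.comp (f := fun R : System => ((R.1, R.2.2), sublistsOf R.2.1))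
    (g := fun p => p.2.any fun A => reaches p.1.1 p.1.2 A) hany hpair

end MaxExactSat

/-! ### The value of a system -/

namespace MaxExactSat

open StackProg LinExcess

theorem sum_map_flatMap {α β : Type} (l : List α) (g : α → List β) (f : β → ℤ) :
    ((l.flatMap g).map f).sum = (l.map fun a => ((g a).map f).sum).sum := by
  induction l with
  | nil => rfl
  | cons a l ih => simp [ih]

theorem sum_map_filter {α : Type} (l : List α) (p : α → Bool) (f : α → ℤ)
    (h : ∀ a ∈ l, p a = false → f a = 0) : ((l.filter p).map f).sum = (l.map f).sum := by
  induction l with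
  | nil => rfl
  | cons a l ih =>
    have ih := ih fun b hb => h b (List.mem_cons_of_mem _ hb)
    cases hp : p a
    · simp [hp, ih, h a (by simp) hp]
    · simp [hp, ih]

def toZ (b : Bool) : ZMod 2 := if b then 1 else 0

theorem toZ_xor (b b' : Bool) : toZ (Bool.xor b b') = toZ b + toZ b' := by
  revert b b'; decide

theorem toZ_decide (a : ZMod 2) : toZ (decide (a = 1)) = a := by revert a; decide

theorem sgn_toZ_add (b b' : Bool) : sgn (toZ b + toZ b') = if b = b' then 1 else -1 := by
  revert b b'; decide

section
variable {α : Type}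

def lhs (z : α → ZMod 2) (S : List α) : ZMod 2 := (S.map z).sum

theorem lhs_perm (z : α → ZMod 2) {S S' : List α} (h : S.Perm S') : lhs z S = lhs z S' :=
  (h.map z).sum_eq

theorem sgn_lhs (z : α → ZMod 2) (S : List α) : sgn (lhs z S) = (S.map fun v => sgn (z v)).prod := by
  induction S with
  | nil => rfl
  | cons v S ih => simp only [lhs, List.map_cons, List.sum_cons, List.prod_cons, sgn_add] at ih ⊢; rw [ih]

end

def termSum (z : Word → ZMod 2) (T : List (List Word × Bool)) : ℤ :=
  (T.map fun t => sgn (lhs z t.1 + toZ t.2)).sum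

def excess (z : Word → ZMod 2) (M : List Eqn) : ℤ :=
  (M.map fun e => (e.2.2 : ℤ) * sgn (lhs z e.1 + toZ e.2.1)).sum

def System.Yes (R : System) : Prop := ∃ z, (R.2.2 : ℤ) ≤ excess z R.1

theorem excess_congr {z z' : Word → ZMod 2} {M : List Eqn}
    (h : ∀ e ∈ M, ∀ v ∈ e.1, z v = z' v) : excess z M = excess z' M := by
  unfold excess
  refine congrArg List.sum (List.map_congr_left fun e he => ?_)
  rw [lhs, List.map_congr_left (h e he), ← lhs]

theorem termSum_le (z : Word → ZMod 2) (T : List (List Word × Bool)) : termSum z T ≤ T.length := by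
  have := List.sum_le_card_nsmul (T.map fun t => sgn (lhs z t.1 + toZ t.2)) 1 (by
    intro x hx
    obtain ⟨t, -, rfl⟩ := List.mem_map.1 hx
    exact (by decide : ∀ a : ZMod 2, sgn a ≤ 1) _)
  simpa [termSum] using this

/-- Both sides are grouped by left-hand sides. The two possible right-hand sides have opposite
signs, so only the difference of their counts matters, and equations of weight zero may be dropped.
-/
theorem excess_collect (z : Word → ZMod 2) (T : List (List Word × Bool)) :
    excess z (collect T) = termSum z T := by
  classical
  have h1 : excess z (collect T) = ∑ S ∈ (T.map Prod.fst).toFinset,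
      ((coeff T S).2.2 : ℤ) * sgn (lhs z S + toZ (coeff T S).2.1) := by
    unfold excess collect
    rw [sum_map_filter]
    · rw [List.map_map, ← List.sum_toFinset _ (List.nodup_dedup _), show (T.map Prod.fst).dedup.toFinset = (T.map Prod.fst).toFinset by
        ext; simp]
      rfl
    · intro e _ he
      simp only [Bool.not_eq_false', decide_eq_true_eq] at he
      simp [he]
  have h2 : termSum z T = ∑ t ∈ (T.map Prod.fst).toFinset ×ˢ (Finset.univ : Finset Bool),
      T.count t • sgn (lhs z t.1 + toZ t.2) := by
    unfold termSum
    rw [Finset.sum_list_map_count, lawful_beq_subsingleton instBEqOfDecidableEq instBEqProd]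
    refine Finset.sum_subset (fun t ht => ?_) fun t _ ht => ?_
    · rw [Finset.mem_product]
      exact ⟨List.mem_toFinset.2 (List.mem_map_of_mem (List.mem_toFinset.1 ht)),
        Finset.mem_univ _⟩
    · rw [List.mem_toFinset] at ht
      rw [List.count_eq_zero_of_not_mem ht, zero_smul]
  rw [h1, h2, Finset.sum_product]
  refine Finset.sum_congr rfl fun S _ => ?_
  have hs : sgn (lhs z S + toZ false) = -sgn (lhs z S + toZ true) := by
    simp [toZ, sgn_add_one]
  rw [Fintype.sum_bool, hs]
  simp only [coeff]
  by_cases h : T.count (S, false) < T.count (S, true)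
  · rw [decide_eq_true h, Nat.sub_eq_zero_of_le h.le, add_zero, Nat.cast_sub h.le]
    simp only [nsmul_eq_mul]; ring
  · rw [decide_eq_false h, Nat.sub_eq_zero_of_le (not_lt.1 h), zero_add,
      Nat.cast_sub (not_lt.1 h), hs]
    simp only [nsmul_eq_mul]; ring

/-! ### The terms of a clause -/

section
variable {α : Type}

theorem sum_map_subs (r : ℕ) (C : List α) (g : List α → ℤ) :
    ((subs r C).map g).sum = g [] + (((subs r C).filter fun U => !U.isEmpty).map g).sum := by
  induction r generalizing C g with
  | zero => simp [subs]
  | succ r ih =>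
    cases C with
    | nil => simp [subs]
    | cons a C =>
      have h : ((subs r C).map fun U => a :: U).filter (fun U => !U.isEmpty)
          = (subs r C).map fun U => a :: U := by
        rw [List.filter_eq_self]
        intro U hU
        obtain ⟨U, -, rfl⟩ := List.mem_map.1 hU
        rfl
      simp only [subs, List.map_append, List.filter_append, List.sum_append]
      rw [h, ih C g, add_assoc]

theorem sum_prod_subs (C : List α) (f : α → ℤ) :
    ((subs C.length C).map fun U => (U.map f).prod).sum = (C.map fun a => 1 + f a).prod := by
  induction C with
  | nil => simp [subs]
  | cons a C ih =>
    have : ((fun U : List α => (U.map f).prod) ∘ fun U => a :: U)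
        = fun U => f a * (U.map f).prod := by
      funext U; simp
    simp only [List.length_cons, subs, List.map_append, List.map_map, List.sum_append,
      List.map_cons, List.prod_cons]
    rw [this, List.sum_map_mul_left, ih]
    ring

theorem sublist_of_mem_subs {r : ℕ} {C U : List α} (h : U ∈ subs r C) :
    U.Sublist C ∧ U.length ≤ r := by
  induction r generalizing C U with
  | zero => simp [subs] at h; simp [h]
  | succ r ih =>
    cases C with
    | nil => simp [subs] at h; simp [h]
    | cons a C =>
      rw [subs, List.mem_append, List.mem_map] at h
      rcases h with h | ⟨U, h, rfl⟩
      · exact ⟨(ih h).1.cons a, (ih h).2.trans (Nat.le_succ r)⟩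
      · exact ⟨(ih h).1.cons_cons a, by simpa using (ih h).2⟩

end

/-- `1` for a true literal, `-1` for a false one. -/
def litSign (z : Word → ZMod 2) (l : Word) : ℤ := sgn (z l.tail + toZ (l.headD false))

/-- Every literal contributes a factor `-litSign`, hence the negated sign bit in `rhsOf`; its
initial value `true` accounts for the minus sign in front. -/
theorem sgn_term (z : Word → ZMod 2) (U : List Word) :
    sgn (lhs z (U.map List.tail) + toZ (rhsOf U)) = -(U.map fun l => -litSign z l).prod := by
  induction U with
  | nil => rfl
  | cons l U ih =>
    have h1 : lhs z ((l :: U).map List.tail) = z l.tail + lhs z (U.map List.tail) := by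
      simp [lhs]
    have h2 : rhsOf (l :: U) = Bool.xor (rhsOf U) (!l.headD false) := rfl
    have h3 : ∀ b : Bool, toZ (!b) = toZ b + 1 := by decide
    rw [h1, h2, toZ_xor, h3, List.map_cons, List.prod_cons, litSign, sgn_add (z l.tail)]
    rw [show z l.tail + lhs z (U.map List.tail) + (toZ (rhsOf U) + (toZ (l.headD false) + 1))
      = z l.tail + (lhs z (U.map List.tail) + toZ (rhsOf U)) + toZ (l.headD false) + 1 by ring]
    rw [sgn_add_one, sgn_add, sgn_add, ih]
    ring

theorem nodup_allVars (cs : List (List Word)) : (allVars cs).Nodup := List.nodup_dedup _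

theorem tail_mem_allVars {cs : List (List Word)} {C : List Word} (hC : C ∈ cs) {l : Word}
    (hl : l ∈ C) : l.tail ∈ allVars cs :=
  List.mem_dedup.2 (List.mem_flatMap.2 ⟨C, hC, List.mem_map_of_mem hl⟩)

theorem canon_perm {D S : List Word} (hD : D.Nodup) (hS : S.Nodup) (h : S ⊆ D) :
    (canon D S).Perm S :=
  (List.perm_ext_iff_of_nodup (hD.filter _) hS).2 fun v => by
    simp only [List.mem_filter, decide_eq_true_eq]
    exact ⟨fun hv => hv.2, fun hv => ⟨h hv, hv⟩⟩

/-- The expansion `1 - ∏ (1 - s_l) = -∑ ∏ (-s_l)` over the nonempty sublists of a clause; the empty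
sublist cancels the `1`. -/
theorem termSum_terms {r : ℕ} {cs : List (List Word)} (hlen : ∀ C ∈ cs, C.length = r)
    (hnd : ∀ C ∈ cs, (C.map List.tail).Nodup) (z : Word → ZMod 2) :
    termSum z (terms r cs) = (cs.map fun C => 1 - (C.map fun l => 1 - litSign z l).prod).sum := by
  unfold termSum terms
  rw [sum_map_flatMap]
  refine congrArg List.sum (List.map_congr_left fun C hC => ?_)
  have h1 : (((subs r C).filter fun U => !U.isEmpty).map fun U =>
      (canon (allVars cs) (U.map List.tail), rhsOf U)).map
        (fun t => sgn (lhs z t.1 + toZ t.2))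
      = ((subs r C).filter fun U => !U.isEmpty).map fun U =>
        -(U.map fun l => -litSign z l).prod := by
    rw [List.map_map]
    refine List.map_congr_left fun U hU => ?_
    have hU := (sublist_of_mem_subs (List.mem_filter.1 hU).1).1
    rw [← sgn_term]
    simp only [Function.comp]
    rw [lhs_perm z (canon_perm (nodup_allVars cs) ((hU.map List.tail).nodup (hnd C hC)) ?_)]
    intro v hv
    obtain ⟨l, hl, rfl⟩ := List.mem_map.1 hv
    exact tail_mem_allVars hC (hU.subset hl)
  have h2 := sum_map_subs r C fun U => -(U.map fun l => -litSign z l).prod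
  have h3 := sum_prod_subs C fun l => -litSign z l
  rw [hlen C hC] at h3
  have h4 : ((subs r C).map fun U => -(U.map fun l => -litSign z l).prod).sum
      = -((subs r C).map fun U => (U.map fun l => -litSign z l).prod).sum := by
    rw [← neg_one_mul, ← List.sum_map_mul_left]
    simp
  rw [h4, h3] at h2
  simp only [List.map_nil, List.prod_nil] at h2
  simp only [← sub_eq_add_neg] at h2
  rw [h1]
  linarith

/-! ### Reading a formula -/

theorem foldr_readStep_bits (l : List Bool) (ws : List Word) (cs : List (List Word)) :
    (l.map Γ'.bit).foldr readStep ([] :: ws, cs) = (l :: ws, cs) := by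
  induction l with
  | nil => rfl
  | cons b l ih => rw [List.map_cons, List.foldr_cons, ih]; rfl

theorem foldr_readStep_encNat (a : ℕ) (ws : List Word) (cs : List (List Word)) :
    (encNat a).foldr readStep (ws, cs) = (encodeNat a :: ws, cs) := by
  rw [encNat, List.foldr_append]
  exact foldr_readStep_bits _ _ _

def litWord {n : ℕ} (l : Literal n) : Word := l.2 :: encodeNat l.1

theorem foldr_readStep_encLit {n : ℕ} (l : Literal n) (ws : List Word) (cs : List (List Word)) :
    (encLit l).foldr readStep (ws, cs) = (litWord l :: ws, cs) := by
  rw [encLit, List.foldr_cons, foldr_readStep_encNat]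
  rfl

def clauseWords {r n : ℕ} (C : Clause r n) : List Word := C.lits.map litWord

theorem foldr_readStep_encClause {r n : ℕ} (C : Clause r n) (ws : List Word)
    (cs : List (List Word)) :
    (encClause C).foldr readStep (ws, cs) = ([], clauseWords C :: cs) := by
  have h : ∀ L : List (Literal n), (L.flatMap encLit).foldr readStep ([], cs)
      = (L.map litWord, cs) := by
    intro L
    induction L with
    | nil => rfl
    | cons l L ih =>
      rw [List.flatMap_cons, List.foldr_append, ih, foldr_readStep_encLit]
      rfl
  rw [encClause, List.foldr_cons, List.foldr_append]
  change readStep Γ'.bra ((C.lits.flatMap encLit).foldr readStep ([], cs)) = _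
  rw [h]
  rfl

/-- The result of reading the pair `(F, k)`. -/
def parsed {r : ℕ} (p : Formula r × ℕ) : List Word × List (List Word) :=
  ([encodeNat p.2, encodeNat p.1.n], p.1.clauses.map clauseWords)

theorem foldr_readStep_encPair {r : ℕ} (p : Formula r × ℕ) :
    ((maxExactSatAA r).encPair p).foldr readStep ([], []) = parsed p := by
  have h : (p.1.clauses.flatMap encClause).foldr readStep ([], [])
      = ([], p.1.clauses.map clauseWords) := by
    induction p.1.clauses with
    | nil => rfl
    | cons C cs ih =>
      rw [List.flatMap_cons, List.foldr_append, ih, foldr_readStep_encClause]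
      rfl
  change (encNat p.2 ++ (encNat p.1.n ++ p.1.clauses.flatMap encClause)).foldr _ _ = _
  rw [List.foldr_append, List.foldr_append, h, foldr_readStep_encNat, foldr_readStep_encNat]
  rfl

/-! ### Formulas as systems -/

/-- The excess of a clause: `1` if it is satisfied and `1 - 2 ^ r` otherwise. -/
def clauseExcess {r n : ℕ} (a : Fin n → Bool) (C : Clause r n) : ℤ :=
  1 - (C.lits.map fun l => if a l.1 = l.2 then 0 else 2).prod

theorem clauseExcess_eq {r n : ℕ} (a : Fin n → Bool) (C : Clause r n) :
    clauseExcess a C = if C.Sat a then 1 else 1 - 2 ^ r := by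
  unfold clauseExcess
  split_ifs with h
  · obtain ⟨l, hl, h⟩ := h
    rw [List.prod_eq_zero (List.mem_map.2 ⟨l, hl, by simp [h]⟩), sub_zero]
  · have : ∀ l ∈ C.lits, (if a l.1 = l.2 then (0 : ℤ) else 2) = 2 := fun l hl =>
      if_neg fun h' => h ⟨l, hl, h'⟩
    rw [List.map_congr_left this, List.map_const', List.prod_replicate, C.length_eq]

/-- Multiply by `2 ^ r`: a falsified clause costs `2 ^ r` compared with a satisfied one. -/
theorem Formula.yes_iff {r : ℕ} (F : Formula r) (k : ℕ) :
    F.Yes k ↔ ∃ a : Fin F.n → Bool, (k : ℤ) ≤ (F.clauses.map (clauseExcess a)).sum := by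
  refine exists_congr fun a => ?_
  have h : (F.clauses.map (clauseExcess a)).sum = F.m - 2 ^ r * (F.m - F.numSat a) := by
    unfold Formula.m Formula.numSat
    induction F.clauses with
    | nil => simp
    | cons C cs ih =>
      rw [List.map_cons, List.sum_cons, ih, clauseExcess_eq, List.countP_cons, List.length_cons]
      by_cases hC : C.Sat a
      · simp [hC]
        ring
      · simp [hC]
        ring
  rw [h]
  have h2 : (0 : ℝ) < 2 ^ r := by positivity
  have h3 : (1 - 1 / 2 ^ r : ℝ) * F.m + k * (1 / 2 ^ r) ≤ F.numSat a ↔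
      (2 ^ r : ℝ) * ((1 - 1 / 2 ^ r : ℝ) * F.m + k * (1 / 2 ^ r)) ≤ 2 ^ r * F.numSat a :=
    (mul_le_mul_iff_right₀ h2).symm
  have h4 : (2 ^ r : ℝ) * ((1 - 1 / 2 ^ r : ℝ) * F.m + k * (1 / 2 ^ r))
      = 2 ^ r * F.m - F.m + k := by
    field_simp
  rw [h3, h4, ← Int.cast_le (R := ℝ)]
  push_cast
  constructor <;> intro h <;> linarith

theorem litSign_litWord {n : ℕ} (a : Fin n → Bool) (z : Word → ZMod 2)
    (hz : ∀ i : Fin n, z (encodeNat i) = toZ (a i)) (l : Literal n) :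
    1 - litSign z (litWord l) = if a l.1 = l.2 then 0 else 2 := by
  have : litSign z (litWord l) = sgn (toZ (a l.1) + toZ l.2) := by
    rw [← hz]
    rfl
  rw [this, sgn_toZ_add]
  split_ifs <;> rfl

theorem map_tail_clauseWords {r n : ℕ} (C : Clause r n) :
    (clauseWords C).map List.tail = (C.lits.map Prod.fst).map fun i : Fin n => encodeNat i := by
  simp [clauseWords, litWord, Function.comp_def]

theorem termSum_parsed {r : ℕ} (F : Formula r) (k : ℕ) (a : Fin F.n → Bool) (z : Word → ZMod 2)
    (hz : ∀ i : Fin F.n, z (encodeNat i) = toZ (a i)) :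
    termSum z (terms r (parsed (F, k)).2) = (F.clauses.map (clauseExcess a)).sum := by
  rw [termSum_terms]
  · simp only [parsed, List.map_map]
    refine congrArg List.sum (List.map_congr_left fun C _ => ?_)
    simp only [Function.comp, clauseWords, clauseExcess, List.map_map]
    refine congrArg (fun l : List ℤ => 1 - l.prod) (List.map_congr_left fun l _ => ?_)
    exact litSign_litWord a z hz l
  · intro C hC
    obtain ⟨C, -, rfl⟩ := List.mem_map.1 hC
    rw [clauseWords, List.length_map, C.length_eq]
  · intro C hC
    obtain ⟨C, -, rfl⟩ := List.mem_map.1 hC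
    rw [map_tail_clauseWords]
    exact C.nodup.map fun i j h => Fin.ext (encodeNat_injective h)

theorem Formula.yes_iff_termSum {r : ℕ} (F : Formula r) (k : ℕ) :
    F.Yes k ↔ ∃ z, (k : ℤ) ≤ termSum z (terms r (parsed (F, k)).2) := by
  rw [F.yes_iff]
  constructor
  · rintro ⟨a, ha⟩
    -- Variables are named by binary words; words that name no variable get the irrelevant value
    -- `0`.
    refine ⟨fun w => if h : bitsVal w < F.n then toZ (a ⟨bitsVal w, h⟩) else 0, ?_⟩
    rwa [termSum_parsed F k a]
    intro i
    simp [bitsVal_encodeNat]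
  · rintro ⟨z, hz⟩
    refine ⟨fun i => decide (z (encodeNat i) = 1), ?_⟩
    rwa [← termSum_parsed F k _ z]
    intro i
    rw [toZ_decide]

/-- The system before trimming. -/
def collected {r : ℕ} (p : Formula r × ℕ) : System :=
  (collect (terms r (parsed p).2), occurring (allVars (parsed p).2)
    (collect (terms r (parsed p).2)), Nat.min p.2 ((terms r (parsed p).2).length + 1))

theorem reduce_parsed {r : ℕ} (p : Formula r × ℕ) : reduce r (parsed p) = trim r (collected p) := by
  have : bitsVal ((parsed p).1.headD []) = p.2 := bitsVal_encodeNat _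
  rw [reduce, this]
  rfl

/-- Truncating the parameter is harmless, since no assignment has an excess above the number of
terms. -/
theorem collected_yes {r : ℕ} (p : Formula r × ℕ) : (collected p).Yes ↔ p.1.Yes p.2 := by
  rw [Formula.yes_iff_termSum]
  refine exists_congr fun z => ?_
  have := termSum_le z (terms r (parsed p).2)
  simp only [collected, excess_collect, Prod.mk.eta]
  change ((min p.2 ((terms r (parsed p).2).length + 1) : ℕ) : ℤ) ≤ _ ↔ _
  omega

end MaxExactSat

/-! ### Properties of the reduced system -/

namespace MaxExactSat

open StackProg LinExcess

/-- The equations of the system are well formed and different, and its variables are those that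
occur. -/
structure Sound (r : ℕ) (R : System) : Prop where
  nodup_vars : R.2.1.Nodup
  nodup_eqns : R.1.Nodup
  nodup : ∀ e ∈ R.1, e.1.Nodup
  ne_nil : ∀ e ∈ R.1, e.1 ≠ []
  length_le : ∀ e ∈ R.1, e.1.length ≤ r
  subset : ∀ e ∈ R.1, e.1 ⊆ R.2.1
  occurs : ∀ v ∈ R.2.1, ∃ e ∈ R.1, v ∈ e.1
  pos : ∀ e ∈ R.1, 0 < e.2.2
  ext : ∀ e ∈ R.1, ∀ e' ∈ R.1, (∀ v, v ∈ e.1 ↔ v ∈ e'.1) → e = e'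

theorem sound_empty (r : ℕ) : Sound r ([], [], 0) := by
  constructor <;> simp

theorem mem_terms {r : ℕ} {cs : List (List Word)} (hnd : ∀ C ∈ cs, (C.map List.tail).Nodup)
    {t : List Word × Bool} (ht : t ∈ terms r cs) :
    ∃ S : List Word, S.Nodup ∧ S ≠ [] ∧ S.length ≤ r ∧ S ⊆ allVars cs ∧
      t.1 = canon (allVars cs) S := by
  simp only [terms, List.mem_flatMap, List.mem_map, List.mem_filter] at ht
  obtain ⟨C, hC, U, ⟨hU, hne⟩, rfl⟩ := ht
  obtain ⟨hU, hlen⟩ := sublist_of_mem_subs hU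
  refine ⟨U.map List.tail, (hU.map _).nodup (hnd C hC), ?_, by simpa using hlen, ?_, rfl⟩
  · rintro h
    rw [List.map_eq_nil_iff] at h
    simp [h] at hne
  · intro v hv
    obtain ⟨l, hl, rfl⟩ := List.mem_map.1 hv
    exact tail_mem_allVars hC (hU.subset hl)

theorem mem_collect {T : List (List Word × Bool)} {e : Eqn} (he : e ∈ collect T) :
    e = coeff T e.1 ∧ 0 < e.2.2 ∧ ∃ t ∈ T, t.1 = e.1 := by
  simp only [collect, List.mem_filter, List.mem_map, List.mem_dedup] at he
  obtain ⟨⟨S, ⟨t, ht, rfl⟩, rfl⟩, h⟩ := he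
  refine ⟨rfl, ?_, t, ht, rfl⟩
  simpa [Nat.pos_iff_ne_zero] using h

theorem nodup_collect (T : List (List Word × Bool)) : (collect T).Nodup :=
  (List.Nodup.map (fun _ _ h => congrArg Prod.fst h) (List.nodup_dedup _)).filter _

theorem sound_of_nodup {r : ℕ} {cs : List (List Word)}
    (hnd : ∀ C ∈ cs, (C.map List.tail).Nodup) (k : ℕ) :
    Sound r (collect (terms r cs), occurring (allVars cs) (collect (terms r cs)), k) := by
  have key : ∀ e ∈ collect (terms r cs), ∃ S : List Word, S.Nodup ∧ S ≠ [] ∧ S.length ≤ r ∧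
      S ⊆ allVars cs ∧ e.1 = canon (allVars cs) S ∧ e.1.Perm S := fun e he => by
    obtain ⟨-, -, t, ht, h⟩ := mem_collect he
    obtain ⟨S, h1, h2, h3, h4, h5⟩ := mem_terms hnd ht
    rw [h] at h5
    exact ⟨S, h1, h2, h3, h4, h5, h5 ▸ canon_perm (nodup_allVars cs) h1 h4⟩
  constructor
  · exact (nodup_allVars cs).filter _
  · exact nodup_collect _
  · intro e he
    obtain ⟨S, h1, -, -, -, -, h⟩ := key e he
    exact h.nodup_iff.2 h1
  · intro e he
    obtain ⟨S, -, h2, -, -, -, h⟩ := key e he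
    rintro h'
    rw [h'] at h
    exact h2 h.nil_eq.symm
  · intro e he
    obtain ⟨S, -, -, h3, -, -, h⟩ := key e he
    exact h.length_eq.trans_le h3
  · intro e he v hv
    obtain ⟨S, -, -, -, h4, -, h⟩ := key e he
    rw [occurring, List.mem_filter]
    exact ⟨h4 (h.subset hv), List.any_eq_true.2 ⟨e, he, by simpa using hv⟩⟩
  · intro v hv
    rw [occurring, List.mem_filter, List.any_eq_true] at hv
    obtain ⟨-, e, he, h⟩ := hv
    exact ⟨e, he, by simpa using h⟩
  · exact fun e he => (mem_collect he).2.1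
  · intro e he e' he' h
    obtain ⟨S, -, -, -, -, h5, h6⟩ := key e he
    obtain ⟨S', -, -, -, -, h5', h6'⟩ := key e' he'
    have : e.1 = e'.1 := by
      rw [h5, h5']
      refine List.filter_congr fun v _ => ?_
      rw [decide_eq_decide, ← h6.mem_iff, ← h6'.mem_iff, h]
    rw [(mem_collect he).1, (mem_collect he').1, this]

theorem sound_collected {r : ℕ} (p : Formula r × ℕ) : Sound r (collected p) := by
  refine sound_of_nodup ?_ _
  intro C hC
  obtain ⟨C, -, rfl⟩ := List.mem_map.1 hC
  rw [map_tail_clauseWords]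
  exact C.nodup.map fun i j h => Fin.ext (encodeNat_injective h)

/-! ### Large systems are yes-instances -/

section
variable {r : ℕ} {R : System}

/-- The left-hand side as a vector. -/
def vec (D : List Word) (e : Eqn) : {v // v ∈ D} → ZMod 2 := fun v => if v.1 ∈ e.1 then 1 else 0

theorem vec_injOn (hR : Sound r R) : Set.InjOn (vec R.2.1) {e | e ∈ R.1} := by
  intro e he e' he' h
  refine hR.ext e he e' he' fun v => ?_
  have key : ∀ e ∈ R.1, ∀ e' ∈ R.1, vec R.2.1 e = vec R.2.1 e' → v ∈ e.1 → v ∈ e'.1 := by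
    intro e he e' _ h hv
    have := congrFun h ⟨v, hR.subset e he hv⟩
    by_contra hc
    simp [vec, hv, hc] at this
  exact ⟨key e he e' he' h, key e' he' e he h.symm⟩

/-- Extension of an assignment by zero. -/
def extend (D : List Word) (z : {v // v ∈ D} → ZMod 2) (w : Word) : ZMod 2 :=
  if h : w ∈ D then z ⟨w, h⟩ else 0

theorem vec_dotProduct (hR : Sound r R) {e : Eqn} (he : e ∈ R.1) (z : {v // v ∈ R.2.1} → ZMod 2) :
    vec R.2.1 e ⬝ᵥ z = lhs (extend R.2.1 z) e.1 := by
  classical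
  rw [lhs, ← List.sum_toFinset _ (hR.nodup e he), dotProduct]
  have h1 : ∀ v : {v // v ∈ R.2.1}, vec R.2.1 e v * z v
      = if v.1 ∈ e.1.toFinset then extend R.2.1 z v.1 else 0 := by
    intro v
    by_cases h : v.1 ∈ e.1 <;> simp [vec, h, extend, v.2]
  rw [Finset.sum_congr rfl fun v _ => h1 v, ← Finset.sum_filter]
  refine Finset.sum_bij (fun v _ => v.1) ?_ ?_ ?_ ?_
  · intro v hv; simpa using hv
  · intro v _ v' _ h; exact Subtype.ext h
  · intro v hv
    exact ⟨⟨v, hR.subset e he (List.mem_toFinset.1 hv)⟩, by simpa using hv, rfl⟩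
  · intro v _; rfl

/-- The system is rewritten over vectors indexed by its variables, with `f`, an inverse of `vec`,
recovering weight and right-hand side. The two alternatives of `easy` are then the two lower bounds
on the excess. -/
theorem yes_of_easy (hR : Sound r R) (h : easy r R.1 R.2.1 R.2.2 = true) : R.Yes := by
  classical
  set f := Function.invFunOn (vec R.2.1) {e | e ∈ R.1} with hf
  have hinv : ∀ e ∈ R.1, f (vec R.2.1 e) = e := fun e he =>
    (vec_injOn hR).leftInvOn_invFunOn he
  set M := R.1.toFinset.image (vec R.2.1) with hM
  have hmem : ∀ u ∈ M, ∃ e ∈ R.1, vec R.2.1 e = u := fun u hu => by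
    obtain ⟨e, he, h⟩ := Finset.mem_image.1 hu
    exact ⟨e, List.mem_toFinset.1 he, h⟩
  have hM0 : (0 : {v // v ∈ R.2.1} → ZMod 2) ∉ M := by
    intro h0
    obtain ⟨e, he, h⟩ := hmem _ h0
    obtain ⟨v, hv⟩ := List.exists_mem_of_ne_nil _ (hR.ne_nil e he)
    have := congrFun h ⟨v, hR.subset e he hv⟩
    simp [vec, hv] at this
  let w : ({v // v ∈ R.2.1} → ZMod 2) → ℤ := fun u => ((f u).2.2 : ℤ)
  let ε : ({v // v ∈ R.2.1} → ZMod 2) → ZMod 2 := fun u => toZ (f u).2.1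
  have hsum : ∀ z, ∑ u ∈ M, w u * sgn (u ⬝ᵥ z + ε u) = excess (extend R.2.1 z) R.1 := by
    intro z
    rw [hM, Finset.sum_image fun e he e' he' h => vec_injOn hR (by simpa using he)
      (by simpa using he') h, excess, ← List.sum_toFinset _ hR.nodup_eqns]
    refine Finset.sum_congr rfl fun e he => ?_
    have he := List.mem_toFinset.1 he
    simp only [w, ε, hinv e he, vec_dotProduct hR he]
  have hfin : ∀ z, (R.2.2 : ℤ) ≤ ∑ u ∈ M, w u * sgn (u ⬝ᵥ z + ε u) → R.Yes := fun z hz =>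
    ⟨_, hz.trans_eq (hsum z)⟩
  rw [easy, Bool.or_eq_true, List.any_eq_true] at h
  rcases h with ⟨e, he, h⟩ | h
  · obtain ⟨z, hz⟩ := exists_excess_ge_weight hM0 w ε (b := vec R.2.1 e)
      (Finset.mem_image_of_mem _ (List.mem_toFinset.2 he))
    refine hfin z (le_trans ?_ hz)
    simp only [w, hinv e he]
    exact_mod_cast of_decide_eq_true h
  · suffices h' : ∃ z, (R.2.2 : ℤ) ≤ ∑ u ∈ M, w u * sgn (u ⬝ᵥ z + ε u) from
      h'.elim fun z hz => hfin z hz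
    refine exists_excess_ge_of_card hM0 w ε (r := r) (L := (encodeNat R.1.length).length)
      ?_ ?_ ?_ ?_ ?_
    · intro u hu
      obtain ⟨e, he, rfl⟩ := hmem u hu
      simp only [w, hinv e he]
      exact_mod_cast hR.pos e he
    · intro u hu
      obtain ⟨e, he, rfl⟩ := hmem u hu
      refine le_trans ?_ (hR.length_le e he)
      rw [← List.toFinset_card_of_nodup (hR.nodup e he)]
      refine Finset.card_le_card_of_injOn (fun v => v.1) ?_ fun v _ v' _ h => Subtype.ext h
      intro v hv
      by_contra hc
      have : v.1 ∉ e.1 := by simpa using hc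
      simp [vec, this] at hv
    · rintro ⟨v, hv⟩
      obtain ⟨e, he, h⟩ := hR.occurs v hv
      exact ⟨_, Finset.mem_image_of_mem _ (List.mem_toFinset.2 he), by simp [vec, h]⟩
    · exact (Finset.card_image_le.trans (List.toFinset_card_le _)).trans_lt
        (lt_two_pow_encodeNat_length _)
    · rw [Fintype.card_of_subtype R.2.1.toFinset (by simp),
        List.toFinset_card_of_nodup hR.nodup_vars]
      exact of_decide_eq_true h

theorem sound_trim (hR : Sound r R) : Sound r (trim r R) := by
  unfold trim
  split_ifs
  · exact sound_empty r
  · exact hR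

theorem trim_yes (hR : Sound r R) : (trim r R).Yes ↔ R.Yes := by
  unfold trim
  split_ifs with h
  · exact iff_of_true ⟨0, by simp [excess]⟩ (yes_of_easy hR h)
  · rfl

/-! ### The size of the reduced system -/

/-- Distinct equations have distinct left-hand sides, and a list of at most `r` variables is
determined by `r` entries, each a variable or missing. -/
theorem length_eqns_le (hR : Sound r R) : R.1.length ≤ (R.2.1.length + 1) ^ r := by
  classical
  rw [← List.toFinset_card_of_nodup hR.nodup_eqns]
  have h : R.1.toFinset.card ≤
      (Fintype.piFinset fun _ : Fin r => Finset.insertNone R.2.1.toFinset).card := by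
    refine Finset.card_le_card_of_injOn (fun e i => e.1[i.1]?) ?_ ?_
    · intro e he
      have he := List.mem_toFinset.1 he
      rw [Finset.mem_coe, Fintype.mem_piFinset]
      intro i
      rw [Finset.mem_insertNone]
      intro v hv
      exact List.mem_toFinset.2 (hR.subset e he (List.mem_of_getElem? hv))
    · intro e he e' he' h
      have he := List.mem_toFinset.1 he
      have he' := List.mem_toFinset.1 he'
      have h1 : e.1 = e'.1 := List.ext_getElem? fun i => by
        rcases lt_or_ge i r with hi | hi
        · exact congrFun h ⟨i, hi⟩
        · rw [List.getElem?_eq_none ((hR.length_le e he).trans hi),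
            List.getElem?_eq_none ((hR.length_le e' he').trans hi)]
      exact hR.ext e he e' he' fun v => by rw [h1]
  refine h.trans_eq ?_
  rw [Fintype.card_piFinset, Finset.prod_const, Finset.card_insertNone,
    List.toFinset_card_of_nodup hR.nodup_vars, Finset.card_univ, Fintype.card_fin]

/-- What trimming achieves. -/
theorem trim_spec (r : ℕ) (R : System) : (trim r R).2.2 ≤ R.2.2 ∧
    (∀ e ∈ (trim r R).1, e.2.2 ≤ (trim r R).2.2) ∧
    (trim r R).2.1.length ≤
      r * (trim r R).2.2 * (encodeNat (trim r R).1.length).length := by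
  unfold trim
  split_ifs with h
  · simp
  · rw [Bool.not_eq_true, easy, Bool.or_eq_false_iff, List.any_eq_false] at h
    refine ⟨le_rfl, fun e he => ?_, ?_⟩
    · have := h.1 e he
      simp at this
      exact this.le
    · exact not_lt.1 (of_decide_eq_false h.2)

/-- The bound on the number of variables. -/
def varBound (r k : ℕ) : ℕ :=
  r * k * (3 + 4 * r + (2 * r).factorial + 2 * r * (Nat.log 2 (r * k + 1) + 1))

/-- `(L + 1) ^ d ≤ (L + 1) ⋯ (L + d) = d! * choose (L + d) d`. It lets `2 ^ L` absorb a power of `L`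
in `le_varBound`. -/
theorem pow_le_factorial_mul (L d : ℕ) : (L + 1) ^ d ≤ d.factorial * 2 ^ (L + d) := by
  refine (Nat.pow_succ_le_ascFactorial (L + 1) d).trans ?_
  rw [Nat.ascFactorial_eq_factorial_mul_choose]
  exact Nat.mul_le_mul_left _ (Nat.choose_le_two_pow _ _)

/-- The hypotheses bound `n` by the length `L` of `M` and `M` by `n`, so `2 ^ L` is at most a
constant times a power of `k * (L + 1)`. This makes `L` logarithmic in `k`, and `n ≤ r * k * L`
follows suit. -/
theorem le_varBound {r k n M : ℕ} (hM : M ≤ (n + 1) ^ r)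
    (hn : n ≤ r * k * (encodeNat M).length) : n ≤ varBound r k := by
  refine hn.trans (Nat.mul_le_mul_left _ ?_)
  rcases Nat.eq_zero_or_pos M with rfl | hpos
  · simp [encodeNat_zero]
  set L := (encodeNat M).length with hL
  set s := Nat.log 2 (r * k + 1) + 1 with hs
  have h1 : 2 ^ L ≤ 2 * M := two_pow_encodeNat_length_le hpos.ne'
  have h2 : r * k + 1 ≤ 2 ^ s := (Nat.lt_pow_succ_log_self (by norm_num) _).le
  have h3 : n + 1 ≤ 2 ^ s * (L + 1) := by
    calc n + 1 ≤ (r * k + 1) * (L + 1) := by nlinarith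
      _ ≤ _ := Nat.mul_le_mul_right _ h2
  have h4 : 2 ^ L ≤ 2 * (2 ^ s * (L + 1)) ^ r :=
    h1.trans (Nat.mul_le_mul_left _ (hM.trans (Nat.pow_le_pow_left h3 r)))
  -- After squaring, the factor `(L + 1) ^ (2 * r)` uses up only one of the two factors `2 ^ L`; the
  -- other one bounds `L`.
  have h5 : 2 ^ L * 2 ^ L ≤ 2 ^ L * 2 ^ (2 + 2 * r * s + 2 * r + (2 * r).factorial) := by
    calc 2 ^ L * 2 ^ L ≤ (2 * (2 ^ s * (L + 1)) ^ r) * (2 * (2 ^ s * (L + 1)) ^ r) :=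
          Nat.mul_le_mul h4 h4
      _ = 2 ^ (2 + 2 * r * s) * (L + 1) ^ (2 * r) := by
          rw [mul_pow, ← pow_mul, pow_add, show 2 * r * s = s * r + s * r by ring, pow_add,
            show 2 * r = r + r by ring, pow_add (L + 1)]
          ring
      _ ≤ 2 ^ (2 + 2 * r * s) * ((2 * r).factorial * 2 ^ (L + 2 * r)) :=
          Nat.mul_le_mul_left _ (pow_le_factorial_mul L (2 * r))
      _ ≤ 2 ^ (2 + 2 * r * s) * (2 ^ (2 * r).factorial * 2 ^ (L + 2 * r)) :=
          Nat.mul_le_mul_left _ (Nat.mul_le_mul_right _ Nat.lt_two_pow_self.le)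
      _ = _ := by simp only [pow_add]; ring
  have h6 := Nat.le_of_mul_le_mul_left h5 (by positivity)
  have h7 := (Nat.pow_le_pow_iff_right (by norm_num : 1 < 2)).1 h6
  omega

theorem isBigO_of_le {h : ℕ → ℕ} {A C : ℝ} (hA : 0 ≤ A) (hC : 0 ≤ C)
    (hh : ∀ k : ℕ, (h k : ℝ) ≤ (C * k + A) * (1 + Real.log (k + 1))) : IsBigOKLogK h := by
  refine IsBigO.of_bound (4 * (C + A)) ?_
  -- From `3 > e` on, `log k ≥ 1` absorbs the additive constants.
  filter_upwards [eventually_ge_atTop 3] with k hk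
  have hk' : (3 : ℝ) ≤ k := by exact_mod_cast hk
  have h1 : 1 ≤ Real.log k := by
    rw [Real.le_log_iff_exp_le (by linarith)]
    exact (Real.exp_one_lt_d9.le.trans (by norm_num)).trans hk'
  have h2 : Real.log (k + 1) ≤ 2 * Real.log k := by
    rw [← Real.log_rpow (by linarith)]
    refine Real.log_le_log (by linarith) ?_
    norm_num
    nlinarith
  rw [Real.norm_of_nonneg (by positivity), Real.norm_of_nonneg (by positivity)]
  calc (h k : ℝ) ≤ (C * k + A) * (1 + Real.log (k + 1)) := hh k
    _ ≤ ((C + A) * k) * (4 * Real.log k) := by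
      have : C * k + A ≤ (C + A) * k := by nlinarith
      exact mul_le_mul this (by linarith)
        (by have := Real.log_nonneg (show (1 : ℝ) ≤ k + 1 by linarith); linarith) (by positivity)
    _ = _ := by ring

/-- The linear and constant terms make room for the padding variables of the kernel and for the
exponent of the running time. -/
theorem isBigO_varBound (r c d e : ℕ) : IsBigOKLogK fun k => c * varBound r k + d * k + e := by
  set K : ℝ := 3 + 4 * r + (2 * r).factorial with hK
  have hK0 : 0 ≤ K := by positivity
  refine isBigO_of_le (A := e) (C := c * (r * (K + 2 * r + 4 * r ^ 2 + 4 * r)) + d)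
    (by positivity) (by positivity) fun k => ?_
  set ℓ := Real.log (k + 1) with hℓ
  have hk : (0 : ℝ) ≤ k := Nat.cast_nonneg k
  have hr : (0 : ℝ) ≤ r := Nat.cast_nonneg r
  have hc : (0 : ℝ) ≤ c := Nat.cast_nonneg c
  have hd : (0 : ℝ) ≤ d := Nat.cast_nonneg d
  have he : (0 : ℝ) ≤ e := Nat.cast_nonneg e
  have hℓ0 : 0 ≤ ℓ := Real.log_nonneg (by linarith)
  -- From `r * k + 1 ≤ (r + 1) * (k + 1)`, `log (r + 1) ≤ r` and `log 2 ≥ 1 / 2`.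
  have h1 : (Nat.log 2 (r * k + 1) : ℝ) ≤ 2 * (r + ℓ) := by
    refine (Real.natLog_le_logb _ _).trans ?_
    have h2 : Real.log ((r * k + 1 : ℕ) : ℝ) ≤ r + ℓ := by
      have h3 : Real.log ((r * k + 1 : ℕ) : ℝ) ≤ Real.log ((r + 1) * (k + 1)) := by
        refine Real.log_le_log (by positivity) ?_
        push_cast
        nlinarith
      have h4 : Real.log (r + 1) ≤ r := by
        have := Real.log_le_sub_one_of_pos (show (0 : ℝ) < r + 1 by linarith)
        linarith
      rw [Real.log_mul (by linarith) (by linarith)] at h3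
      linarith
    have h5 : (1 : ℝ) / 2 ≤ Real.log 2 := by have := Real.log_two_gt_d9; linarith
    rw [Real.logb, Nat.cast_two, div_le_iff₀ (by linarith)]
    nlinarith
  have h6 : (varBound r k : ℝ) ≤ r * k * ((K + 2 * r + 4 * r ^ 2 + 4 * r) * (1 + ℓ)) := by
    unfold varBound
    push_cast
    refine mul_le_mul_of_nonneg_left ?_ (by positivity)
    rw [← hK]
    have h7 : 2 * (r : ℝ) * (Nat.log 2 (r * k + 1) + 1) ≤ 2 * r * (2 * (r + ℓ) + 1) :=
      mul_le_mul_of_nonneg_left (by linarith) (by positivity)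
    have h8 : 0 ≤ (K + 2 * r + 4 * r ^ 2) * ℓ := by positivity
    nlinarith
  push_cast
  have h7 := mul_le_mul_of_nonneg_left h6 hc
  have h8 : 0 ≤ d * k * ℓ := by positivity
  have h9 : 0 ≤ e * ℓ := by positivity
  linarith

end

end MaxExactSat

/-! ### The bikernel -/

namespace MaxExactSat

open StackProg LinExcess

section
variable {r : ℕ}

theorem sound_reduce (p : Formula r × ℕ) : Sound r (reduce r (parsed p)) := by
  rw [reduce_parsed]
  exact sound_trim (sound_collected p)

theorem reduce_yes (p : Formula r × ℕ) : (reduce r (parsed p)).Yes ↔ p.1.Yes p.2 := by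
  rw [reduce_parsed, trim_yes (sound_collected p), collected_yes]

theorem reduce_param_le (p : Formula r × ℕ) : (reduce r (parsed p)).2.2 ≤ p.2 := by
  rw [reduce_parsed]
  exact (trim_spec r _).1.trans (Nat.min_le_left _ _)

theorem reduce_weight_le (p : Formula r × ℕ) :
    ∀ e ∈ (reduce r (parsed p)).1, e.2.2 ≤ p.2 := by
  intro e he
  refine le_trans ?_ (reduce_param_le p)
  rw [reduce_parsed] at he ⊢
  exact (trim_spec r _).2.1 e he

theorem reduce_vars_le (p : Formula r × ℕ) :
    (reduce r (parsed p)).2.1.length ≤ varBound r p.2 := by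
  refine le_varBound (length_eqns_le (sound_reduce p)) ?_
  have h := reduce_param_le p
  have h' : (reduce r (parsed p)).2.1.length ≤ r * (reduce r (parsed p)).2.2 *
      (encodeNat (reduce r (parsed p)).1.length).length := by
    rw [reduce_parsed]
    exact (trim_spec r _).2.2
  exact h'.trans (Nat.mul_le_mul_right _ (Nat.mul_le_mul_left _ h))

theorem reduce_eqns_le (p : Formula r × ℕ) :
    (reduce r (parsed p)).1.length ≤ (varBound r p.2 + 1) ^ r :=
  (length_eqns_le (sound_reduce p)).trans
    (Nat.pow_le_pow_left (Nat.succ_le_succ (reduce_vars_le p)) r)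

theorem length_flatMap_le {α β : Type} (l : List α) (f : α → List β) {m : ℕ}
    (h : ∀ a ∈ l, (f a).length ≤ m) : (l.flatMap f).length ≤ l.length * m := by
  induction l with
  | nil => simp
  | cons a l ih =>
    have h1 := h a (by simp)
    have h2 := ih fun b hb => h b (List.mem_cons_of_mem _ hb)
    rw [List.flatMap_cons, List.length_append, List.length_cons, Nat.add_mul, Nat.one_mul]
    omega

theorem length_encNat_le (a : ℕ) : (encNat a).length ≤ a + 1 := by
  have := encodeNat_length_le a
  simpa [encNat] using this

/-- A map between instances that is computed by a polynomial-time function on words. -/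
theorem polyTime_of_PT {L' : ParamProblem} {φ : Formula r × ℕ → L'.Inst × ℕ}
    {f : System → List Γ'} (hf : PT f) (h : ∀ p, f (reduce r (parsed p)) = L'.encPair (φ p)) :
    Nonempty (TM2ComputableInPolyTime (maxExactSatAA r).encPair L'.encPair φ) := by
  obtain ⟨M, c, hM⟩ := exists_machine_word pt_readStep size_readStep_le ([], [])
    (PTB.comp hf (pt_reduce r))
  refine ⟨⟨M, (Polynomial.X + 2) ^ c, fun p => ?_⟩⟩
  have h1 := hM ((maxExactSatAA r).encPair p)
  have h3 : ((maxExactSatAA r).encPair p).foldr readStep ([], []) = parsed p :=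
    foldr_readStep_encPair p
  rw [h3, show f (reduce r (parsed p)) = _ from h p] at h1
  have h2 : Polynomial.eval ((maxExactSatAA r).encPair p).length
      ((Polynomial.X + 2 : Polynomial ℕ) ^ c) = (((maxExactSatAA r).encPair p).length + 2) ^ c := by
    simp
  rw [h2]
  exact h1.some

/-! ### The instance of Max `r`-Lin AA given by a reduced system. -/

section Lin
variable {R : System}

/-- A variable is named by its position in `R.2.1`, the numbering that `linWord` writes. -/
def toEquation (hR : Sound r R) (e : {e // e ∈ R.1}) : Equation r R.2.1.length where
  vars := e.1.1.pmap (fun v h => ⟨R.2.1.idxOf v, List.idxOf_lt_length_iff.2 h⟩)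
    fun v hv => hR.subset e.1 e.2 hv
  rhs := e.1.2.1
  weight := e.1.2.2
  nodup := (hR.nodup e.1 e.2).pmap fun v hv v' hv' h =>
    (List.idxOf_inj hv).1 (congrArg Fin.val h)
  length_le := by simpa using hR.length_le e.1 e.2
  weight_pos := hR.pos e.1 e.2

def toLin (hR : Sound r R) : LinSystem r := ⟨R.2.1.length, R.1.attach.map (toEquation hR)⟩

theorem sum_map_attach {α : Type} (l : List α) (f : α → ℤ) :
    (l.attach.map fun a => f a.1).sum = (l.map f).sum := by
  rw [List.attach_map_val]

theorem flatMap_attach {α β : Type} (l : List α) (f : α → List β) :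
    (l.attach.flatMap fun a => f a.1) = l.flatMap f := by
  rw [List.flatMap_def, List.attach_map_val, List.flatMap_def]

theorem lhs_toEquation (hR : Sound r R) (e : {e // e ∈ R.1}) {z : Word → ZMod 2}
    {z' : Fin R.2.1.length → ZMod 2}
    (h : ∀ v (hv : v ∈ R.2.1), z' ⟨R.2.1.idxOf v, List.idxOf_lt_length_iff.2 hv⟩ = z v) :
    ((toEquation hR e).vars.map z').sum = lhs z e.1.1 := by
  rw [toEquation, List.map_pmap, lhs]
  refine congrArg List.sum ?_
  rw [← List.pmap_eq_map fun v hv => hR.subset e.1 e.2 hv]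
  exact List.pmap_congr_left _ fun v _ hv _ => h v hv

theorem excess_toLin (hR : Sound r R) {z : Word → ZMod 2} {z' : Fin R.2.1.length → ZMod 2}
    (h : ∀ v (hv : v ∈ R.2.1), z' ⟨R.2.1.idxOf v, List.idxOf_lt_length_iff.2 hv⟩ = z v) :
    (toLin hR).excess z' = excess z R.1 := by
  change ((R.1.attach.map (toEquation hR)).map fun e => if e.Sat z' then (e.weight : ℤ)
    else -(e.weight : ℤ)).sum = _
  rw [excess, List.map_map, ← sum_map_attach R.1]
  refine congrArg List.sum (List.map_congr_left fun e _ => ?_)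
  have hs : (toEquation hR e).Sat z' ↔ lhs z e.1.1 = toZ e.1.2.1 := by
    rw [Equation.Sat, lhs_toEquation hR e h]
    rfl
  have hsgn : ∀ a b : ZMod 2, sgn (a + b) = if a = b then 1 else -1 := by decide
  rw [hsgn]
  change (if (toEquation hR e).Sat z' then (e.1.2.2 : ℤ) else -(e.1.2.2 : ℤ)) = _
  by_cases hc : lhs z e.1.1 = toZ e.1.2.1
  · rw [if_pos (hs.2 hc), if_pos hc, mul_one]
  · rw [if_neg fun h' => hc (hs.1 h'), if_neg hc, mul_neg_one]

theorem toLin_yes (hR : Sound r R) : (toLin hR).Yes R.2.2 ↔ R.Yes := by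
  constructor
  · rintro ⟨z', hz⟩
    refine ⟨fun v => if h : R.2.1.idxOf v < R.2.1.length then z' ⟨_, h⟩ else 0,
      hz.trans_eq (excess_toLin hR fun v hv => ?_)⟩
    rw [dif_pos (List.idxOf_lt_length_iff.2 hv)]
    rfl
  · rintro ⟨z, hz⟩
    refine ⟨fun i : Fin R.2.1.length => z R.2.1[i],
      hz.trans_eq (excess_toLin hR fun v hv => ?_).symm⟩
    simp

theorem encPair_toLin (hR : Sound r R) :
    (maxLinAA r).encPair (toLin hR, R.2.2) = linWord R := by
  change encNat R.2.2 ++ (encNat R.2.1.length ++ (R.1.attach.map (toEquation hR)).flatMap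
    encEquation) = _
  rw [linWord, List.flatMap_map]
  refine congrArg (fun l => encNat R.2.2 ++ (encNat R.2.1.length ++ l)) ?_
  rw [← flatMap_attach R.1]
  refine List.flatMap_congr fun e _ => ?_
  simp only [encEquation, toEquation]
  refine congrArg (fun l => Γ'.bra :: Γ'.bit e.1.2.1 :: (encNat e.1.2.2 ++ (l ++ [Γ'.ket]))) ?_
  rw [List.flatMap_def, List.flatMap_def, List.map_pmap]
  exact congrArg List.flatten (List.pmap_eq_map (f := fun v => encNat (R.2.1.idxOf v)) _)

end Lin

theorem hasBikernel_maxLinAA (r : ℕ) : HasBikernelKLogK (maxExactSatAA r) (maxLinAA r) := by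
  refine ⟨fun p => (toLin (sound_reduce p), (reduce r (parsed p)).2.2),
    ⟨polyTime_of_PT pt_linWord fun p => (encPair_toLin (sound_reduce p)).symm, fun p => ?_,
      ⟨fun k => k, fun p => reduce_param_le p⟩,
      -- An equation takes two brackets, a bit, at most `k + 1` symbols for its weight and at most
      -- `varBound r k + 1` for each variable.
      ⟨fun k => varBound r k + 1 + (varBound r k + 1) ^ r * (k + 4 + r * (varBound r k + 1)),
        fun p => ?_⟩⟩,
    fun k => 1 * varBound r k + 0 * k + 0, isBigO_varBound r 1 0 0, fun p => ?_⟩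
  · exact (reduce_yes p).symm.trans (toLin_yes (sound_reduce p)).symm
  · change (encNat (reduce r (parsed p)).2.1.length ++
      ((reduce r (parsed p)).1.attach.map (toEquation (sound_reduce p))).flatMap
        encEquation).length ≤ _
    rw [List.length_append]
    refine Nat.add_le_add ((length_encNat_le _).trans (Nat.succ_le_succ (reduce_vars_le p))) ?_
    refine (length_flatMap_le _ _ (m := p.2 + 4 + r * (varBound r p.2 + 1)) ?_).trans ?_
    · intro e he
      obtain ⟨e, -, rfl⟩ := List.mem_map.1 he
      have h1 := length_encNat_le e.1.2.2
      have h2 := reduce_weight_le p e.1 e.2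
      have h3 := length_flatMap_le (toEquation (sound_reduce p) e).vars
        (fun i : Fin _ => encNat i) (m := varBound r p.2 + 1) fun i _ =>
          (length_encNat_le _).trans (i.2.le.trans (reduce_vars_le p) |> Nat.succ_le_succ)
      have h4 := Nat.mul_le_mul_right (varBound r p.2 + 1)
        (toEquation (sound_reduce p) e).length_le
      simp only [encEquation, List.length_cons, List.length_append, List.length_nil]
      have h5 : (toEquation (sound_reduce p) e).weight = e.1.2.2 := rfl
      rw [h5]
      omega
    · rw [List.length_map, List.length_attach]
      exact Nat.mul_le_mul_right _ (reduce_eqns_le p)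
  · have : (reduce r (parsed p)).2.1.length ≤ 1 * varBound r p.2 + 0 * p.2 + 0 := by
      simpa using reduce_vars_le p
    exact this

end

end MaxExactSat

/-! ### The kernel -/

namespace MaxExactSat

open StackProg LinExcess

section
variable {α : Type}

theorem sum_prod_signings (P : List α) (f : α × Bool → ℤ) :
    ((signings P.length P).map fun c => (c.map f).prod).sum
      = (P.map fun i => f (i, false) + f (i, true)).prod := by
  induction P with
  | nil => simp [signings]
  | cons i P ih =>
    have h : ∀ s : Bool, ((fun c : List (α × Bool) => (c.map f).prod) ∘ fun c => (i, s) :: c)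
        = fun c => f (i, s) * (c.map f).prod := fun s => by
      funext c; simp
    simp only [List.length_cons, signings, List.map_append, List.map_map, List.sum_append,
      List.map_cons, List.prod_cons]
    rw [h, h, List.sum_map_mul_left, List.sum_map_mul_left, ih]
    ring

theorem length_signings_le (r : ℕ) (P : List α) : (signings r P).length ≤ 2 ^ r := by
  induction r generalizing P with
  | zero => simp [signings]
  | succ r ih =>
    cases P with
    | nil => simpa [signings] using Nat.one_le_two_pow
    | cons i P =>
      have := ih P
      simp only [signings, List.length_append, List.length_map, pow_succ]
      omega

theorem map_fst_of_mem_signings {P : List α} {c : List (α × Bool)}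
    (hc : c ∈ signings P.length P) : c.map Prod.fst = P := by
  induction P generalizing c with
  | nil => simp [signings] at hc; simp [hc]
  | cons i P ih =>
    simp only [List.length_cons, signings, List.mem_append, List.mem_map] at hc
    rcases hc with ⟨c, hc, rfl⟩ | ⟨c, hc, rfl⟩ <;> simp [ih hc]

/-- The indicator of `p` is `(1 - sgn) / 2`; doubling avoids the division. -/
theorem two_mul_sum_map_filter (l : List α) (p : α → Bool) (f : α → ℤ) :
    2 * ((l.filter p).map f).sum = (l.map fun a => (1 - sgn (toZ (p a))) * f a).sum := by
  induction l with
  | nil => rfl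
  | cons a l ih =>
    rw [List.map_cons, List.sum_cons, ← ih]
    cases hp : p a
    · simp [hp, toZ]
    · have : sgn (toZ true) = -1 := by decide
      rw [List.filter_cons_of_pos hp, List.map_cons, List.sum_cons, this]
      ring

end

theorem sgn_keeps (n : ℕ) (b : Bool) (c : List (ℕ × Bool)) : sgn (toZ (keeps n b c))
    = sgn (toZ b) * (c.map fun l => if l.1 < n ∧ l.2 = false then (-1 : ℤ) else 1).prod := by
  induction c with
  | nil => simp [keeps]
  | cons l c ih =>
    have h : keeps n b (l :: c) = Bool.xor (keeps n b c) (decide (l.1 < n) && !l.2) := rfl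
    have h' : sgn (toZ (decide (l.1 < n) && !l.2))
        = if l.1 < n ∧ l.2 = false then (-1 : ℤ) else 1 := by
      obtain ⟨i, s⟩ := l
      by_cases hi : i < n <;> cases s <;> simp [hi, toZ]
      rfl
    rw [h, toZ_xor, sgn_add, ih, h', List.map_cons, List.prod_cons]
    ring

/-- The excess of the clauses that replace an equation. -/
theorem two_mul_sum_keeps (a : ℕ → Bool) (n : ℕ) (b : Bool) (P : List ℕ) (hP : ∃ i ∈ P, i < n) :
    2 * (((signings P.length P).filter fun c => keeps n b c).map fun c =>
      1 - (c.map fun l => if a l.1 = l.2 then (0 : ℤ) else 2).prod).sum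
    = 2 ^ P.length * (sgn (toZ b) *
      (P.map fun i => if i < n ∧ a i = true then (-1 : ℤ) else 1).prod) := by
  rw [two_mul_sum_map_filter]
  set t : ℕ × Bool → ℤ := fun l => if a l.1 = l.2 then 0 else 2 with ht
  set q : ℕ × Bool → ℤ := fun l => if l.1 < n ∧ l.2 = false then -1 else 1 with hq
  -- The product is expanded into four terms that factor over the literals, so each sums to a
  -- product over `P`. The first two cancel, the third vanishes at a variable below `n`, and the
  -- fourth is the claimed value.
  have h1 : ((signings P.length P).map fun c => (1 - sgn (toZ (keeps n b c))) *
      (1 - (c.map t).prod)) = (signings P.length P).map fun c =>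
        ((c.map fun _ => (1 : ℤ)).prod + (-1) * (c.map t).prod) +
          ((-sgn (toZ b)) * (c.map q).prod + sgn (toZ b) * (c.map fun l => q l * t l).prod) := by
    refine List.map_congr_left fun c _ => ?_
    rw [sgn_keeps, List.prod_map_mul]
    simp only [List.map_const', List.prod_replicate, one_pow]
    ring
  rw [h1, List.sum_map_add, List.sum_map_add, List.sum_map_add, List.sum_map_mul_left,
    List.sum_map_mul_left, List.sum_map_mul_left, sum_prod_signings, sum_prod_signings,
    sum_prod_signings, sum_prod_signings]
  have h2 : (P.map fun i => t (i, false) + t (i, true)) = P.map fun i => (1 : ℤ) + 1 :=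
    List.map_congr_left fun i _ => by cases h : a i <;> simp [ht, h]
  have h3 : (P.map fun i => q (i, false) + q (i, true)).prod = 0 := by
    obtain ⟨i, hi, hin⟩ := hP
    exact List.prod_eq_zero (List.mem_map.2 ⟨i, hi, by simp [hq, hin]⟩)
  have h4 : (P.map fun i => q (i, false) * t (i, false) + q (i, true) * t (i, true))
      = P.map fun i => 2 * if i < n ∧ a i = true then (-1 : ℤ) else 1 :=
    List.map_congr_left fun i _ => by
      cases h : a i <;> by_cases hi : i < n <;> simp [ht, hq, h, hi]
  have h5 : (P.map fun _ => (2 : ℤ)).prod = 2 ^ P.length := by simp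
  rw [h2, h3, h4, List.prod_map_mul, h5]
  ring

/-! ### Padding an equation to exactly `r` variables. -/

section
variable {r : ℕ} {D S : List Word}

theorem filter_range_lt {t r : ℕ} (h : t ≤ r) :
    ((List.range r).filter fun j => decide (j < t)).Perm (List.range t) :=
  (List.perm_ext_iff_of_nodup (List.nodup_range.filter _) List.nodup_range).2 fun j => by
    simp only [List.mem_filter, List.mem_range, decide_eq_true_eq]
    omega

theorem length_padded (hS : S.length ≤ r) : (padded r D S).length = r := by
  rw [padded, List.length_append, List.length_map, List.length_map,
    (filter_range_lt (Nat.sub_le r _)).length_eq, List.length_range]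
  omega

theorem lt_of_mem_padded (hSD : S ⊆ D) {i : ℕ} (hi : i ∈ padded r D S) : i < D.length + r := by
  simp only [padded, List.mem_append, List.mem_map, List.mem_filter, List.mem_range] at hi
  rcases hi with ⟨v, hv, rfl⟩ | ⟨j, ⟨hj, -⟩, rfl⟩
  · exact (List.idxOf_lt_length_iff.2 (hSD hv)).trans_le (Nat.le_add_right _ _)
  · omega

theorem nodup_padded (hS : S.Nodup) (hSD : S ⊆ D) : (padded r D S).Nodup := by
  refine List.Nodup.append ?_ ?_ ?_
  · exact List.Nodup.map_on (fun v hv v' _ h => (List.idxOf_inj (hSD hv)).1 h) hS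
  · exact (List.nodup_range.filter _).map fun i j h => Nat.add_right_cancel h
  · intro i hi hi'
    obtain ⟨v, hv, rfl⟩ := List.mem_map.1 hi
    obtain ⟨j, -, hj⟩ := List.mem_map.1 hi'
    have := List.idxOf_lt_length_iff.2 (hSD hv)
    omega

theorem prod_padded (hSD : S ⊆ D) (a : ℕ → Bool) {z : Word → ZMod 2}
    (hz : ∀ v ∈ D, z v = toZ (a (D.idxOf v))) :
    ((padded r D S).map fun i => if i < D.length ∧ a i = true then (-1 : ℤ) else 1).prod
      = sgn (lhs z S) := by
  rw [padded, List.map_append, List.prod_append, List.map_map, List.map_map, sgn_lhs]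
  have h1 : ((List.range r).filter fun j => decide (j < r - S.length)).map
      ((fun i => if i < D.length ∧ a i = true then (-1 : ℤ) else 1) ∘ fun j => j + D.length)
      = ((List.range r).filter fun j => decide (j < r - S.length)).map fun _ => (1 : ℤ) :=
    List.map_congr_left fun j _ => by simp
  rw [h1]
  simp only [List.map_const', List.prod_replicate, one_pow, mul_one]
  refine congrArg List.prod (List.map_congr_left fun v hv => ?_)
  have h2 := List.idxOf_lt_length_iff.2 (hSD hv)
  simp only [Function.comp, hz v (hSD hv)]
  cases a (D.idxOf v) <;> simp [h2, toZ]
  rfl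

end

/-! ### The formula given by a reduced system. -/

section
variable {r : ℕ} {R : System}

theorem mem_gadget (hR : Sound r R) {e : Eqn} (he : e ∈ R.1) {c : List (ℕ × Bool)}
    (hc : c ∈ gadget r R.2.1 e) : c.map Prod.fst = padded r R.2.1 e.1 := by
  simp only [gadget, List.mem_flatMap, List.mem_filter] at hc
  obtain ⟨-, -, hc, -⟩ := hc
  have h := length_padded (D := R.2.1) (hR.length_le e he)
  exact map_fst_of_mem_signings (by rwa [h])

theorem lt_of_mem_gadget (hR : Sound r R) {e : Eqn} (he : e ∈ R.1) {c : List (ℕ × Bool)}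
    (hc : c ∈ gadget r R.2.1 e) : ∀ l ∈ c, l.1 < R.2.1.length + r := fun l hl =>
  lt_of_mem_padded (r := r) (hR.subset e he) (by
    rw [← mem_gadget hR he hc]
    exact List.mem_map_of_mem hl)

def toClause (hR : Sound r R) (e : {e // e ∈ R.1}) (c : {c // c ∈ gadget r R.2.1 e.1}) :
    Clause r (R.2.1.length + r) where
  lits := c.1.pmap (fun l h => (⟨l.1, h⟩, l.2)) (lt_of_mem_gadget hR e.2 c.2)
  nodup := by
    have h := nodup_padded (r := r) (hR.nodup e.1 e.2) (hR.subset e.1 e.2)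
    rw [← mem_gadget hR e.2 c.2] at h
    refine List.Nodup.of_map (fun i : Fin _ => i.1) ?_
    rw [List.map_map, List.map_pmap]
    exact (List.pmap_eq_map (f := Prod.fst) _).symm ▸ h
  length_eq := by
    rw [List.length_pmap, ← List.length_map Prod.fst, mem_gadget hR e.2 c.2]
    exact length_padded (hR.length_le e.1 e.2)

def toSat (hR : Sound r R) : Formula r :=
  ⟨R.2.1.length + r, R.1.attach.flatMap fun e =>
    (gadget r R.2.1 e.1).attach.map (toClause hR e)⟩

theorem clauseExcess_toClause (hR : Sound r R) (e : {e // e ∈ R.1})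
    (c : {c // c ∈ gadget r R.2.1 e.1}) (a : ℕ → Bool) :
    clauseExcess (fun i : Fin _ => a i) (toClause hR e c)
      = 1 - (c.1.map fun l => if a l.1 = l.2 then (0 : ℤ) else 2).prod := by
  unfold clauseExcess toClause
  rw [List.map_pmap]
  exact congrArg (fun l : List ℤ => 1 - l.prod)
    (List.pmap_eq_map (f := fun l : ℕ × Bool => if a l.1 = l.2 then (0 : ℤ) else 2) _)

/-- If the equation holds, all `2 ^ (r - 1)` clauses of a copy are satisfied; otherwise exactly one
is falsified. The excess of a copy is therefore `2 ^ (r - 1)` or its negative. -/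
theorem sum_gadget (hr : 0 < r) (hR : Sound r R) {e : Eqn} (he : e ∈ R.1) (a : ℕ → Bool)
    {z : Word → ZMod 2} (hz : ∀ v ∈ R.2.1, z v = toZ (a (R.2.1.idxOf v))) :
    ((gadget r R.2.1 e).map fun c =>
      1 - (c.map fun l => if a l.1 = l.2 then (0 : ℤ) else 2).prod).sum
    = 2 ^ (r - 1) * (e.2.2 * sgn (lhs z e.1 + toZ e.2.1)) := by
  have hlen := length_padded (D := R.2.1) (hR.length_le e he)
  have hP : ∃ i ∈ padded r R.2.1 e.1, i < R.2.1.length := by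
    obtain ⟨v, hv⟩ := List.exists_mem_of_ne_nil _ (hR.ne_nil e he)
    exact ⟨_, List.mem_append_left _ (List.mem_map_of_mem hv),
      List.idxOf_lt_length_iff.2 (hR.subset e he hv)⟩
  have h := two_mul_sum_keeps a R.2.1.length e.2.1 (padded r R.2.1 e.1) hP
  rw [hlen, prod_padded (hR.subset e he) a hz] at h
  have h2 : (2 : ℤ) ^ r = 2 * 2 ^ (r - 1) := by
    rw [← pow_succ', Nat.sub_add_cancel hr]
  rw [h2, mul_assoc] at h
  have h3 := mul_left_cancel₀ (two_ne_zero) h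
  rw [gadget, sum_map_flatMap, h3, List.map_const', List.sum_replicate, List.length_replicate,
    sgn_add, nsmul_eq_mul]
  ring

theorem sum_toSat (hr : 0 < r) (hR : Sound r R) (a : ℕ → Bool) {z : Word → ZMod 2}
    (hz : ∀ v ∈ R.2.1, z v = toZ (a (R.2.1.idxOf v))) :
    ((toSat hR).clauses.map (clauseExcess fun i : Fin _ => a i)).sum
      = 2 ^ (r - 1) * excess z R.1 := by
  change ((R.1.attach.flatMap fun e => (gadget r R.2.1 e.1).attach.map (toClause hR e)).map
    (clauseExcess fun i : Fin _ => a i)).sum = _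
  rw [sum_map_flatMap, excess, ← List.sum_map_mul_left, ← sum_map_attach R.1]
  refine congrArg List.sum (List.map_congr_left fun e _ => ?_)
  rw [List.map_map, ← sum_gadget hr hR e.2 a hz, ← sum_map_attach (gadget r R.2.1 e.1)]
  exact congrArg List.sum (List.map_congr_left fun c _ => clauseExcess_toClause hR e c a)

theorem toSat_yes (hr : 0 < r) (hR : Sound r R) :
    (toSat hR).Yes (2 ^ (r - 1) * R.2.2) ↔ R.Yes := by
  have key : ∀ x : ℤ, ((2 ^ (r - 1) * R.2.2 : ℕ) : ℤ) ≤ 2 ^ (r - 1) * x ↔ (R.2.2 : ℤ) ≤ x := by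
    intro x
    push_cast
    exact mul_le_mul_iff_right₀ (by positivity)
  rw [Formula.yes_iff]
  constructor
  · rintro ⟨a', ha⟩
    let a : ℕ → Bool := fun i => if h : i < R.2.1.length + r then a' ⟨i, h⟩ else false
    have haa : a' = fun i : Fin _ => a i := by
      funext i
      have hi : i.1 < R.2.1.length + r := i.2
      change a' i = if h : i.1 < R.2.1.length + r then a' ⟨i.1, h⟩ else false
      rw [dif_pos hi]
    rw [haa, sum_toSat hr hR a (z := fun v => toZ (a (R.2.1.idxOf v))) fun v _ => rfl, key] at ha
    exact ⟨_, ha⟩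
  · rintro ⟨z, hz⟩
    let a : ℕ → Bool := fun i => decide (z (R.2.1.getD i []) = 1)
    refine ⟨fun i => a i, ?_⟩
    rwa [sum_toSat hr hR a (z := z), key]
    intro v hv
    have := List.idxOf_lt_length_iff.2 hv
    simp [a, toZ_decide, this]

theorem encPair_toSat (hR : Sound r R) :
    (maxExactSatAA r).encPair (toSat hR, 2 ^ (r - 1) * R.2.2) = satWord r R := by
  change encNat (2 ^ (r - 1) * R.2.2) ++ (encNat (R.2.1.length + r) ++
    (R.1.attach.flatMap fun e =>
      (gadget r R.2.1 e.1).attach.map (toClause hR e)).flatMap encClause) = _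
  rw [satWord, List.flatMap_assoc]
  refine congrArg (fun l => encNat (2 ^ (r - 1) * R.2.2) ++ (encNat (R.2.1.length + r) ++ l)) ?_
  rw [← flatMap_attach R.1]
  refine List.flatMap_congr fun e _ => ?_
  rw [List.flatMap_map, ← flatMap_attach (gadget r R.2.1 e.1)]
  refine List.flatMap_congr fun c _ => ?_
  simp only [encClause, toClause]
  refine congrArg (fun l => Γ'.bra :: (l ++ [Γ'.ket])) ?_
  rw [List.flatMap_def, List.flatMap_def, List.map_pmap]
  exact congrArg List.flatten
    (List.pmap_eq_map (f := fun l : ℕ × Bool => Γ'.bit l.2 :: encNat l.1) _)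

theorem length_gadget_le (r : ℕ) (D : List Word) (e : Eqn) :
    (gadget r D e).length ≤ e.2.2 * 2 ^ r := by
  have h := length_flatMap_le (List.replicate e.2.2 ()) (fun _ =>
    (signings r (padded r D e.1)).filter fun c => keeps D.length e.2.1 c) (m := 2 ^ r) fun _ _ =>
      (List.length_filter_le _ _).trans (length_signings_le _ _)
  rwa [List.length_replicate] at h

end

theorem hasKernel_maxExactSatAA {r : ℕ} (hr : 0 < r) : HasKernelKLogK (maxExactSatAA r) := by
  let N : ℕ → ℕ := fun k => varBound r k + r + 1
  refine ⟨fun p => (toSat (sound_reduce p), 2 ^ (r - 1) * (reduce r (parsed p)).2.2),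
    ⟨polyTime_of_PT (pt_satWord r) fun p => (encPair_toSat (sound_reduce p)).symm, fun p => ?_,
      ⟨fun k => 2 ^ (r - 1) * k, fun p => Nat.mul_le_mul_left _ (reduce_param_le p)⟩,
      ⟨fun k => N k + (varBound r k + 1) ^ r * ((k * 2 ^ r) * (r * (N k + 1) + 2)),
        fun p => ?_⟩⟩,
    fun k => 1 * varBound r k + 0 * k + r, isBigO_varBound r 1 0 r, fun p => ?_⟩
  · exact (reduce_yes p).symm.trans (toSat_yes hr (sound_reduce p)).symm
  · have hN : (reduce r (parsed p)).2.1.length + r + 1 ≤ N p.2 := by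
      have := reduce_vars_le p
      simp only [N]
      omega
    change (encNat ((reduce r (parsed p)).2.1.length + r) ++
      ((reduce r (parsed p)).1.attach.flatMap fun e =>
        (gadget r (reduce r (parsed p)).2.1 e.1).attach.map
          (toClause (sound_reduce p) e)).flatMap encClause).length ≤ _
    rw [List.length_append, List.flatMap_assoc]
    refine Nat.add_le_add ((length_encNat_le _).trans hN) ?_
    refine (length_flatMap_le _ _ (m := (p.2 * 2 ^ r) * (r * (N p.2 + 1) + 2)) ?_).trans ?_
    · intro e _
      refine (length_flatMap_le _ _ (m := r * (N p.2 + 1) + 2) ?_).trans ?_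
      · intro C _
        have h := length_flatMap_le C.lits encLit (m := N p.2 + 1) fun l _ => by
          have h1 := length_encNat_le l.1
          have h2 := l.1.2
          simp only [encLit, List.length_cons]
          omega
        rw [C.length_eq] at h
        simp only [encClause, List.length_cons, List.length_append, List.length_nil]
        omega
      · rw [List.length_map, List.length_attach]
        exact Nat.mul_le_mul_right _ ((length_gadget_le _ _ _).trans
          (Nat.mul_le_mul_right _ (reduce_weight_le p e.1 e.2)))
    · rw [List.length_attach]
      exact Nat.mul_le_mul_right _ (reduce_eqns_le p)
  · have : (reduce r (parsed p)).2.1.length + r ≤ 1 * varBound r p.2 + 0 * p.2 + r := by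
      have := reduce_vars_le p
      omega
    exact this

end MaxExactSat

/-! ### The decision algorithm -/

namespace MaxExactSat

open StackProg LinExcess

section
variable {r : ℕ} {R : System}

theorem filter_mem_sublistsOf (D : List Word) (p : Word → Bool) : D.filter p ∈ sublistsOf D := by
  induction D with
  | nil => simp [sublistsOf]
  | cons v D ih =>
    have h : sublistsOf (v :: D) = sublistsOf D ++ (sublistsOf D).map fun A => v :: A := rfl
    rw [h, List.mem_append, List.mem_map]
    cases hv : p v
    · left
      rwa [List.filter_cons_of_neg (by simp [hv])]
    · right
      exact ⟨_, ih, by rw [List.filter_cons_of_pos hv]⟩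

theorem sgn_holds (A : List Word) (e : Eqn) :
    sgn (lhs (fun v => toZ (decide (v ∈ A))) e.1 + toZ e.2.1) = if holds A e then 1 else -1 := by
  obtain ⟨S, b, w⟩ := e
  have key : toZ (holds A (S, b, w))
      = lhs (fun v => toZ (decide (v ∈ A))) S + toZ b + 1 := by
    induction S with
    | nil =>
      have h : ∀ b : Bool, toZ (!b) = 0 + toZ b + 1 := by decide
      exact h b
    | cons v S ih =>
      have h : holds A (v :: S, b, w) = Bool.xor (holds A (S, b, w)) (decide (v ∈ A)) := rfl
      rw [h, toZ_xor, ih, lhs, lhs, List.map_cons, List.sum_cons]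
      ring
  have h2 : ∀ (x : ZMod 2) (c : Bool), toZ c = x + 1 → sgn x = if c then 1 else -1 := by decide
  exact h2 _ _ key

theorem reaches_iff (M : List Eqn) (k : ℕ) (A : List Word) : reaches M k A = true ↔
    (k : ℤ) ≤ excess (fun v => toZ (decide (v ∈ A))) M := by
  have h : excess (fun v => toZ (decide (v ∈ A))) M
      = (((M.filter fun e => holds A e).map fun e => e.2.2).sum : ℕ)
        - (((M.filter fun e => !holds A e).map fun e => e.2.2).sum : ℕ) := by
    unfold excess
    induction M with
    | nil => rfl
    | cons e M ih =>
      rw [List.map_cons, List.sum_cons, ih, sgn_holds]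
      cases he : holds A e
      · simp [he]
        ring
      · simp [he]
        ring
  rw [h, reaches, decide_eq_true_iff]
  omega

theorem solve_iff (hR : Sound r R) : solve R = true ↔ R.Yes := by
  rw [solve, List.any_eq_true]
  constructor
  · rintro ⟨A, -, hA⟩
    exact ⟨_, (reaches_iff _ _ _).1 hA⟩
  · rintro ⟨z, hz⟩
    refine ⟨_, filter_mem_sublistsOf R.2.1 fun v => decide (z v = 1), (reaches_iff _ _ _).2 ?_⟩
    rwa [excess_congr (z' := z)]
    intro e he v hv
    have : decide (v ∈ R.2.1.filter fun v => decide (z v = 1)) = decide (z v = 1) := by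
      rw [decide_eq_decide, List.mem_filter, decide_eq_true_iff]
      exact and_iff_right (hR.subset e he hv)
    rw [this, toZ_decide]

end

/-- Here the second function may have its own, non-polynomial bound; needed to run the exhaustive
search on the reduced system. -/
theorem _root_.StackProg.PTB.comp_of_bound {α β γ : Type} [Enc α] [Enc β] [Enc γ] {B : α → ℕ}
    {B' : β → ℕ} {f : α → β} {g : β → γ} (hg : PTB B' g) (hf : PTB B f)
    (hB : PolyBdd B fun a => B' (f a)) : PTB B (fun x => g (f x)) := by
  obtain ⟨⟨p, T, hp, hT⟩, hs, -⟩ := hf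
  obtain ⟨⟨q, U, hq, hU⟩, -, hs'⟩ := hg
  exact ⟨⟨.seq p q, fun a => T a + U (f a), fun a e x y => (hp a e x y).seq (hq _ e x y),
    hT.add (hU.comp hB)⟩, hs, hs'.comp hB⟩

theorem ptb_solve_reduce (r : ℕ) :
    PTB (fun s : List Word × List (List Word) => size s + 2 ^ (reduce r s).2.1.length)
      (fun s => solve (reduce r s)) := by
  have h1 := PTB.of_PT (B := fun s : List Word × List (List Word) =>
    size s + 2 ^ (reduce r s).2.1.length) (pt_reduce r)
    (PolyBdd.self.mono fun s => Nat.le_add_right _ _)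
  exact PTB.comp_of_bound ptb_solve h1
    (h1.2.2.add (PolyBdd.self.mono fun s => Nat.le_add_left _ _))

theorem size_foldr_readStep_le (w : List Γ') :
    size (w.foldr readStep ([], [])) ≤ 7 * w.length + 3 := by
  induction w with
  | nil => simp
  | cons a w ih =>
    have := size_readStep_le a (w.foldr readStep ([], []))
    rw [List.foldr_cons, List.length_cons]
    omega

theorem ParamProblem.SolvesIn.mono {L : ParamProblem} {M : TM2ComputableAux Γ' Bool} {x : L.Inst}
    {k t t' : ℕ} (h : L.SolvesIn M x k t) (ht : t ≤ t') : L.SolvesIn M x k t' := by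
  obtain ⟨b, hb, ⟨h⟩⟩ := h
  exact ⟨b, hb, ⟨⟨h.toEvalsTo, h.steps_le_m.trans ht⟩⟩⟩

/-- The running time in terms of the length of the input. -/
theorem exists_decider (r : ℕ) : ∃ (M : TM2ComputableAux Γ' Bool) (c : ℕ),
    ∀ (F : Formula r) (k : ℕ), (maxExactSatAA r).SolvesIn M F k
      ((8 * ((maxExactSatAA r).encPair (F, k)).length + 5 + 2 ^ varBound r k) ^ c) := by
  obtain ⟨M, c, hM⟩ := exists_machine_bool pt_readStep size_readStep_le ([], [])
    (ptb_solve_reduce r)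
  refine ⟨M, c, fun F k => ?_⟩
  have h1 := hM ((maxExactSatAA r).encPair (F, k))
  have h2 : ((maxExactSatAA r).encPair (F, k)).foldr readStep ([], []) = parsed (F, k) :=
    foldr_readStep_encPair (F, k)
  have h3 := size_foldr_readStep_le ((maxExactSatAA r).encPair (F, k))
  rw [h2] at h1 h3
  refine ParamProblem.SolvesIn.mono
    ⟨_, (solve_iff (sound_reduce (F, k))).trans (reduce_yes (F, k)), h1⟩ ?_
  refine Nat.pow_le_pow_left ?_ c
  have h4 : 2 ^ (reduce r (parsed (F, k))).2.1.length ≤ 2 ^ varBound r k :=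
    Nat.pow_le_pow_right (by norm_num) (reduce_vars_le (F, k))
  omega

/-! ### The running time in terms of `k` and the number of clauses. -/

theorem Formula.AllOccur.n_le {r : ℕ} {F : Formula r} (hF : F.AllOccur) : F.n ≤ F.m * r := by
  classical
  have h1 : (Finset.univ : Finset (Fin F.n)) ⊆
      (F.clauses.flatMap fun C => C.lits.map Prod.fst).toFinset := fun i _ => by
    rw [List.mem_toFinset, List.mem_flatMap]
    exact hF i
  have h2 := (Finset.card_le_card h1).trans (List.toFinset_card_le _)
  rw [Finset.card_univ, Fintype.card_fin] at h2
  exact h2.trans (length_flatMap_le _ _ fun C _ => by rw [List.length_map, C.length_eq])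

/-- If all variables occur, `n ≤ r * m`, so the word is polynomial in `m` apart from the code of
`k`. -/
theorem Formula.AllOccur.length_encPair_le {r : ℕ} {F : Formula r} (hF : F.AllOccur) (k : ℕ) :
    ((maxExactSatAA r).encPair (F, k)).length ≤ k + 2 + (r ^ 2 + 2 * r + 2) * F.m ^ 2 := by
  have h1 : (F.clauses.flatMap encClause).length ≤ F.m * (r * (F.n + 1) + 2) := by
    refine length_flatMap_le _ _ fun C _ => ?_
    have h := length_flatMap_le C.lits encLit (m := F.n + 1) fun l _ => by
      have h1 := length_encNat_le l.1
      have h2 := l.1.2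
      simp only [encLit, List.length_cons]
      omega
    rw [C.length_eq] at h
    simp only [encClause, List.length_cons, List.length_append, List.length_nil]
    omega
  have h2 := length_encNat_le F.n
  have h3 := length_encNat_le k
  have h4 : ((maxExactSatAA r).encPair (F, k)).length
      = (encNat k).length + ((encNat F.n).length + (F.clauses.flatMap encClause).length) := by
    change (encNat k ++ (encNat F.n ++ F.clauses.flatMap encClause)).length = _
    rw [List.length_append, List.length_append]
  have h5 := hF.n_le
  have h6 : F.m * (r * (F.n + 1) + 2) ≤ F.m * (r * (F.m * r + 1) + 2) := by gcongr
  have h7 : F.m ≤ F.m ^ 2 := Nat.le_self_pow (by norm_num) _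
  have h8 : F.m * (r * (F.m * r + 1) + 2) = r ^ 2 * F.m ^ 2 + (r + 2) * F.m := by ring
  have h9 : (r + 2) * F.m ≤ (r + 2) * F.m ^ 2 := Nat.mul_le_mul_left _ h7
  have h10 : F.m * r ≤ r * F.m ^ 2 := by rw [mul_comm]; exact Nat.mul_le_mul_left _ h7
  have h11 : (r ^ 2 + 2 * r + 2) * F.m ^ 2
      = r ^ 2 * F.m ^ 2 + (r + 2) * F.m ^ 2 + r * F.m ^ 2 := by ring
  omega

/-- Splits the power of a sum into a part for the input length and a part for `2 ^ varBound`. -/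
theorem add_pow_le_two_mul (x y c : ℕ) : (x + y) ^ c ≤ (2 * x) ^ c + (2 * y) ^ c := by
  rcases le_total x y with h | h
  · exact (Nat.pow_le_pow_left (by omega) c).trans (Nat.le_add_left _ _)
  · exact (Nat.pow_le_pow_left (by omega) c).trans (Nat.le_add_right _ _)

theorem add_le_two_pow {k x : ℕ} : 8 * k + 21 + 2 ^ x ≤ 2 ^ (k + x + 6) := by
  have h1 : k < 2 ^ k := Nat.lt_two_pow_self
  have h2 : 1 ≤ 2 ^ x := Nat.one_le_two_pow
  have h3 : 1 ≤ 2 ^ k := Nat.one_le_two_pow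
  have h4 : 2 ^ (k + x + 6) = 2 ^ k * 2 ^ x * 64 := by rw [pow_add, pow_add]; norm_num
  have h5 : 2 ^ k ≤ 2 ^ k * 2 ^ x := Nat.le_mul_of_pos_right _ h2
  have h6 : 2 ^ x ≤ 2 ^ k * 2 ^ x := Nat.le_mul_of_pos_left _ h3
  omega

theorem solvableKLogK (r : ℕ) : SolvableKLogK r := by
  obtain ⟨M, c, hM⟩ := exists_decider r
  set K := r ^ 2 + 2 * r + 2 with hK
  refine ⟨M, fun k => c * varBound r k + c * k + (7 * c + 16 * K * c + 1), 6 * c + (16 * K + 2) * c,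
    isBigO_varBound r c c _, fun F k => ⟨(hM F k).mono ?_, fun hF => (hM F k).mono ?_⟩⟩
  · set N := ((maxExactSatAA r).encPair (F, k)).length with hN
    -- The word contains two commas; thus powers of `N` absorb constants.
    have h2 : 2 ≤ N := by
      have : N = (encNat k).length + ((encNat F.n).length +
          (F.clauses.flatMap encClause).length) := by
        change (encNat k ++ (encNat F.n ++ F.clauses.flatMap encClause)).length = _
        rw [List.length_append, List.length_append]
      simp only [encNat, List.length_append, List.length_singleton] at this
      omega
    have h3 : 2 * (8 * N + 5) ≤ N ^ 6 := by
      have : 2 ^ 5 ≤ N ^ 5 := Nat.pow_le_pow_left h2 5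
      calc 2 * (8 * N + 5) ≤ 2 ^ 5 * N := by omega
        _ ≤ N ^ 5 * N := Nat.mul_le_mul_right _ this
        _ = N ^ 6 := by ring
    calc (8 * N + 5 + 2 ^ varBound r k) ^ c
        ≤ (2 * (8 * N + 5)) ^ c + (2 * 2 ^ varBound r k) ^ c := add_pow_le_two_mul _ _ _
      _ ≤ (N ^ 6) ^ c + 2 ^ ((varBound r k + 1) * c) := by
        refine Nat.add_le_add (Nat.pow_le_pow_left h3 c) ?_
        rw [pow_mul, pow_succ']
      _ ≤ N ^ (6 * c + (16 * K + 2) * c) +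
          2 ^ (c * varBound r k + c * k + (7 * c + 16 * K * c + 1)) := by
        refine Nat.add_le_add ?_ (Nat.pow_le_pow_right (by norm_num) ?_)
        · rw [← pow_mul]
          exact Nat.pow_le_pow_right (by omega) (Nat.le_add_right _ _)
        · rw [Nat.add_mul, mul_comm (varBound r k)]
          omega
      _ = _ := Nat.add_comm _ _
  · have h1 := hF.length_encPair_le k
    rw [← hK] at h1
    set m := F.m with hm
    have h2 : (16 * K * m ^ 2) ^ c ≤ 2 ^ (16 * K * c) + m ^ (6 * c + (16 * K + 2) * c) := by
      have h3 : 16 * K ≤ 2 ^ (16 * K) := Nat.lt_two_pow_self.le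
      -- For `m ≤ 1` powers of `m` absorb nothing, and the constant goes into the exponent of two;
      -- for `m ≥ 2` a power of `m` absorbs it.
      rcases le_or_gt m 1 with h | h
      · refine le_trans ?_ (Nat.le_add_right _ _)
        rw [pow_mul]
        refine Nat.pow_le_pow_left (le_trans ?_ h3) c
        exact (Nat.mul_le_mul_left _ (Nat.pow_le_pow_left h 2)).trans_eq (by ring)
      · refine le_trans ?_ (Nat.le_add_left _ _)
        calc (16 * K * m ^ 2) ^ c ≤ (m ^ (16 * K) * m ^ 2) ^ c := by
              refine Nat.pow_le_pow_left (Nat.mul_le_mul_right _ ?_) c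
              exact h3.trans (Nat.pow_le_pow_left h _)
          _ = m ^ ((16 * K + 2) * c) := by rw [← pow_add, pow_mul]
          _ ≤ _ := Nat.pow_le_pow_right (by omega) (Nat.le_add_left _ _)
    have h4 : (2 * (8 * k + 21 + 2 ^ varBound r k)) ^ c ≤ 2 ^ ((k + varBound r k + 7) * c) := by
      rw [pow_mul]
      refine Nat.pow_le_pow_left ?_ c
      rw [pow_succ']
      exact Nat.mul_le_mul_left _ add_le_two_pow
    have h5 : (k + varBound r k + 7) * c + 16 * K * c + 1
        = c * varBound r k + c * k + (7 * c + 16 * K * c + 1) := by ring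
    calc _ ≤ (8 * k + 21 + 2 ^ varBound r k + 8 * K * m ^ 2) ^ c :=
          Nat.pow_le_pow_left (by
            have : 8 * K * m ^ 2 = 8 * (K * m ^ 2) := by ring
            omega) c
      _ ≤ (2 * (8 * k + 21 + 2 ^ varBound r k)) ^ c + (2 * (8 * K * m ^ 2)) ^ c :=
        add_pow_le_two_mul _ _ _
      _ ≤ 2 ^ ((k + varBound r k + 7) * c) +
          (2 ^ (16 * K * c) + m ^ (6 * c + (16 * K + 2) * c)) := by
        refine Nat.add_le_add h4 (le_trans (Nat.pow_le_pow_left (le_of_eq ?_) c) h2)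
        ring
      _ ≤ _ := by
        beta_reduce
        rw [← h5, ← Nat.add_assoc]
        refine Nat.add_le_add_right ?_ _
        rw [pow_succ, pow_add]
        have h6 : 1 ≤ 2 ^ ((k + varBound r k + 7) * c) := Nat.one_le_two_pow
        have h7 : 1 ≤ 2 ^ (16 * K * c) := Nat.one_le_two_pow
        have h8 := Nat.le_mul_of_pos_right (2 ^ ((k + varBound r k + 7) * c)) h7
        have h9 := Nat.le_mul_of_pos_left (2 ^ (16 * K * c)) h6
        omega

end MaxExactSat

theorem mainTheorem8 (r : ℕ) (hr : 2 ≤ r) :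
    MaxExactSat.HasBikernelKLogK (MaxExactSat.maxExactSatAA r) (MaxExactSat.maxLinAA r) ∧
    MaxExactSat.HasKernelKLogK (MaxExactSat.maxExactSatAA r) ∧
    MaxExactSat.SolvableKLogK r :=
  ⟨MaxExactSat.hasBikernel_maxLinAA r, MaxExactSat.hasKernel_maxExactSatAA (by omega),
    MaxExactSat.solvableKLogK r⟩
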